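/- Let $l\ge 0$, $K=\mathbf C$, and let $Q_l$ be the quiver with vertices $1,\dots,l,\omega,l^*,\dots,1^*$ and arrows $$1\xrightarrow{a_1}2\xrightarrow{a_2}\cdots\xrightarrow{a_{l-1}} l\xrightarrow{a_l}\omega\xrightarrow{a_l^*}l^*\xrightarrow{a_{l-1}^*}\cdots\xrightarrow{a_1^*}1^*,\qquad \alpha:\omega\to\omega .$$ Let $A(l)=KQ_l/(\alpha^2,\,a_l^*a_l)$, and write $l+1:=\omega=:(l+1)^*$. Let $\sigma$ be the involution of $Q_l$ with $i\leftrightarrow i^*$, $a_i\leftrightarrow a_i^*$, $\sigma(\omega)=\omega$, $\sigma(\alpha)=\alpha$. A symplectic (respectively orthogonal) representation of $A(l)$ is a finite-dimensional representation $M$ of $A(l)$ with a non-degenerate skew-symmetric (respectively symmetric) bilinear form $\langle-,-\rangle$ on $\bigoplus_p M_p$ such that $\langle M_p,M_q\rangle=0$ unless $q=\sigma(p)$, and $\langle M_\beta v,w\rangle+\langle v,M_{\sigma(\beta)}w\rangle=0$ for every arrow $\beta:p\to q$, $v\in M_p$, $w\in M_{\sigma(q)}$. It is called indecomposable if it is nonzero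 and is not the orthogonal direct sum of two nonzero subrepresentations. Isomorphisms of symplectic (orthogonal) representations are isomorphisms of representations that preserve the forms. Consider the following representations of $A(l)$, each given by a coefficient quiver (a basis, with every drawn arrow mapping one basis vector to another and everything not drawn being $0$). Rows are joined by the arrows $a_k$ or $a_k^*$, and one arrow $\alpha$ joins the $\omega$'s of two rows: * $M_{ij}$ and $M_{ij}^*$ $(1\le i\le j\le l+1)$: one row $i\to\cdots\to j$, respectively $j^*\to\cdots\to i^*$; * $D_{ij}^{\pm}$: rows $i\to\cdots\to\omega$ and $j\to\cdots\to\omega$, with $\alpha$ from the second row to the first for $D_{ij}^+$ $(1\le i\le j\le l+1)$, and from the first to the second for $D_{ij}^-$ $(1\le i<j\le l+1)$; * $C_{ij}^{\pm}$: rows $\omega\to\cdots\to i^*$ and $\omega\to\cdots\to j^*$, with $\alpha$ from the first row to the second for $C_{ij}^+$ $(1\le i\le j\le l+1)$, and from the second to the first for $C_{ij}^-$ $(1\le i<j\le l+1)$; * $Z_{ij}^{\pm}$ $(1\le i,j\le l)$: rows $i\to\cdots\to\omega$ and $\omega\to\cdots\to j^*$, with $\alpha$ from the second row to the first for $Z_{ij}^+$,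 and from the first to the second for $Z_{ij}^-$. Then the following classification holds. **Symplectic case.** The indecomposable symplectic representations of $A(l)$ are, up to isomorphism, $Z_{ii}^\pm$; $M_{ij}\oplus M_{ij}^*$; $D_{ij}^\pm\oplus C_{ij}^\pm$ for $(i,j)\ne(l+1,l+1)$; $D_{l+1,l+1}^+$; and $Z_{ij}^\pm\oplus Z_{ji}^\pm$ for $i\ne j$. **Orthogonal case.** The indecomposable orthogonal representations of $A(l)$ are, up to isomorphism, $M_{ij}\oplus M_{ij}^*$ for $(i,j)\neq(l+1,l+1)$; $D_{ij}^\pm\oplus C_{ij}^\pm$; $Z_{ij}^\pm\oplus Z_{ji}^\pm$ (including $i=j$); and $M_{l+1,l+1}$. In both cases this means: (a) a symplectic (orthogonal) representation is indecomposable if and only if its underlying representation is isomorphic to one in the list; (b) every representation in the list carries a symplectic (orthogonal) structure; (c) this structure is unique up to isomorphism: two indecomposable symplectic (orthogonal) representations whose underlying representations are isomorphic are isomorphic as symplectic (orthogonal) representations. -/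

import Mathlib

open scoped DirectSum

universe w

/-! ### Quiver representations -/

/-- A finite-dimensional `K`-representation of a quiver: a vector space at every vertex and a
linear map for every arrow. -/
structure QuiverRep (K : Type*) [Field K] (V : Type*) [Quiver V] where
  space : V → Type w
  [addCommGroup : ∀ p, AddCommGroup (space p)]
  [module : ∀ p, Module K (space p)]
  [finiteDimensional : ∀ p, FiniteDimensional K (space p)]
  map : ∀ {p q : V}, (p ⟶ q) → (space p →ₗ[K] space q)

attribute [instance] QuiverRep.addCommGroup QuiverRep.module QuiverRep.finiteDimensional

namespace QuiverRep

variable {K : Type*} [Field K] {V : Type*} [Quiver V]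

/-- The family of linear isomorphisms `e` is an isomorphism of representations. -/
def IsIsomorphism (M N : QuiverRep K V) (e : ∀ p, M.space p ≃ₗ[K] N.space p) : Prop :=
  ∀ (p q : V) (a : p ⟶ q) (x : M.space p), e q (M.map a x) = N.map a (e p x)

/-- Two representations are isomorphic. -/
def Isomorphic (M N : QuiverRep K V) : Prop :=
  ∃ e : ∀ p, M.space p ≃ₗ[K] N.space p, IsIsomorphism M N e

/-- The direct sum of two representations. -/
def directSum (M N : QuiverRep K V) : QuiverRep K V where
  space p := M.space p × N.space p
  map a := (M.map a).prodMap (N.map a)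

/-- A family of subspaces that is stable under all arrows. -/
def IsSubrep (M : QuiverRep K V) (U : ∀ p, Submodule K (M.space p)) : Prop :=
  ∀ (p q : V) (a : p ⟶ q), ∀ x ∈ U p, M.map a x ∈ U q

end QuiverRep

/-! ### Symmetric quivers and their symplectic and orthogonal representations -/

/-- A symmetric quiver: an involution `σ` of the vertices and arrows which sends `a : p ⟶ q` to
`σ a : σ q ⟶ σ p`. -/
class SymmetricQuiver (V : Type*) [Quiver V] where
  vert : V → V
  arrow : ∀ {p q : V}, (p ⟶ q) → (vert q ⟶ vert p)
  vert_vert : ∀ p, vert (vert p) = p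
  arrow_arrow : ∀ {p q : V} (a : p ⟶ q), HEq (arrow (arrow a)) a

namespace QuiverRep

variable {K : Type*} [Field K] {V : Type*} [Quiver V] [DecidableEq V]

/-- Bilinear forms on the total space `⨁ p, M_p`. -/
abbrev Form (M : QuiverRep K V) := LinearMap.BilinForm K (⨁ p, M.space p)

/-- The value of a form on a vector `x` at the vertex `p` and a vector `y` at the vertex `q`. -/
abbrev pair (M : QuiverRep K V) (B : M.Form) {p q : V} (x : M.space p) (y : M.space q) : K :=
  B (DirectSum.lof K V M.space p x) (DirectSum.lof K V M.space q y)

/-- `B` makes `M` a symmetric representation of the symmetric quiver `V`. -/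
structure IsSymmetricRep [SymmetricQuiver V] (M : QuiverRep K V) (B : M.Form) : Prop where
  nondegenerate : B.Nondegenerate
  vanish : ∀ (p q : V), q ≠ SymmetricQuiver.vert p →
    ∀ (x : M.space p) (y : M.space q), M.pair B x y = 0
  compat : ∀ (p q : V) (a : p ⟶ q) (v : M.space p) (w : M.space (SymmetricQuiver.vert q)),
    M.pair B (M.map a v) w + M.pair B v (M.map (SymmetricQuiver.arrow a) w) = 0

/-- A symplectic representation: a symmetric one whose form is skew-symmetric. -/
def IsSymplectic [SymmetricQuiver V] (M : QuiverRep K V) (B : M.Form) : Prop :=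
  M.IsSymmetricRep B ∧ ∀ x y, B x y = - B y x

/-- An orthogonal representation: a symmetric one whose form is symmetric. -/
def IsOrthogonal [SymmetricQuiver V] (M : QuiverRep K V) (B : M.Form) : Prop :=
  M.IsSymmetricRep B ∧ ∀ x y, B x y = B y x

/-- Isomorphism of representations with forms: an isomorphism of representations which preserves
the forms. -/
def Isometric (M : QuiverRep K V) (B : M.Form) (N : QuiverRep K V) (C : N.Form) : Prop :=
  ∃ e : ∀ p, M.space p ≃ₗ[K] N.space p, IsIsomorphism M N e ∧
    ∀ (p q : V) (x : M.space p) (y : M.space q), N.pair C (e p x) (e q y) = M.pair B x y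

/-- Indecomposability as a representation with a form: `M` is nonzero and is not the orthogonal
direct sum of two nonzero subrepresentations. -/
def FormIndecomposable (M : QuiverRep K V) (B : M.Form) : Prop :=
  (∃ p, Nontrivial (M.space p)) ∧
  ∀ U W : ∀ p, Submodule K (M.space p), M.IsSubrep U → M.IsSubrep W →
    (∀ p, IsCompl (U p) (W p)) →
    (∀ (p q : V), ∀ x ∈ U p, ∀ y ∈ W q, M.pair B x y = 0 ∧ M.pair B y x = 0) →
    (∀ p, U p = ⊥) ∨ (∀ p, W p = ⊥)

end QuiverRep

/-! ### Coefficient quivers -/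

/-- A coefficient quiver over the quiver `V`: finitely many basis vectors `basis p` at every vertex
`p`; `edge a b c` means that there is an arrow `b ⟶ c` coloured with `a`. -/
structure CoeffQuiver (V : Type*) [Quiver V] where
  basis : V → Type
  [fintype : ∀ p, Fintype (basis p)]
  edge : ∀ {p q : V}, (p ⟶ q) → basis p → basis q → Prop

attribute [instance] CoeffQuiver.fintype

open Classical in
/-- The representation with a given coefficient quiver in which all arrows act as `1`: the arrow `a`
sends the basis vector `b` to the sum of all `c` with `edge a b c`. -/
noncomputable def CoeffQuiver.rep {V : Type*} [Quiver V] (Γ : CoeffQuiver V) (K : Type) [Field K] :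
    QuiverRep K V where
  space p := Γ.basis p → K
  map a := Matrix.mulVecLin (Matrix.of fun c b => if Γ.edge a b c then 1 else 0)

/-! ### The quiver `Q_l` -/

namespace AL

/-- The vertices `1, …, l, ω, l*, …, 1*` of `Q_l`, in this order numbered `1, …, 2l + 1`. So `i` has
number `i`, `ω` has number `l + 1`, and `i*` has number `2l + 2 - i`. -/
@[ext]
structure Vertex (l : ℕ) where
  num : ℕ
  one_le : 1 ≤ num
  le : num ≤ 2 * l + 1
  deriving DecidableEq

/-- The arrows of `Q_l`: one from each vertex to the next one (these are `a_1, …, a_l` and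
`a_l*, …, a_1*`) and the loop `α` at `ω`. -/
inductive Arrow (l : ℕ) : Vertex l → Vertex l → Type
  | step {p q : Vertex l} (h : p.num + 1 = q.num) : Arrow l p q
  | loop {p q : Vertex l} (hp : p.num = l + 1) (hq : q.num = l + 1) : Arrow l p q

instance (l : ℕ) : Quiver (Vertex l) where
  Hom p q := Arrow l p q

/-- The involution on vertices: `i ↦ i*`, `i* ↦ i`, `ω ↦ ω`. -/
def starVertex {l : ℕ} (p : Vertex l) : Vertex l :=
  ⟨2 * l + 2 - p.num, by have := p.le; omega, by have := p.one_le; omega⟩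

theorem starVertex_starVertex {l : ℕ} (p : Vertex l) : starVertex (starVertex p) = p := by
  have := p.le
  apply Vertex.ext
  simp only [starVertex]
  omega

/-- The involution on arrows: `a_i ↦ a_i*`, `a_i* ↦ a_i`, `α ↦ α`. -/
def starArrow {l : ℕ} {p q : Vertex l} : Arrow l p q → Arrow l (starVertex q) (starVertex p)
  | .step h => .step (by have := p.le; have := q.le; simp only [starVertex]; omega)
  | .loop hp hq => .loop (by simp only [starVertex]; omega) (by simp only [starVertex]; omega)

theorem step_heq {l : ℕ} {p q p' q' : Vertex l} (hp : p' = p) (hq : q' = q)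
    (h : p.num + 1 = q.num) (h' : p'.1 + 1 = q'.1) :
    HEq (Arrow.step h') (Arrow.step h) := by
  subst hp hq; rfl

theorem loop_heq {l : ℕ} {p q p' q' : Vertex l} (hp : p' = p) (hq : q' = q)
    (h1 : p.num = l + 1) (h2 : q.num = l + 1) (h1' : p'.1 = l + 1) (h2' : q'.1 = l + 1) :
    HEq (Arrow.loop h1' h2') (Arrow.loop h1 h2) := by
  subst hp hq; rfl

instance (l : ℕ) : SymmetricQuiver (Vertex l) where
  vert := starVertex
  arrow := starArrow
  vert_vert := starVertex_starVertex
  arrow_arrow {p q} (a : Arrow l p q) := by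
    cases a with
    | step h => exact step_heq (starVertex_starVertex p) (starVertex_starVertex q) _ _
    | loop hp hq => exact loop_heq (starVertex_starVertex p) (starVertex_starVertex q) _ _ _ _

/-- The representation satisfies the relations `α² = 0` and `a_l* a_l = 0`, that is, it is a
representation of `A(l)`. -/
def IsBound {K : Type*} [Field K] {l : ℕ} (M : QuiverRep K (Vertex l)) : Prop :=
  (∀ (ω : Vertex l) (h : ω.num = l + 1) (x : M.space ω),
    M.map (Arrow.loop h h : ω ⟶ ω) (M.map (Arrow.loop h h : ω ⟶ ω) x) = 0) ∧
  (∀ (p ω q : Vertex l) (_ : ω.num = l + 1) (h₁ : p.num + 1 = ω.num) (h₂ : ω.num + 1 = q.num)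
    (x : M.space p), M.map (Arrow.step h₂ : ω ⟶ q) (M.map (Arrow.step h₁ : p ⟶ ω) x) = 0)

/-- `(M, B)` is a symplectic representation of `A(l)`. -/
def IsSymplecticRep {K : Type*} [Field K] {l : ℕ} (M : QuiverRep K (Vertex l)) (B : M.Form) :
    Prop :=
  IsBound M ∧ M.IsSymplectic B

/-- `(M, B)` is an orthogonal representation of `A(l)`. -/
def IsOrthogonalRep {K : Type*} [Field K] {l : ℕ} (M : QuiverRep K (Vertex l)) (B : M.Form) :
    Prop :=
  IsBound M ∧ M.IsOrthogonal B

/-! ### The string modules -/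

/-- The coefficient quiver consisting of one row
`lo ⟶ lo + 1 ⟶ ⋯ ⟶ hi` of vertices (in the numbering `1, …, 2l + 1`), without arrow `α`. -/
def oneRow (l lo hi : ℕ) : CoeffQuiver (Vertex l) where
  basis p := {_r : Unit // lo ≤ p.num ∧ p.num ≤ hi}
  edge a _ _ := match a with
    | .step _ => True
    | .loop _ _ => False

/-- The coefficient quiver consisting of a row `0` with vertices `lo₀ ⟶ ⋯ ⟶ hi₀`, a row `1` with
vertices `lo₁ ⟶ ⋯ ⟶ hi₁`, and an arrow coloured `α` from the `ω` of row `0` to the `ω` of row `1`. -/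
def twoRows (l lo₀ hi₀ lo₁ hi₁ : ℕ) : CoeffQuiver (Vertex l) where
  basis p := {r : Fin 2 // if r = 0 then lo₀ ≤ p.num ∧ p.num ≤ hi₀ else lo₁ ≤ p.num ∧ p.num ≤ hi₁}
  edge a r s := match a with
    | .step _ => r.1 = s.1
    | .loop _ _ => r.1 = 0 ∧ s.1 = 1

variable (l : ℕ)

/-- `st l i` is the number of the vertex `i*`; in particular `st l (l + 1) = l + 1`. -/
abbrev st (i : ℕ) : ℕ := 2 * l + 2 - i

/-- `M_ij`: `i → i+1 → ⋯ → j`, for `1 ≤ i ≤ j ≤ l + 1`. -/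
noncomputable def M (i j : ℕ) : QuiverRep ℂ (Vertex l) := (oneRow l i j).rep ℂ

/-- `M_ij*`: `j* → ⋯ → i*`, for `1 ≤ i ≤ j ≤ l + 1`. -/
noncomputable def Mstar (i j : ℕ) : QuiverRep ℂ (Vertex l) := (oneRow l (st l j) (st l i)).rep ℂ

/-- `D_ij⁺`: rows `i → ⋯ → ω` and `j → ⋯ → ω`, with `α` from the second row to the first,
for `1 ≤ i ≤ j ≤ l + 1`. -/
noncomputable def Dplus (i j : ℕ) : QuiverRep ℂ (Vertex l) :=
  (twoRows l j (l + 1) i (l + 1)).rep ℂ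

/-- `D_ij⁻`: rows `i → ⋯ → ω` and `j → ⋯ → ω`, with `α` from the first row to the second,
for `1 ≤ i < j ≤ l + 1`. -/
noncomputable def Dminus (i j : ℕ) : QuiverRep ℂ (Vertex l) :=
  (twoRows l i (l + 1) j (l + 1)).rep ℂ

/-- `C_ij⁺`: rows `ω → ⋯ → i*` and `ω → ⋯ → j*`, with `α` from the first row to the second,
for `1 ≤ i ≤ j ≤ l + 1`. -/
noncomputable def Cplus (i j : ℕ) : QuiverRep ℂ (Vertex l) :=
  (twoRows l (l + 1) (st l i) (l + 1) (st l j)).rep ℂ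

/-- `C_ij⁻`: rows `ω → ⋯ → i*` and `ω → ⋯ → j*`, with `α` from the second row to the first,
for `1 ≤ i < j ≤ l + 1`. -/
noncomputable def Cminus (i j : ℕ) : QuiverRep ℂ (Vertex l) :=
  (twoRows l (l + 1) (st l j) (l + 1) (st l i)).rep ℂ

/-- `Z_ij⁺`: rows `i → ⋯ → ω` and `ω → ⋯ → j*`, with `α` from the second row to the first,
for `1 ≤ i, j ≤ l`. -/
noncomputable def Zplus (i j : ℕ) : QuiverRep ℂ (Vertex l) :=
  (twoRows l (l + 1) (st l j) i (l + 1)).rep ℂ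

/-- `Z_ij⁻`: rows `i → ⋯ → ω` and `ω → ⋯ → j*`, with `α` from the first row to the second,
for `1 ≤ i, j ≤ l`. -/
noncomputable def Zminus (i j : ℕ) : QuiverRep ℂ (Vertex l) :=
  (twoRows l i (l + 1) (l + 1) (st l j)).rep ℂ

/-- The list of symplectic indecomposables (underlying representations). -/
inductive SymplecticList : QuiverRep.{0} ℂ (Vertex l) → Prop
  | Zp_self (i : ℕ) (h1 : 1 ≤ i) (h2 : i ≤ l) : SymplecticList (Zplus l i i)
  | Zm_self (i : ℕ) (h1 : 1 ≤ i) (h2 : i ≤ l) : SymplecticList (Zminus l i i)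
  | M_Mstar (i j : ℕ) (h1 : 1 ≤ i) (h2 : i ≤ j) (h3 : j ≤ l + 1) :
      SymplecticList ((M l i j).directSum (Mstar l i j))
  | Dp_Cp (i j : ℕ) (h1 : 1 ≤ i) (h2 : i ≤ j) (h3 : j ≤ l + 1) (h4 : (i, j) ≠ (l + 1, l + 1)) :
      SymplecticList ((Dplus l i j).directSum (Cplus l i j))
  | Dm_Cm (i j : ℕ) (h1 : 1 ≤ i) (h2 : i < j) (h3 : j ≤ l + 1) :
      SymplecticList ((Dminus l i j).directSum (Cminus l i j))
  | Dp_last : SymplecticList (Dplus l (l + 1) (l + 1))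
  | Zp_Zp (i j : ℕ) (h1 : 1 ≤ i) (h2 : i ≤ l) (h3 : 1 ≤ j) (h4 : j ≤ l) (h5 : i ≠ j) :
      SymplecticList ((Zplus l i j).directSum (Zplus l j i))
  | Zm_Zm (i j : ℕ) (h1 : 1 ≤ i) (h2 : i ≤ l) (h3 : 1 ≤ j) (h4 : j ≤ l) (h5 : i ≠ j) :
      SymplecticList ((Zminus l i j).directSum (Zminus l j i))

/-- The list of orthogonal indecomposables (underlying representations). -/
inductive OrthogonalList : QuiverRep.{0} ℂ (Vertex l) → Prop
  | M_Mstar (i j : ℕ) (h1 : 1 ≤ i) (h2 : i ≤ j) (h3 : j ≤ l + 1) (h4 : (i, j) ≠ (l + 1, l + 1)) :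
      OrthogonalList ((M l i j).directSum (Mstar l i j))
  | Dp_Cp (i j : ℕ) (h1 : 1 ≤ i) (h2 : i ≤ j) (h3 : j ≤ l + 1) :
      OrthogonalList ((Dplus l i j).directSum (Cplus l i j))
  | Dm_Cm (i j : ℕ) (h1 : 1 ≤ i) (h2 : i < j) (h3 : j ≤ l + 1) :
      OrthogonalList ((Dminus l i j).directSum (Cminus l i j))
  | Zp_Zp (i j : ℕ) (h1 : 1 ≤ i) (h2 : i ≤ l) (h3 : 1 ≤ j) (h4 : j ≤ l) :
      OrthogonalList ((Zplus l i j).directSum (Zplus l j i))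
  | Zm_Zm (i j : ℕ) (h1 : 1 ≤ i) (h2 : i ≤ l) (h3 : 1 ≤ j) (h4 : j ≤ l) :
      OrthogonalList ((Zminus l i j).directSum (Zminus l j i))
  | M_last : OrthogonalList (M l (l + 1) (l + 1))

end AL

namespace AL

open QuiverRep

/-! ### Representations with an `ε`-symmetric form, and duality between opposite vertices -/

variable {l : ℕ} {N : QuiverRep.{w} ℂ (Vertex l)} {B : N.Form} {ε : ℂ}

/-- The vertex `ω`. -/
def omega (l : ℕ) : Vertex l := ⟨l + 1, by omega, by omega⟩

@[simp] theorem omega_num (l : ℕ) : (omega l).num = l + 1 := rfl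

theorem eq_omega {p : Vertex l} (h : p.num = l + 1) : p = omega l := Vertex.ext h

/-- Two vertices are exchanged by the involution. -/
def Opp (p p' : Vertex l) : Prop := p.num + p'.num = 2 * l + 2

theorem opp_star (p : Vertex l) : Opp p (starVertex p) := by
  have := p.le
  simp only [Opp, starVertex]; omega

theorem Opp.eq_star {p p' : Vertex l} (h : Opp p p') : p' = starVertex p := by
  apply Vertex.ext
  simp only [Opp, starVertex] at *; omega

theorem Opp.symm {p p' : Vertex l} (h : Opp p p') : Opp p' p := by
  simp only [Opp] at *; omega

theorem opp_omega (l : ℕ) : Opp (omega l) (omega l) := by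
  simp only [Opp, omega_num]; omega

/-- Opposite numbers have an even sum, so the alternating sign of the standard form can be read at
either vertex of a pair. -/
theorem Opp.neg_one_pow {p p' : Vertex l} (h : Opp p p') :
    ((-1 : ℂ)) ^ p'.num = (-1) ^ p.num := by
  have h1 : (-1 : ℂ) ^ (p.num + p'.num) = 1 := by
    rw [h, show 2 * l + 2 = 2 * (l + 1) by ring, pow_mul]; simp
  rw [pow_add] at h1
  have h2 : (-1 : ℂ) ^ p.num * (-1) ^ p.num = 1 := by
    rw [← pow_add, ← two_mul, pow_mul]; simp
  linear_combination (-1) ^ p.num * h1 - (-1) ^ p'.num * h2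

/-- The form on a representation, as a bilinear pairing of the spaces at two vertices. -/
noncomputable def pairing (N : QuiverRep.{w} ℂ (Vertex l)) (B : N.Form) (p q : Vertex l) :
    N.space p →ₗ[ℂ] N.space q →ₗ[ℂ] ℂ :=
  B.compl₁₂ (DirectSum.lof ℂ _ N.space p) (DirectSum.lof ℂ _ N.space q)

theorem pairing_apply {p q : Vertex l} (x : N.space p) (y : N.space q) :
    pairing N B p q x y = N.pair B x y := rfl

/-- A representation of `A(l)` with a form which is `ε`-symmetric, where `ε = ±1`. -/
structure IsEpsRep (ε : ℂ) (N : QuiverRep.{w} ℂ (Vertex l)) (B : N.Form) : Prop where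
  bound : IsBound N
  symm : N.IsSymmetricRep B
  eps : ∀ x y, B x y = ε * B y x
  sign : ε = 1 ∨ ε = -1

/-- The map of `N` along the arrow from a vertex to the next one. -/
abbrev stepMap (N : QuiverRep.{w} ℂ (Vertex l)) {p q : Vertex l} (h : p.num + 1 = q.num) :
    N.space p →ₗ[ℂ] N.space q := N.map (Arrow.step h : p ⟶ q)

/-- The map of `N` along the loop. -/
abbrev loopMap (N : QuiverRep.{w} ℂ (Vertex l)) {p q : Vertex l} (hp : p.num = l + 1)
    (hq : q.num = l + 1) : N.space p →ₗ[ℂ] N.space q := N.map (Arrow.loop hp hq : p ⟶ q)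

/-- The endomorphism `α` of the space at `ω`. -/
abbrev alphaMap (N : QuiverRep.{w} ℂ (Vertex l)) : N.space (omega l) →ₗ[ℂ] N.space (omega l) :=
  loopMap N (omega_num l) (omega_num l)

theorem IsBound.alphaMap_sq (h : IsBound N) (x : N.space (omega l)) :
    alphaMap N (alphaMap N x) = 0 := h.1 _ rfl x

section Form

variable (h : IsEpsRep ε N B)
include h

theorem IsEpsRep.eps_ne_zero : ε ≠ 0 := by
  rcases h.sign with h | h <;> rw [h] <;> norm_num

theorem IsEpsRep.pairing_swap {p q : Vertex l} (x : N.space p) (y : N.space q) :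
    pairing N B p q x y = ε * pairing N B q p y x := h.eps _ _

theorem IsEpsRep.pairing_of_not_opp {p q : Vertex l} (hpq : ¬ Opp p q) (x : N.space p)
    (y : N.space q) : pairing N B p q x y = 0 :=
  h.symm.vanish p q (fun e => hpq (e ▸ opp_star p)) x y

/-- Stating compatibility with `Opp` instead of `starVertex` avoids transport along
`starVertex_starVertex`. -/
theorem IsEpsRep.pairing_step {p q p' q' : Vertex l} (hp : Opp p p') (hq : Opp q q')
    (e : p.num + 1 = q.num) (e' : q'.num + 1 = p'.num) (x : N.space p) (y : N.space q') :
    pairing N B q q' (stepMap N e x) y = - pairing N B p p' x (stepMap N e' y) := by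
  obtain rfl := hp.eq_star
  obtain rfl := hq.eq_star
  exact eq_neg_of_add_eq_zero_left (h.symm.compat p q (Arrow.step e) x y)

theorem IsEpsRep.pairing_loop {p q p' q' : Vertex l} (hp : p.num = l + 1) (hq : q.num = l + 1)
    (hp' : p'.num = l + 1) (hq' : q'.num = l + 1) (x : N.space p) (y : N.space q') :
    pairing N B q q' (loopMap N hp hq x) y = - pairing N B p p' x (loopMap N hq' hp' y) := by
  obtain rfl : p' = starVertex p := Opp.eq_star (by simp only [Opp]; omega)
  obtain rfl : q' = starVertex q := Opp.eq_star (by simp only [Opp]; omega)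
  exact eq_neg_of_add_eq_zero_left (h.symm.compat p q (Arrow.loop hp hq) x y)

theorem IsEpsRep.pairing_alpha (x y : N.space (omega l)) :
    pairing N B _ _ (alphaMap N x) y = - pairing N B _ _ x (alphaMap N y) :=
  h.pairing_loop _ _ _ _ x y

/-- The form vanishes off opposite vertices, so nondegeneracy on the total space can be tested on
each pair of opposite spaces. -/
theorem IsEpsRep.eq_zero_of_pairing {p p' : Vertex l} (hp : Opp p p') (y : N.space p')
    (hy : ∀ x : N.space p, pairing N B p p' x y = 0) : y = 0 := by
  have h1 : DirectSum.lof ℂ _ N.space p' y = 0 := by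
    refine h.symm.nondegenerate.2 _ fun X => ?_
    have : B.flip (DirectSum.lof ℂ _ N.space p' y) = 0 := by
      refine DirectSum.linearMap_ext ℂ fun q => LinearMap.ext fun x => ?_
      change pairing N B q p' x y = 0
      by_cases hq : Opp q p'
      · obtain rfl : q = p := by rw [hq.symm.eq_star, hp.symm.eq_star]
        exact hy x
      · exact h.pairing_of_not_opp hq x y
    exact LinearMap.congr_fun this X
  have h2 := congrArg (DirectSum.component ℂ _ N.space p') h1
  rwa [DirectSum.component.lof_self, map_zero] at h2

theorem IsEpsRep.eq_zero_of_pairing_left {p p' : Vertex l} (hp : Opp p p') (x : N.space p)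
    (hx : ∀ y : N.space p', pairing N B p p' x y = 0) : x = 0 :=
  h.eq_zero_of_pairing hp.symm x fun y => by rw [h.pairing_swap, hx, mul_zero]

/-- Both maps into the dual space are injective, so opposite spaces have equal dimension and the
pairing is perfect. -/
theorem IsEpsRep.exists_pairing_eq {p p' : Vertex l} (hp : Opp p p')
    (f : N.space p →ₗ[ℂ] ℂ) : ∃ y, ∀ x, pairing N B p p' x y = f x := by
  have i1 : Function.Injective (pairing N B p p').flip :=
    (injective_iff_map_eq_zero _).2 fun y hy =>
      h.eq_zero_of_pairing hp y fun x => LinearMap.congr_fun hy x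
  have i2 : Function.Injective (pairing N B p p') :=
    (injective_iff_map_eq_zero _).2 fun y hy =>
      h.eq_zero_of_pairing_left hp y fun x => LinearMap.congr_fun hy x
  have d1 := LinearMap.finrank_le_finrank_of_injective i1
  have d2 := LinearMap.finrank_le_finrank_of_injective i2
  have e1 : Module.finrank ℂ (N.space p →ₗ[ℂ] ℂ) = Module.finrank ℂ (N.space p) :=
    Subspace.dual_finrank_eq
  have e2 : Module.finrank ℂ (N.space p' →ₗ[ℂ] ℂ) = Module.finrank ℂ (N.space p') :=
    Subspace.dual_finrank_eq
  obtain ⟨y, hy⟩ := (LinearMap.injective_iff_surjective_of_finrank_eq_finrank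
    (by omega)).1 i1 f
  exact ⟨y, fun x => LinearMap.congr_fun hy x⟩

/-- A vector outside a subspace is detected by a vector orthogonal to the subspace. -/
theorem IsEpsRep.exists_orthogonal {p p' : Vertex l} (hp : Opp p p')
    {S : Submodule ℂ (N.space p)} {v : N.space p} (hv : v ∉ S) :
    ∃ y, (∀ x ∈ S, pairing N B p p' x y = 0) ∧ pairing N B p p' v y ≠ 0 := by
  obtain ⟨f, hf, hS⟩ := Submodule.exists_le_ker_of_notMem hv
  obtain ⟨y, hy⟩ := h.exists_pairing_eq hp f
  exact ⟨y, fun x hx => by rw [hy]; exact hS hx, by rwa [hy]⟩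

end Form

/-! ### Rows -/

/-- `x` is a row of vectors, supported on the vertices `lo, …, hi`: each vector is mapped to the
next one, and the last one to zero. -/
structure IsRow (N : QuiverRep.{w} ℂ (Vertex l)) (lo hi : ℕ) (x : ∀ p, N.space p) : Prop where
  supp : ∀ p, ¬ (lo ≤ p.num ∧ p.num ≤ hi) → x p = 0
  step : ∀ (p q : Vertex l) (e : p.num + 1 = q.num), q.num ≠ lo → stepMap N e (x p) = x q
  -- This follows from `supp` except for `lo = 0`, where it leaves only the zero row; the filtration
  -- by `lo` therefore starts at zero.
  first : ∀ q : Vertex l, q.num = 1 → lo ≠ 1 → x q = 0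

variable {lo hi lo' hi' : ℕ}

theorem isRow_zero : IsRow N lo hi 0 := ⟨fun _ _ => rfl, fun _ _ _ _ => map_zero _, fun _ _ _ => rfl⟩

theorem IsRow.add {x y : ∀ p, N.space p} (hx : IsRow N lo hi x) (hy : IsRow N lo hi y) :
    IsRow N lo hi (x + y) where
  supp p hp := by simp [hx.supp p hp, hy.supp p hp]
  step p q e hq := by simp [hx.step p q e hq, hy.step p q e hq]
  first q hq hl := by simp [hx.first q hq hl, hy.first q hq hl]

theorem IsRow.smul (c : ℂ) {x : ∀ p, N.space p} (hx : IsRow N lo hi x) :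
    IsRow N lo hi (c • x) where
  supp p hp := by simp [hx.supp p hp]
  step p q e hq := by simp [hx.step p q e hq]
  first q hq hl := by simp [hx.first q hq hl]

/-- The vectors at `p` which belong to rows from `lo` to `hi`. -/
def rowSpace (N : QuiverRep.{w} ℂ (Vertex l)) (lo hi : ℕ) (p : Vertex l) :
    Submodule ℂ (N.space p) where
  carrier := {v | ∃ x, IsRow N lo hi x ∧ x p = v}
  add_mem' := by
    rintro _ _ ⟨x, hx, rfl⟩ ⟨y, hy, rfl⟩
    exact ⟨x + y, hx.add hy, rfl⟩
  zero_mem' := ⟨0, isRow_zero, rfl⟩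
  smul_mem' := by
    rintro c _ ⟨x, hx, rfl⟩
    exact ⟨c • x, hx.smul c, rfl⟩

theorem mem_rowSpace {p : Vertex l} {v : N.space p} :
    v ∈ rowSpace N lo hi p ↔ ∃ x, IsRow N lo hi x ∧ x p = v := Iff.rfl

theorem IsRow.mono_hi {x : ∀ p, N.space p} (hx : IsRow N lo hi x) (h : hi ≤ hi') :
    IsRow N lo hi' x where
  supp p hp := hx.supp p (by omega)
  step := hx.step
  first := hx.first

theorem IsRow.truncate {x : ∀ p, N.space p} (hx : IsRow N lo hi x) (h : lo ≤ lo') :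
    IsRow N lo' hi (fun p => if p.num < lo' then 0 else x p) where
  supp p hp := by
    split_ifs with h1
    · rfl
    · exact hx.supp p (by omega)
  step p q e hq := by
    by_cases h1 : q.num < lo'
    · simp [h1, show p.num < lo' by omega]
    · simp only [h1, show ¬ p.num < lo' by omega, if_false]
      exact hx.step p q e (by omega)
  first q hq hl := by
    split_ifs with h1
    · rfl
    · exact hx.first q hq (by omega)

theorem rowSpace_mono {p : Vertex l} (h1 : lo ≤ lo') (h2 : lo' ≤ p.num) (h3 : hi ≤ hi') :
    rowSpace N lo hi p ≤ rowSpace N lo' hi' p := by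
  rintro _ ⟨x, hx, rfl⟩
  exact ⟨_, (hx.truncate h1).mono_hi h3, if_neg (by omega)⟩

/-- A row which vanishes at `q₀` vanishes from there on. -/
theorem IsRow.cut {x : ∀ p, N.space p} (hx : IsRow N lo hi x) (q₀ : Vertex l)
    (h0 : x q₀ = 0) (h : lo ≤ q₀.num) : IsRow N lo (q₀.num - 1) x where
  step := hx.step
  first := hx.first
  supp p hp := by
    have key : ∀ (k : ℕ) (q : Vertex l), q.num = q₀.num + k → x q = 0 := by
      intro k
      induction k with
      | zero =>
        intro q hq
        obtain rfl : q = q₀ := Vertex.ext hq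
        exact h0
      | succ k ih =>
        intro q hq
        have hq' := q.le
        have := q₀.one_le
        rw [← hx.step ⟨q₀.num + k, by omega, by omega⟩ q (by simp; omega) (by omega),
          ih _ rfl, map_zero]
    by_cases h1 : lo ≤ p.num
    · exact key (p.num - q₀.num) p (by have := q₀.one_le; omega)
    · exact hx.supp p (by omega)

theorem IsRow.eq_zero {x : ∀ p, N.space p} (hx : IsRow N 0 hi x) (p : Vertex l) : x p = 0 := by
  have key : ∀ (k : ℕ) (q : Vertex l), q.num = 1 + k → x q = 0 := by
    intro k
    induction k with
    | zero => exact fun q hq => hx.first q hq (by omega)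
    | succ k ih =>
      intro q hq
      have hq' := q.le
      rw [← hx.step ⟨1 + k, by omega, by omega⟩ q (by simp; omega) (by omega), ih _ rfl, map_zero]
  exact key (p.num - 1) p (by have := p.one_le; omega)

/-- The images of a vector at `p` at the vertices after `p`. -/
noncomputable def pushAux (N : QuiverRep.{w} ℂ (Vertex l)) (p : Vertex l) (v : N.space p) :
    ∀ (n : ℕ) (h1 : 1 ≤ n) (h2 : n ≤ 2 * l + 1), N.space ⟨n, h1, h2⟩
  | 0, h1, _ => absurd h1 (by omega)
  | n + 1, h1, h2 =>
    if h : p.num = n + 1 then (Vertex.ext h : p = ⟨n + 1, h1, h2⟩) ▸ v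
    else if hn : p.num < n + 1 then
      stepMap N (p := ⟨n, by have := p.one_le; omega, by omega⟩) (q := ⟨n + 1, h1, h2⟩) rfl
        (pushAux N p v n (by have := p.one_le; omega) (by omega))
    else 0

theorem exists_row (p : Vertex l) (v : N.space p) :
    ∃ x, IsRow N p.num (2 * l + 1) x ∧ x p = v := by
  refine ⟨fun q => pushAux N p v q.num q.one_le q.le, ⟨?_, ?_, ?_⟩, ?_⟩
  · rintro ⟨_ | n, h1, h2⟩ hq
    · omega
    · simp only at hq
      simp only [pushAux]
      rw [dif_neg (by omega), dif_neg (by omega)]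
  · rintro ⟨m, g1, g2⟩ ⟨n, h1, h2⟩ e hq
    simp only at e
    subst e
    simp only at hq
    by_cases hn : p.num < m + 1
    · simp only [pushAux]
      rw [dif_neg (by omega), dif_pos hn]
    · rcases m with _ | m
      · omega
      · simp only [pushAux]
        rw [dif_neg (by omega), dif_neg (by omega), dif_neg (by omega), dif_neg (by omega),
          map_zero]
  · rintro ⟨_ | n, h1, h2⟩ hq hl
    · omega
    · simp only at hq
      have := p.one_le
      simp only [pushAux]
      rw [dif_neg (by omega), dif_neg (by omega)]
  · obtain ⟨_ | n, h1, h2⟩ := p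
    · omega
    · simp [pushAux]

/-- The pairing of two rows at opposite vertices depends on the vertices only up to sign. -/
theorem IsEpsRep.pairing_rows (h : IsEpsRep ε N B) {x y : ∀ p, N.space p}
    (hx : IsRow N lo hi x) (hy : IsRow N lo' hi' y) {p q p' q' : Vertex l} (hp : Opp p p')
    (hq : Opp q q') (hpq : p.num ≤ q.num) (h1 : lo ≤ p.num) (h2 : lo' ≤ q'.num) :
    (-1) ^ p.num * pairing N B p p' (x p) (y p') =
      (-1) ^ q.num * pairing N B q q' (x q) (y q') := by
  obtain ⟨k, hk⟩ := Nat.exists_eq_add_of_le hpq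
  induction k generalizing q q' with
  | zero =>
    obtain rfl : q = p := Vertex.ext hk
    obtain rfl : q' = p' := by rw [hp.eq_star, hq.eq_star]
    rfl
  | succ k ih =>
    have := q.le
    have := p.one_le
    have hq2 : q.num + q'.num = 2 * l + 2 := hq
    let r : Vertex l := ⟨p.num + k, by omega, by omega⟩
    let r' : Vertex l := ⟨q'.num + 1, by omega, by omega⟩
    have hr : Opp r r' := by simp only [Opp, r, r']; omega
    have er : r.num + 1 = q.num := by simp only [r]; omega
    have er' : q'.num + 1 = r'.num := rfl
    -- Compatibility moves one step from the first argument to the second and changes the sign; `h1`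
    -- and `h2` ensure that neither row is asked to step onto its first vertex.
    rw [ih hr (by simp [r]) (by simp only [r']; omega) rfl, ← hx.step r q er (by omega),
      ← hy.step q' r' er' (by simp only [r']; omega), h.pairing_step hr hq er er', ← er, pow_succ]
    ring

/-! ### The filtration of the space at `ω` -/

/-- The vectors at `ω` which lie in a row between `ω` and the vertex number `m`. -/
def filt (N : QuiverRep.{w} ℂ (Vertex l)) (m : ℕ) : Submodule ℂ (N.space (omega l)) :=
  rowSpace N (min m (l + 1)) (max m (l + 1)) (omega l)

theorem filt_mono : Monotone (filt N) := fun a b h => by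
  unfold filt
  exact rowSpace_mono (by omega) (by simp) (by omega)

theorem filt_zero : filt N 0 = ⊥ := by
  rw [eq_bot_iff]
  rintro _ ⟨x, hx, rfl⟩
  exact IsRow.eq_zero (by simpa using hx) _

theorem filt_top : filt N (2 * l + 1) = ⊤ := by
  rw [eq_top_iff]
  rintro v -
  obtain ⟨x, hx, rfl⟩ := exists_row (omega l) v
  refine ⟨x, ?_, rfl⟩
  convert hx using 1
  · simp; omega
  · simp; omega

/-- Follow `y` to the vertex opposite to `n`. Sliding the pairing along rows shows that its image
there is orthogonal to the whole space at `n`, hence zero, so the row of `y` stops before that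
vertex. -/
theorem IsEpsRep.mem_rowSpace_of_orthogonal (h : IsEpsRep ε N B) {p p' : Vertex l}
    (hp : Opp p p') {n : ℕ} (hn : n ≤ p.num) (y : N.space p')
    (hy : ∀ v ∈ rowSpace N n (2 * l + 1) p, pairing N B p p' v y = 0) :
    y ∈ rowSpace N p'.num (2 * l + 1 - n) p' := by
  obtain ⟨z, hz, rfl⟩ := exists_row p' y
  refine ⟨z, ?_, rfl⟩
  rcases Nat.eq_zero_or_pos n with rfl | hn0
  · simpa using hz
  have := p.le
  have hp2 : p.num + p'.num = 2 * l + 2 := hp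
  let q : Vertex l := ⟨n, hn0, by omega⟩
  let q' : Vertex l := ⟨2 * l + 2 - n, by omega, by omega⟩
  have hq : Opp q q' := by simp only [Opp, q, q']; omega
  have h0 : z q' = 0 := by
    refine h.eq_zero_of_pairing hq _ fun u => ?_
    obtain ⟨x, hx, rfl⟩ := exists_row q u
    have := h.pairing_rows hx hz hq hp hn le_rfl le_rfl
    rw [hy _ ⟨x, hx, rfl⟩, mul_zero] at this
    exact (mul_eq_zero.1 this).resolve_left (pow_ne_zero _ (by norm_num))
  have := hz.cut q' h0 (by simp only [q']; omega)
  rwa [show q'.num - 1 = 2 * l + 1 - n by simp only [q']; omega] at this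

/-- A double orthogonal argument: if `y` were outside the image, some `u` orthogonal to the image
would detect it, but by the previous lemma `u` lies in the kernel, to which `y` is orthogonal. -/
theorem IsEpsRep.mem_rowSpace_of_orthogonal' (h : IsEpsRep ε N B) {p p' : Vertex l}
    (hp : Opp p p') {n : ℕ} (hn : p.num ≤ n) (hn' : n ≤ 2 * l + 1) (y : N.space p')
    (hy : ∀ v ∈ rowSpace N p.num n p, pairing N B p p' v y = 0) :
    y ∈ rowSpace N (2 * l + 1 - n) (2 * l + 1) p' := by
  by_contra hc
  obtain ⟨u, hu, hu'⟩ := h.exists_orthogonal hp.symm hc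
  have hp2 : p.num + p'.num = 2 * l + 2 := hp
  have := h.mem_rowSpace_of_orthogonal hp.symm (n := 2 * l + 1 - n) (by omega) u hu
  rw [show 2 * l + 1 - (2 * l + 1 - n) = n by omega] at this
  rw [h.pairing_swap, hy u this, mul_zero] at hu'
  exact hu' rfl

/-- The relation `a_l* a_l = 0` stops at `ω` every row that comes from before `ω`. This places
images inside kernels and makes `filt N n` the full image of the space at `n`. -/
theorem IsBound.rowSpace_le (hb : IsBound N) {n : ℕ} (hn : n ≤ l) :
    rowSpace N n (2 * l + 1) (omega l) ≤ filt N n := by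
  rintro _ ⟨x, hx, rfl⟩
  refine ⟨x, ?_, rfl⟩
  rw [min_eq_left (by omega), max_eq_right (by omega)]
  rcases Nat.eq_zero_or_pos l with rfl | hl
  · exact hx
  let p : Vertex l := ⟨l, by omega, by omega⟩
  let q : Vertex l := ⟨l + 2, by omega, by omega⟩
  have e1 : p.num + 1 = (omega l).num := rfl
  have e2 : (omega l).num + 1 = q.num := rfl
  have h0 : x q = 0 := by
    rw [← hx.step _ q e2 (by simp only [q]; omega), ← hx.step p _ e1 (by simp; omega)]
    exact hb.2 p (omega l) q rfl e1 e2 (x p)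
  simpa [q] using hx.cut q h0 (by simp only [q]; omega)

theorem IsEpsRep.mem_filt_of_orthogonal (h : IsEpsRep ε N B) {n : ℕ} (hn : n ≤ 2 * l + 1)
    (y : N.space (omega l)) (hy : ∀ v ∈ filt N n, pairing N B _ _ v y = 0) :
    y ∈ filt N (2 * l + 1 - n) := by
  rcases Nat.lt_or_ge l n with hl | hl
  · apply h.bound.rowSpace_le (by omega)
    refine h.mem_rowSpace_of_orthogonal' (opp_omega l) (by simp; omega) hn y ?_
    rwa [filt, min_eq_right (by omega), max_eq_left (by omega)] at hy
  · rw [filt, min_eq_right (by omega), max_eq_left (by omega)]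
    exact h.mem_rowSpace_of_orthogonal (opp_omega l) (by simp; omega) y
      fun v hv => hy v (h.bound.rowSpace_le hl hv)

/-- One index is at most `l`, say `a`. Sliding the pairing back to the vertex `a` meets the second
row at the number `2 * l + 2 - a`, where it has already ended. -/
theorem IsEpsRep.pairing_filt (h : IsEpsRep ε N B) {a b : ℕ} (hab : a + b ≤ 2 * l + 1)
    {v w : N.space (omega l)} (hv : v ∈ filt N a) (hw : w ∈ filt N b) :
    pairing N B _ _ v w = 0 := by
  wlog hal : a ≤ l generalizing a b v w
  · rw [h.pairing_swap, this (by omega) hw hv (by omega), mul_zero]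
  rcases Nat.eq_zero_or_pos a with rfl | ha
  · rw [filt_zero, Submodule.mem_bot] at hv
    simp [hv]
  obtain ⟨x, hx, rfl⟩ := hv
  obtain ⟨y, hy, rfl⟩ := hw
  let p : Vertex l := ⟨a, ha, by omega⟩
  let p' : Vertex l := ⟨2 * l + 2 - a, by omega, by omega⟩
  have hp : Opp p p' := by simp only [Opp, p, p']; omega
  have := h.pairing_rows hx hy hp (opp_omega l) (by simp only [p, omega_num]; omega)
    (by simp [p]) (by simp)
  rw [hy.supp p' (by simp only [p']; omega), map_zero, mul_zero] at this
  exact (mul_eq_zero.1 this.symm).resolve_left (pow_ne_zero _ (by norm_num))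

end AL

namespace AL

open QuiverRep

/-! ### Systems of rows -/

/-- A system of rows: the row `r` goes from `lo r` to `hi r`, and `alpha` tells to which row the
vector at `ω` of a row is mapped by `α`. -/
structure RowSystem (R : Type) where
  lo : R → ℕ
  hi : R → ℕ
  alpha : R → Option R

variable {l : ℕ} {R R' : Type}

/-- The row `r` has a vector at `p`. -/
def RowSystem.Mem (D : RowSystem R) (r : R) (p : Vertex l) : Prop :=
  D.lo r ≤ p.num ∧ p.num ≤ D.hi r

instance (D : RowSystem R) (r : R) (p : Vertex l) : Decidable (D.Mem r p) :=
  inferInstanceAs (Decidable (_ ∧ _))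

/-- The vectors `x` in the representation `N` are arranged in a given system of rows. -/
structure IsSystem (D : RowSystem R) (N : QuiverRep.{w} ℂ (Vertex l))
    (x : R → ∀ p, N.space p) : Prop where
  row : ∀ r, IsRow N (D.lo r) (D.hi r) (x r)
  loop : ∀ (r : R) (p q : Vertex l) (hp : p.num = l + 1) (hq : q.num = l + 1),
    loopMap N hp hq (x r p) = (D.alpha r).elim 0 fun r' => x r' q

/-- A basis of `N`, arranged in a given system of rows, with its dual basis. -/
structure Frame [Fintype R] [DecidableEq R] (D : RowSystem R) (N : QuiverRep.{w} ℂ (Vertex l)) where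
  x : R → ∀ p, N.space p
  coord : R → ∀ p, N.space p →ₗ[ℂ] ℂ
  sys : IsSystem D N x
  -- Rows are indexed uniformly over all vertices, so the vector of a row that does not meet `p` is
  -- zero; hence the condition `D.Mem r p`.
  dual : ∀ r r' p, coord r p (x r' p) = if r = r' ∧ D.Mem r p then 1 else 0
  span : ∀ p v, ∑ r, coord r p v • x r p = v

/-- The disjoint union of two systems of rows. -/
def RowSystem.sum (D : RowSystem R) (D' : RowSystem R') : RowSystem (R ⊕ R') where
  lo := Sum.elim D.lo D'.lo
  hi := Sum.elim D.hi D'.hi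
  alpha := Sum.elim (fun r => (D.alpha r).map Sum.inl) (fun r => (D'.alpha r).map Sum.inr)

section Systems

variable {D : RowSystem R} {N : QuiverRep.{w} ℂ (Vertex l)} {N' : QuiverRep ℂ (Vertex l)}
  {x : R → ∀ p, N.space p} {y : R → ∀ p, N'.space p}

theorem IsSystem.supp (hx : IsSystem D N x) {r : R} {p : Vertex l} (h : ¬ D.Mem r p) :
    x r p = 0 := (hx.row r).supp p h

theorem IsSystem.step_eq (hx : IsSystem D N x) (r : R) {p q : Vertex l}
    (e : p.num + 1 = q.num) : stepMap N e (x r p) = if q.num = D.lo r then 0 else x r q := by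
  split_ifs with h
  · rw [(hx.row r).supp p (by omega), map_zero]
  · exact (hx.row r).step p q e h

/-- Families of maps which respect two systems of rows commute with the arrows on these. -/
theorem IsSystem.map_eq (hx : IsSystem D N x) (hy : IsSystem D N' y)
    (e : ∀ p, N.space p →ₗ[ℂ] N'.space p) (he : ∀ r p, e p (x r p) = y r p)
    {p q : Vertex l} (a : p ⟶ q) (r : R) : e q (N.map a (x r p)) = N'.map a (e p (x r p)) := by
  match a with
  | Arrow.step h =>
    have h1 := hx.step_eq r h
    have h2 := hy.step_eq r h
    rw [he]
    refine (congrArg _ h1).trans (Eq.trans ?_ h2.symm)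
    split_ifs
    · simp
    · exact he r q
  | Arrow.loop hp hq =>
    have h1 := hx.loop r p q hp hq
    have h2 := hy.loop r p q hp hq
    rw [he]
    refine (congrArg _ h1).trans (Eq.trans ?_ h2.symm)
    cases D.alpha r with
    | none => simp
    | some r' => exact he r' q

end Systems

/-! ### Frames and the isomorphisms they determine -/

section Frames

variable [Fintype R] [DecidableEq R] [Fintype R'] [DecidableEq R'] {D : RowSystem R}
  {D' : RowSystem R'} {N : QuiverRep.{w} ℂ (Vertex l)} {N' : QuiverRep ℂ (Vertex l)}

/-- The map on a vertex space which sends the vectors of a frame to given vectors. -/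
noncomputable def Frame.lift (F : Frame D N) {p : Vertex l}
    {W : Type*} [AddCommGroup W] [Module ℂ W] (y : R → W) : N.space p →ₗ[ℂ] W :=
  ∑ r, (F.coord r p).smulRight (y r)

theorem Frame.lift_apply (F : Frame D N) {p : Vertex l} {W : Type*} [AddCommGroup W] [Module ℂ W]
    (y : R → W) (v : N.space p) : F.lift y v = ∑ r, F.coord r p v • y r := by
  simp [Frame.lift]

theorem Frame.lift_x (F : Frame D N) {p : Vertex l} {W : Type*} [AddCommGroup W] [Module ℂ W]
    (y : R → W) (r : R) (hy : ¬ D.Mem r p → y r = 0) : F.lift (p := p) y (F.x r p) = y r := by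
  rw [F.lift_apply]
  simp only [F.dual]
  by_cases h : D.Mem r p
  · rw [Finset.sum_eq_single r] <;> simp +contextual [h]
  · rw [hy h]
    refine Finset.sum_eq_zero fun r' _ => ?_
    rw [if_neg, zero_smul]
    rintro ⟨rfl, h'⟩
    exact h h'

theorem Frame.hom_ext (F : Frame D N) {p : Vertex l} {W : Type*} [AddCommGroup W] [Module ℂ W]
    {f g : N.space p →ₗ[ℂ] W} (h : ∀ r, f (F.x r p) = g (F.x r p)) : f = g := by
  ext v
  rw [← F.span p v]
  simp [h]

theorem Frame.lift_lift (F : Frame D N) (F' : Frame D N') (p : Vertex l) :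
    F'.lift (p := p) (fun r => F.x r p) ∘ₗ F.lift (p := p) (fun r => F'.x r p) =
      LinearMap.id := by
  refine F.hom_ext fun r => ?_
  rw [LinearMap.comp_apply, F.lift_x (fun r => F'.x r p) r F'.sys.supp,
    F'.lift_x (fun r => F.x r p) r F.sys.supp]
  rfl

/-- The isomorphism between two representations which have frames over the same system of rows. -/
noncomputable def Frame.equiv (F : Frame D N) (F' : Frame D N') (p : Vertex l) :
    N.space p ≃ₗ[ℂ] N'.space p :=
  LinearEquiv.ofLinearMap (F.lift fun r => F'.x r p) (F'.lift fun r => F.x r p)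
    (F'.lift_lift F p) (F.lift_lift F' p)

theorem Frame.equiv_x (F : Frame D N) (F' : Frame D N') (r : R) (p : Vertex l) :
    F.equiv F' p (F.x r p) = F'.x r p :=
  F.lift_x (fun r => F'.x r p) r F'.sys.supp

theorem Frame.isIsomorphism (F : Frame D N) (F' : Frame D N') :
    IsIsomorphism N N' (F.equiv F') := by
  intro p q a v
  refine LinearMap.congr_fun (f := (F.equiv F' q).toLinearMap ∘ₗ N.map a)
    (g := N'.map a ∘ₗ (F.equiv F' p).toLinearMap) (F.hom_ext fun r => ?_) v
  exact F.sys.map_eq F'.sys (fun p => (F.equiv F' p).toLinearMap) (F.equiv_x F') a r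

end Frames

section DirectSum

variable {D : RowSystem R} {D' : RowSystem R'} {N N' : QuiverRep.{w} ℂ (Vertex l)}

theorem IsRow.inl {lo hi : ℕ} {x : ∀ p, N.space p} (hx : IsRow N lo hi x) :
    IsRow (N.directSum N') lo hi (fun p => ((x p, 0) : N.space p × N'.space p)) where
  supp p hp := Prod.ext (hx.supp p hp) rfl
  step p q e hq := Prod.ext (hx.step p q e hq) (map_zero (stepMap N' e))
  first q hq hl := Prod.ext (hx.first q hq hl) rfl

theorem IsRow.inr {lo hi : ℕ} {x : ∀ p, N'.space p} (hx : IsRow N' lo hi x) :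
    IsRow (N.directSum N') lo hi (fun p => ((0, x p) : N.space p × N'.space p)) where
  supp p hp := Prod.ext rfl (hx.supp p hp)
  step p q e hq := Prod.ext (map_zero (stepMap N e)) (hx.step p q e hq)
  first q hq hl := Prod.ext rfl (hx.first q hq hl)

theorem IsSystem.sum {x : R → ∀ p, N.space p} {y : R' → ∀ p, N'.space p} (hx : IsSystem D N x)
    (hy : IsSystem D' N' y) : IsSystem (D.sum D') (N.directSum N') (fun r p =>
      (Sum.elim (fun r => (x r p, 0)) (fun r => (0, y r p)) r : N.space p × N'.space p)) where
  row r := by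
    cases r with
    | inl r => exact (hx.row r).inl
    | inr r => exact (hy.row r).inr
  loop r p q hp hq := by
    cases r with
    | inl r =>
      refine Prod.ext ((hx.loop r p q hp hq).trans ?_) ((map_zero (loopMap N' hp hq)).trans ?_) <;>
      · simp only [RowSystem.sum, Sum.elim_inl]
        cases D.alpha r <;> rfl
    | inr r =>
      refine Prod.ext ((map_zero (loopMap N hp hq)).trans ?_) ((hy.loop r p q hp hq).trans ?_) <;>
      · simp only [RowSystem.sum, Sum.elim_inr]
        cases D'.alpha r <;> rfl

/-- The direct sum of two representations with frames. -/
noncomputable def Frame.sum [Fintype R] [DecidableEq R] [Fintype R'] [DecidableEq R'] (F : Frame D N)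
    (F' : Frame D' N') : Frame (D.sum D') (N.directSum N') where
  x r p := (Sum.elim (fun r => (F.x r p, 0)) (fun r => (0, F'.x r p)) r :
    N.space p × N'.space p)
  coord r p := Sum.elim (fun r => F.coord r p ∘ₗ LinearMap.fst ℂ (N.space p) (N'.space p))
    (fun r => F'.coord r p ∘ₗ LinearMap.snd ℂ (N.space p) (N'.space p)) r
  sys := F.sys.sum F'.sys
  dual r r' p := by
    rcases r with r | r <;> rcases r' with r' | r'
    · refine (F.dual r r' p).trans (if_congr ?_ rfl rfl)
      simp [RowSystem.Mem, RowSystem.sum]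
    · refine (map_zero (F.coord r p)).trans ?_
      simp
    · refine (map_zero (F'.coord r p)).trans ?_
      simp
    · refine (F'.dual r r' p).trans (if_congr ?_ rfl rfl)
      simp [RowSystem.Mem, RowSystem.sum]
  span p v := by
    obtain ⟨v, v'⟩ := (v : N.space p × N'.space p)
    rw [Fintype.sum_sum_type]
    refine Prod.ext ?_ ?_
    · refine (congrArg₂ (· + ·) (Prod.fst_sum ..) (Prod.fst_sum ..)).trans ?_
      exact (congrArg₂ (· + ·) (F.span p v)
        (Finset.sum_eq_zero fun r _ => smul_zero (F'.coord r p v'))).trans (add_zero v)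
    · refine (congrArg₂ (· + ·) (Prod.snd_sum ..) (Prod.snd_sum ..)).trans ?_
      exact (congrArg₂ (· + ·) (Finset.sum_eq_zero fun r _ => smul_zero (F.coord r p v))
        (F'.span p v')).trans (zero_add v')

end DirectSum

end AL

/-! ### Standard forms on systems of rows, and splitting off a standard system -/

namespace AL

open QuiverRep

variable {l : ℕ} {R : Type} {ε : ℂ} {D : RowSystem R}

/-- Every row is a nonempty interval of vertices on one side of `ω`. -/
structure RowSystem.Regular (l : ℕ) (D : RowSystem R) : Prop where
  lo_le_hi : ∀ r, D.lo r ≤ D.hi r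
  one_le_lo : ∀ r, 1 ≤ D.lo r
  hi_le : ∀ r, D.hi r ≤ 2 * l + 1
  half : ∀ r, D.hi r ≤ l + 1 ∨ l + 1 ≤ D.lo r

theorem RowSystem.Regular.sum {R' : Type} {D' : RowSystem R'} (h : D.Regular l)
    (h' : D'.Regular l) : (D.sum D').Regular l where
  lo_le_hi r := by rcases r with r | r; exacts [h.lo_le_hi r, h'.lo_le_hi r]
  one_le_lo r := by rcases r with r | r; exacts [h.one_le_lo r, h'.one_le_lo r]
  hi_le r := by rcases r with r | r; exacts [h.hi_le r, h'.hi_le r]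
  half r := by rcases r with r | r; exacts [h.half r, h'.half r]

/-- The standard form on a system of rows: the vectors of the row `r` are paired with those of the
row `dual r`, with values `± c r`, and any other pairing vanishes. -/
structure FormData (ε : ℂ) (l : ℕ) (D : RowSystem R) extends RowSystem.Regular l D where
  dual : R → R
  c : R → ℂ
  c_ne : ∀ r, c r ≠ 0
  dual_dual : ∀ r, dual (dual r) = r
  lo_dual : ∀ r, D.lo (dual r) + D.hi r = 2 * l + 2
  c_dual : ∀ r, c (dual r) = ε * c r
  alpha_dual : ∀ r r', D.alpha r = some r' → D.alpha (dual r') = some (dual r)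
  -- With `alpha_dual`, this is compatibility of the form with `α`, read on coefficients.
  c_alpha : ∀ r r', D.alpha r = some r' → c r' = - c r
  -- This encodes `α² = 0`; `half` encodes `a_l* a_l = 0`.
  alpha_alpha : ∀ r r', D.alpha r = some r' → D.alpha r' = none
  alpha_mem : ∀ r r', D.alpha r = some r' → D.Mem r (omega l)

theorem FormData.mem_dual (Φ : FormData ε l D) {p p' : Vertex l} (hp : Opp p p') (r : R) :
    D.Mem (Φ.dual r) p' ↔ D.Mem r p := by
  have h1 := Φ.lo_dual r
  have h2 := Φ.lo_dual (Φ.dual r)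
  rw [Φ.dual_dual] at h2
  simp only [Opp, RowSystem.Mem] at *
  omega

theorem FormData.alpha_mem' (Φ : FormData ε l D) {r r' : R} (h : D.alpha r = some r') :
    D.Mem r' (omega l) := by
  rw [← Φ.mem_dual (opp_omega l)]
  exact Φ.alpha_mem _ _ (Φ.alpha_dual _ _ h)

theorem FormData.eq_dual_iff (Φ : FormData ε l D) {r r' : R} :
    r' = Φ.dual r ↔ r = Φ.dual r' := by
  constructor <;> rintro rfl <;> rw [Φ.dual_dual]

/-- The value of the standard form at two vectors of the rows `r` and `r'`. -/
noncomputable def FormData.gram [DecidableEq R] (Φ : FormData ε l D) (r r' : R) (p : Vertex l) : ℂ :=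
  -- The sign alternates along a row because each step contributes `-1` through compatibility.
  if r' = Φ.dual r ∧ D.Mem r p then (-1) ^ p.num * Φ.c r else 0

theorem FormData.gram_swap [DecidableEq R] (Φ : FormData ε l D) (hε : ε * ε = 1) {p p' : Vertex l}
    (hp : Opp p p') (r r' : R) : Φ.gram r r' p = ε * Φ.gram r' r p' := by
  unfold FormData.gram
  by_cases h : r' = Φ.dual r
  · subst h
    simp only [true_and, Φ.dual_dual, Φ.mem_dual hp, hp.neg_one_pow, Φ.c_dual]
    split_ifs
    · linear_combination (- (-1) ^ p.num * Φ.c r) * hε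
    · simp
  · rw [if_neg (fun h' => h h'.1), if_neg (fun h' => h (Φ.eq_dual_iff.2 h'.1)), mul_zero]

/-- The vectors `x` form a system of rows on which the form `B` is the standard one. -/
structure IsStandard [DecidableEq R] (Φ : FormData ε l D) (N : QuiverRep.{w} ℂ (Vertex l))
    (B : N.Form) (x : R → ∀ p, N.space p) : Prop where
  sys : IsSystem D N x
  gram : ∀ r r' p p', Opp p p' → pairing N B p p' (x r p) (x r' p') = Φ.gram r r' p

section Complement

variable {Φ : FormData ε l D} {N : QuiverRep.{w} ℂ (Vertex l)}
  {B : N.Form} {x : R → ∀ p, N.space p}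

/-- The functionals dual to the vectors of a standard system. -/
noncomputable def stdCoord (Φ : FormData ε l D) (N : QuiverRep.{w} ℂ (Vertex l))
    (B : N.Form) (x : R → ∀ p, N.space p) (r : R) (p : Vertex l) : N.space p →ₗ[ℂ] ℂ :=
  ((-1) ^ p.num * Φ.c r)⁻¹ • (pairing N B p (starVertex p)).flip (x (Φ.dual r) (starVertex p))

theorem stdCoord_apply (r : R) (p : Vertex l) (v : N.space p) :
    stdCoord Φ N B x r p v = ((-1) ^ p.num * Φ.c r)⁻¹ *
      pairing N B p (starVertex p) v (x (Φ.dual r) (starVertex p)) := rfl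

theorem FormData.coeff_ne (Φ : FormData ε l D) (r : R) (p : Vertex l) :
    ((-1) ^ p.num * Φ.c r : ℂ) ≠ 0 :=
  mul_ne_zero (pow_ne_zero _ (by norm_num)) (Φ.c_ne r)

theorem isSubrep_span (hx : IsSystem D N x) :
    N.IsSubrep fun p => Submodule.span ℂ (Set.range fun r => x r p) := by
  intro p q a v hv
  induction hv using Submodule.span_induction with
  | zero => simp
  | add u v _ _ hu hv => rw [map_add]; exact add_mem hu hv
  | smul c v _ hv => rw [map_smul]; exact Submodule.smul_mem _ _ hv
  | mem v hv =>
    obtain ⟨r, rfl⟩ := hv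
    match a with
    | Arrow.step e =>
      change stepMap N e (x r p) ∈ _
      rw [hx.step_eq]
      split_ifs
      · exact zero_mem _
      · exact Submodule.subset_span ⟨r, rfl⟩
    | Arrow.loop hp hq =>
      change loopMap N hp hq (x r p) ∈ _
      rw [hx.loop]
      cases D.alpha r with
      | none => exact zero_mem _
      | some r' => exact Submodule.subset_span ⟨r', rfl⟩

variable [DecidableEq R]

theorem IsStandard.stdCoord_x (hx : IsStandard Φ N B x) (r r' : R) (p : Vertex l) :
    stdCoord Φ N B x r p (x r' p) = if r = r' ∧ D.Mem r p then 1 else 0 := by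
  rw [stdCoord_apply, hx.gram _ _ _ _ (opp_star p), FormData.gram]
  by_cases h : r = r'
  · subst h
    simp only [true_and]
    split_ifs
    · exact inv_mul_cancel₀ (Φ.coeff_ne r p)
    · simp
  · rw [if_neg, if_neg (fun h' => h h'.1), mul_zero]
    rintro ⟨h', -⟩
    exact h (by simpa [Φ.dual_dual] using congrArg Φ.dual h')

theorem IsStandard.stdCoord_eq_zero (hx : IsStandard Φ N B x) {r : R} {p : Vertex l}
    (h : ¬ D.Mem r p) : stdCoord Φ N B x r p = 0 := by
  ext v
  rw [stdCoord_apply, hx.sys.supp (fun h' => h ((Φ.mem_dual (opp_star p) r).1 h'))]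
  simp

/-- The common kernel of the coordinates is the orthogonal complement of the system. The adjoint of
an arrow is, up to sign, the opposite arrow, and this preserves the system. -/
theorem IsStandard.isSubrep_orthogonal (h : IsEpsRep ε N B) (hx : IsStandard Φ N B x) :
    N.IsSubrep fun p => ⨅ r, LinearMap.ker (stdCoord Φ N B x r p) := by
  have key : ∀ p v, v ∈ (⨅ r, LinearMap.ker (stdCoord Φ N B x r p)) ↔
      ∀ r p', Opp p p' → pairing N B p p' v (x r p') = 0 := by
    intro p v
    simp only [Submodule.mem_iInf, LinearMap.mem_ker, stdCoord_apply, mul_eq_zero, inv_eq_zero,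
      Φ.coeff_ne, false_or]
    constructor
    · intro hv r p' hp
      obtain rfl := hp.eq_star
      simpa [Φ.dual_dual] using hv (Φ.dual r)
    · exact fun hv r => hv _ _ (opp_star p)
  intro p q a v hv
  rw [key] at hv ⊢
  intro r q' hq
  match a with
  | Arrow.step e =>
    have e' : q'.num + 1 = (starVertex p).num := by
      have := p.le
      simp only [starVertex, Opp] at *; omega
    refine (h.pairing_step (opp_star p) hq e e' v _).trans ?_
    rw [hx.sys.step_eq]
    split_ifs
    · simp
    · rw [hv _ _ (opp_star p), neg_zero]
  | Arrow.loop hp hq2 =>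
    have e1 : q'.num = l + 1 := by simp only [Opp] at hq; omega
    have e2 : (starVertex p).num = l + 1 := by simp only [starVertex]; omega
    refine (h.pairing_loop hp hq2 e2 e1 v _).trans ?_
    rw [hx.sys.loop]
    cases D.alpha r with
    | none => simp
    | some r' => exact neg_eq_zero.2 (hv _ _ (opp_star p))

theorem IsStandard.ne_zero (hx : IsStandard Φ N B x) {r : R} {p : Vertex l} (h : D.Mem r p) :
    x r p ≠ 0 := by
  intro h0
  have := hx.stdCoord_x r r p
  simp [h0, h] at this

variable [Fintype R]

theorem IsStandard.stdCoord_sum (hx : IsStandard Φ N B x) (r : R) (p : Vertex l) (a : R → ℂ)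
    (ha : ∀ r, ¬ D.Mem r p → a r = 0) :
    stdCoord Φ N B x r p (∑ r', a r' • x r' p) = a r := by
  simp only [map_sum, map_smul, hx.stdCoord_x, smul_eq_mul]
  rw [Finset.sum_eq_single r]
  · by_cases h : D.Mem r p
    · simp [h]
    · simp [h, ha r h]
  · intro r' _ h
    simp [h.symm]
  · simp

/-- The frame given by a standard system which spans. -/
noncomputable def IsStandard.frame (hx : IsStandard Φ N B x)
    (h : ∀ p v, (∀ r, stdCoord Φ N B x r p v = 0) → v = 0) : Frame D N where
  x := x
  coord := stdCoord Φ N B x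
  sys := hx.sys
  dual := hx.stdCoord_x
  span p v := by
    refine sub_eq_zero.1 (h p _ fun r => ?_)
    rw [map_sub, hx.stdCoord_sum, sub_self]
    intro r hr
    rw [hx.stdCoord_eq_zero hr]
    rfl

/-- An indecomposable representation which contains a standard system is spanned by it. -/
theorem IsStandard.spans_of_indecomposable [Nonempty R] (h : IsEpsRep ε N B)
    (hx : IsStandard Φ N B x) (hN : N.FormIndecomposable B) (p : Vertex l) (v : N.space p)
    (hv : ∀ r, stdCoord Φ N B x r p v = 0) : v = 0 := by
  have hmem : ∀ (p : Vertex l) (v : N.space p), ∑ r, stdCoord Φ N B x r p v • x r p ∈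
      Submodule.span ℂ (Set.range fun r => x r p) := fun p v =>
    Submodule.sum_mem _ fun r _ => Submodule.smul_mem _ _ (Submodule.subset_span ⟨r, rfl⟩)
  have hzero : ∀ (p : Vertex l) (v : N.space p) (r : R), ¬ D.Mem r p →
      stdCoord Φ N B x r p v = 0 := fun p v r hr => by rw [hx.stdCoord_eq_zero hr]; rfl
  have hspan : ∀ (p : Vertex l) (v : N.space p),
      v ∈ Submodule.span ℂ (Set.range fun r => x r p) →
      v = ∑ r, stdCoord Φ N B x r p v • x r p := by
    intro p v hv
    induction hv using Submodule.span_induction with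
    | zero => simp
    | add u v _ _ hu hv =>
      conv_lhs => rw [hu, hv]
      simp [add_smul, Finset.sum_add_distrib]
    | smul c v _ hv =>
      conv_lhs => rw [hv]
      simp [Finset.smul_sum, smul_smul]
    | mem v hv =>
      obtain ⟨r, rfl⟩ := hv
      simp only [hx.stdCoord_x]
      by_cases hr : D.Mem r p
      · rw [Finset.sum_eq_single r] <;> simp +contextual [hr]
      · rw [hx.sys.supp hr, Finset.sum_eq_zero]
        intro r' _
        rw [if_neg, zero_smul]
        rintro ⟨rfl, h'⟩
        exact hr h'
  have hort : ∀ (p q : Vertex l), ∀ u ∈ Submodule.span ℂ (Set.range fun r => x r p),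
      ∀ y ∈ (⨅ r, LinearMap.ker (stdCoord Φ N B x r q)), pairing N B q p y u = 0 := by
    intro p q u hu y hy
    by_cases hpq : Opp q p
    · obtain rfl := hpq.eq_star
      simp only [Submodule.mem_iInf, LinearMap.mem_ker, stdCoord_apply, mul_eq_zero, inv_eq_zero,
        Φ.coeff_ne, false_or] at hy
      have : Submodule.span ℂ (Set.range fun r => x r (starVertex q)) ≤
          LinearMap.ker (pairing N B q (starVertex q) y) := by
        rw [Submodule.span_le]
        rintro _ ⟨r, rfl⟩
        simpa [Φ.dual_dual] using hy (Φ.dual r)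
      exact this hu
    · exact h.pairing_of_not_opp hpq _ _
  have hcompl : ∀ p, IsCompl (Submodule.span ℂ (Set.range fun r => x r p))
      (⨅ r, LinearMap.ker (stdCoord Φ N B x r p)) := by
    intro p
    constructor
    · rw [Submodule.disjoint_def]
      intro v hv hv'
      simp only [Submodule.mem_iInf, LinearMap.mem_ker] at hv'
      rw [hspan p v hv]
      simp [hv']
    · rw [codisjoint_iff, eq_top_iff]
      rintro v -
      rw [Submodule.mem_sup]
      -- The coordinates give the orthogonal projection onto the span.
      refine ⟨_, hmem p v, v - ∑ r, stdCoord Φ N B x r p v • x r p, ?_, by abel⟩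
      simp only [Submodule.mem_iInf, LinearMap.mem_ker]
      intro r
      rw [map_sub, hx.stdCoord_sum r p (fun r => stdCoord Φ N B x r p v) (hzero p v), sub_self]
  rcases hN.2 _ _ (isSubrep_span hx.sys) (hx.isSubrep_orthogonal h) hcompl
    (fun p q u hu y hy => ⟨by rw [← pairing_apply, h.pairing_swap, hort p q u hu y hy, mul_zero],
      hort p q u hu y hy⟩) with h1 | h1
  -- The span is not zero: a row has a nonzero vector at its first vertex.
  · exfalso
    obtain ⟨r⟩ := ‹Nonempty R›
    have := Φ.hi_le r
    have hlo := Φ.lo_le_hi r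
    have hm : D.Mem r (⟨D.lo r, Φ.one_le_lo r, by omega⟩ : Vertex l) := ⟨le_rfl, hlo⟩
    refine hx.ne_zero hm ?_
    rw [← Submodule.mem_bot ℂ, ← h1]
    exact Submodule.subset_span ⟨r, rfl⟩
  · rw [← Submodule.mem_bot ℂ, ← h1 p]
    simpa using hv

end Complement

/-- Two representations spanned by standard systems of the same kind are isometric. -/
theorem isometric_of_isStandard [Fintype R] [DecidableEq R] {Φ : FormData ε l D}
    {N N' : QuiverRep.{w} ℂ (Vertex l)} {B : N.Form} {B' : N'.Form} (h : IsEpsRep ε N B)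
    (h' : IsEpsRep ε N' B') (F : Frame D N) (F' : Frame D N') (hF : IsStandard Φ N B F.x)
    (hF' : IsStandard Φ N' B' F'.x) : N.Isometric B N' B' := by
  refine ⟨F.equiv F', F.isIsomorphism F', fun p q v u => ?_⟩
  rw [← pairing_apply, ← pairing_apply]
  by_cases hpq : Opp p q
  · refine LinearMap.congr_fun₂ (f := (pairing N' B' p q).compl₁₂ (F.equiv F' p).toLinearMap
      (F.equiv F' q).toLinearMap) (F.hom_ext fun r => F.hom_ext fun r' => ?_) v u
    simp only [LinearMap.compl₁₂_apply, LinearEquiv.coe_coe, F.equiv_x]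
    rw [hF.gram _ _ _ _ hpq, hF'.gram _ _ _ _ hpq]
  · rw [h.pairing_of_not_opp hpq, h'.pairing_of_not_opp hpq]

end AL

/-! ### The standard form exists on every representation with a suitable frame -/

namespace AL

open QuiverRep

section ExistsForm

variable {l : ℕ} {R : Type} {ε : ℂ} {D : RowSystem R} [Fintype R] [DecidableEq R]
  {N : QuiverRep.{w} ℂ (Vertex l)}

/-- A bilinear form on the total space, given by its values on the vertex spaces. -/
noncomputable def formOf (β : ∀ p q, N.space p →ₗ[ℂ] N.space q →ₗ[ℂ] ℂ) : N.Form :=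
  DirectSum.toModule ℂ _ _ fun p => LinearMap.flip (DirectSum.toModule ℂ _ _ fun q => (β p q).flip)

theorem pairing_formOf (β : ∀ p q, N.space p →ₗ[ℂ] N.space q →ₗ[ℂ] ℂ) (p q : Vertex l) :
    pairing N (formOf β) p q = β p q := by
  ext x y
  simp [pairing, formOf]

theorem form_ext {B B' : N.Form} (h : ∀ p q, pairing N B p q = pairing N B' p q) : B = B' :=
  DirectSum.linearMap_ext ℂ fun p => LinearMap.ext fun x => DirectSum.linearMap_ext ℂ fun q =>
    LinearMap.ext fun y => LinearMap.congr_fun₂ (h p q) x y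

/-- The standard form on a representation with a frame. -/
noncomputable def stdForm (Φ : FormData ε l D) (F : Frame D N) : N.Form :=
  formOf fun p q => if q = starVertex p then
    ∑ r, ((-1) ^ p.num * Φ.c r) • (F.coord r p).smulRight (F.coord (Φ.dual r) q) else 0

theorem pairing_stdForm_of_ne (Φ : FormData ε l D) (F : Frame D N) {p q : Vertex l}
    (h : ¬ Opp p q) : pairing N (stdForm Φ F) p q = 0 := by
  rw [stdForm, pairing_formOf, if_neg]
  rintro rfl
  exact h (opp_star p)

theorem pairing_stdForm (Φ : FormData ε l D) (F : Frame D N) {p q : Vertex l} (h : Opp p q)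
    (r r' : R) : pairing N (stdForm Φ F) p q (F.x r p) (F.x r' q) = Φ.gram r r' p := by
  rw [stdForm, pairing_formOf, if_pos h.eq_star, FormData.gram]
  simp only [LinearMap.sum_apply, LinearMap.smul_apply, LinearMap.smulRight_apply, F.dual,
    smul_eq_mul, Φ.mem_dual h]
  rw [Finset.sum_eq_single r]
  · simp only [true_and]
    by_cases h1 : D.Mem r p <;> by_cases h2 : r' = Φ.dual r <;> simp [h1, h2, eq_comm]
  · intro r'' _ hr
    simp [hr]
  · simp

theorem Frame.isBound (Φ : FormData ε l D) (F : Frame D N) : IsBound N := by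
  constructor
  · intro ω hω v
    refine LinearMap.congr_fun (f := loopMap N hω hω ∘ₗ loopMap N hω hω) (g := 0)
      (F.hom_ext fun r => ?_) v
    rw [LinearMap.comp_apply, F.sys.loop]
    cases hr : D.alpha r with
    | none => simp
    | some r' =>
      simp only [Option.elim]
      rw [F.sys.loop, Φ.alpha_alpha _ _ hr]
      rfl
  · intro p ω q hω h1 h2 v
    refine LinearMap.congr_fun (f := stepMap N h2 ∘ₗ stepMap N h1) (g := 0)
      (F.hom_ext fun r => ?_) v
    rw [LinearMap.comp_apply, F.sys.step_eq]
    split_ifs with h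
    · simp
    · rw [F.sys.step_eq]
      split_ifs with h'
      · rfl
      · rcases Φ.half r with h3 | h3
        · exact F.sys.supp fun hm => by have := hm.2; omega
        · by_cases hm : D.lo r ≤ ω.num
          · omega
          · exact F.sys.supp fun hm => by have := hm.1; omega

theorem stdForm_eps (Φ : FormData ε l D) (hε : ε * ε = 1) (F : Frame D N)
    (x y : ⨁ p, N.space p) : stdForm Φ F x y = ε * stdForm Φ F y x := by
  refine LinearMap.congr_fun₂ (f := stdForm Φ F) (g := ε • (stdForm Φ F).flip)
    (form_ext fun p q => ?_) x y
  by_cases h : Opp p q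
  · refine F.hom_ext fun r => F.hom_ext fun r' => ?_
    refine (pairing_stdForm Φ F h r r').trans ((Φ.gram_swap hε h r r').trans ?_)
    exact congrArg (ε * ·) (pairing_stdForm Φ F h.symm r' r).symm
  · ext v u
    rw [pairing_stdForm_of_ne Φ F h]
    have := LinearMap.congr_fun₂ (pairing_stdForm_of_ne Φ F (fun h' => h h'.symm : ¬ Opp q p)) u v
    exact (mul_eq_zero_of_right ε this).symm

/-- Pairing with the vectors of the frame recovers, up to nonzero scalars, all coordinates of a
vector of the total space; nondegeneracy follows. -/
theorem stdForm_lof (Φ : FormData ε l D) (F : Frame D N) {p q : Vertex l} (h : Opp p q) (r : R)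
    (X : ⨁ p, N.space p) : stdForm Φ F X (DirectSum.lof ℂ _ N.space q (F.x (Φ.dual r) q)) =
      (-1) ^ p.num * Φ.c r * F.coord r p (DirectSum.component ℂ _ N.space p X) := by
  refine LinearMap.congr_fun
    (f := (stdForm Φ F).flip (DirectSum.lof ℂ _ N.space q (F.x (Φ.dual r) q)))
    (g := ((-1) ^ p.num * Φ.c r) • (F.coord r p ∘ₗ DirectSum.component ℂ _ N.space p))
    (DirectSum.linearMap_ext ℂ fun p' => ?_) X
  by_cases hp : p' = p
  · subst hp
    refine F.hom_ext fun r' => (pairing_stdForm Φ F h r' _).trans ?_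
    simp only [LinearMap.comp_apply, LinearMap.smul_apply, DirectSum.component.lof_self, F.dual,
      FormData.gram, smul_eq_mul]
    by_cases hr : r = r'
    · subst hr
      simp
    · rw [if_neg, if_neg (fun h' => hr h'.1), mul_zero]
      rintro ⟨h', -⟩
      exact hr (by simpa [Φ.dual_dual] using congrArg Φ.dual h')
  · ext v
    refine (LinearMap.congr_fun₂ (pairing_stdForm_of_ne Φ F (p := p') (q := q) fun h' => hp ?_)
      v _).trans ?_
    · rw [h'.symm.eq_star, h.symm.eq_star]
    · simp only [LinearMap.comp_apply, LinearMap.smul_apply]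
      rw [DirectSum.component.of, dif_neg hp]
      simp

/-- The standard form makes a representation with a frame into a symmetric one. -/
theorem exists_form (Φ : FormData ε l D) (hε : ε = 1 ∨ ε = -1) (F : Frame D N) :
    ∃ B, IsEpsRep ε N B ∧ IsStandard Φ N B F.x := by
  have hε2 : ε * ε = 1 := by rcases hε with h | h <;> rw [h] <;> norm_num
  have left : (stdForm Φ F).SeparatingLeft := by
    intro X hX
    refine DirectSum.ext_component ℂ fun p => ?_
    rw [map_zero, ← F.span p (DirectSum.component ℂ _ N.space p X)]
    refine Finset.sum_eq_zero fun r _ => ?_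
    have := stdForm_lof Φ F (opp_star p) r X
    rw [hX] at this
    rw [(mul_eq_zero.1 this.symm).resolve_left (Φ.coeff_ne r p), zero_smul]
  refine ⟨stdForm Φ F, ⟨F.isBound Φ, ⟨⟨left, ?_⟩, ?_, ?_⟩, stdForm_eps Φ hε2 F, hε⟩, F.sys,
    fun r r' p p' hp => pairing_stdForm Φ F hp r r'⟩
  · intro Y hY
    refine left Y fun X => ?_
    rw [stdForm_eps Φ hε2 F, hY, mul_zero]
  · intro p q hq x y
    refine LinearMap.congr_fun₂ (pairing_stdForm_of_ne Φ F fun h => hq h.eq_star) x y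
  · intro p q a v u
    refine LinearMap.congr_fun₂
      (f := (pairing N (stdForm Φ F) q (starVertex q)).comp (N.map a) +
        (pairing N (stdForm Φ F) p (starVertex p)).compl₂ (N.map (SymmetricQuiver.arrow a)))
      (g := 0) (F.hom_ext fun r => F.hom_ext fun r' => ?_) v u
    simp only [LinearMap.add_apply, LinearMap.comp_apply, LinearMap.compl₂_apply,
      LinearMap.zero_apply]
    match a with
    | Arrow.step e =>
      have e' : (starVertex q).num + 1 = (starVertex p).num := by
        have := p.le
        have := q.le
        simp only [starVertex]; omega
      have h1 := F.sys.step_eq r e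
      have h2 := F.sys.step_eq r' e'
      refine (congrArg₂ (· + ·) (congrArg (fun z => pairing N (stdForm Φ F) q _ z _) h1)
        (congrArg (pairing N (stdForm Φ F) p _ _) h2)).trans ?_
      rw [apply_ite (pairing N (stdForm Φ F) p (starVertex p) (F.x r p)),
        pairing_stdForm Φ F (opp_star p),
        apply_ite fun z => pairing N (stdForm Φ F) q (starVertex q) z (F.x r' (starVertex q)),
        pairing_stdForm Φ F (opp_star q)]
      simp only [map_zero, LinearMap.zero_apply, FormData.gram]
      by_cases hr : r' = Φ.dual r
      · have h3 := Φ.lo_dual r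
        have h4 : (starVertex p).num + p.num = 2 * l + 2 := by
          have := p.le
          simp only [starVertex]; omega
        have h5 := Φ.lo_le_hi r
        subst hr
        -- By `lo_dual`, the row `r` can be continued from `p` to `q` exactly when its dual can be
        -- continued from `q*` to `p*`, so both terms are present or absent together, with opposite
        -- signs.
        simp only [true_and, RowSystem.Mem, ← e, pow_succ]
        split_ifs <;> first | omega | simp
      · simp [hr]
    | Arrow.loop hp hq =>
      have e1 : (starVertex q).num = l + 1 := by simp only [starVertex]; omega
      have e2 : (starVertex p).num = l + 1 := by simp only [starVertex]; omega
      have h1 := F.sys.loop r p q hp hq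
      have h2 := F.sys.loop r' _ _ e1 e2
      refine (congrArg₂ (· + ·) (congrArg (fun z => pairing N (stdForm Φ F) q _ z _) h1)
        (congrArg (pairing N (stdForm Φ F) p _ _) h2)).trans ?_
      obtain rfl := eq_omega hp
      obtain rfl := eq_omega hq
      have g1 : pairing N (stdForm Φ F) (omega l) (starVertex (omega l))
          ((D.alpha r).elim 0 fun r' => F.x r' (omega l)) (F.x r' (starVertex (omega l))) =
          if D.alpha r = some (Φ.dual r') then - ((-1) ^ (l + 1) * Φ.c r) else 0 := by
        cases hr : D.alpha r with
        | none => simp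
        | some s =>
          simp only [Option.elim]
          rw [pairing_stdForm Φ F (opp_star _), FormData.gram, Φ.c_alpha _ _ hr]
          simp only [Φ.alpha_mem' hr, and_true, Option.some.injEq, omega_num, mul_neg]
          exact if_congr Φ.eq_dual_iff rfl rfl
      have g2 : pairing N (stdForm Φ F) (omega l) (starVertex (omega l)) (F.x r (omega l))
          ((D.alpha r').elim 0 fun r' => F.x r' (starVertex (omega l))) =
          if D.alpha r' = some (Φ.dual r) then (-1) ^ (l + 1) * Φ.c r else 0 := by
        cases hr : D.alpha r' with
        | none => simp
        | some s =>
          simp only [Option.elim]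
          rw [pairing_stdForm Φ F (opp_star _), FormData.gram]
          simp only [Option.some.injEq, omega_num]
          refine if_congr (and_iff_left_of_imp ?_) rfl rfl
          rintro rfl
          rw [← Φ.mem_dual (opp_omega l)]
          exact Φ.alpha_mem' hr
      rw [g1, g2]
      -- Since duality reverses `α`, the two terms occur together and cancel.
      have : D.alpha r = some (Φ.dual r') ↔ D.alpha r' = some (Φ.dual r) := by
        constructor <;> intro h <;> simpa [Φ.dual_dual] using Φ.alpha_dual _ _ h
      simp only [this]
      split_ifs <;> simp

end ExistsForm

end AL

namespace AL

open QuiverRep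

/-! ### Types of indecomposable summands -/

/-- The types of string modules: a row not meeting `ω`, a row at `ω` which `α` does not meet, and
two rows joined by `α`. -/
inductive Kind where
  | chain (i j : ℕ)
  | one (m : ℕ)
  | two (s t : ℕ)

variable {l : ℕ}

/-- The string module of the given type is a direct summand of `N`. -/
def Has (N : QuiverRep.{w} ℂ (Vertex l)) : Kind → Prop
  -- Each clause says that a subquotient attached functorially to `N` is nonzero. For index `1` the
  -- subtraction gives `0`, where the rows and the filtration vanish.
  | .chain i j => ∃ p : Vertex l, p.num = j ∧ ∃ v ∈ rowSpace N i j p,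
      v ∉ rowSpace N (i - 1) (2 * l + 1) p
  | .one m => ∃ v ∈ filt N m, alphaMap N v = 0 ∧
      v ∉ filt N (m - 1) ⊔ LinearMap.range (alphaMap N)
  | .two s t => ∃ v ∈ filt N s, alphaMap N v ∈ filt N t ∧
      alphaMap N v ∉ filt N (t - 1) ⊔ (filt N (s - 1)).map (alphaMap N)

/-! ### Homomorphisms preserve rows and filtration, so types are additive -/

section Hom

variable {N : QuiverRep.{w} ℂ (Vertex l)} {N' N₁ N₂ : QuiverRep ℂ (Vertex l)}

/-- The family `f` is a homomorphism of representations. -/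
def IsHom (N : QuiverRep.{w} ℂ (Vertex l)) (N' : QuiverRep ℂ (Vertex l))
    (f : ∀ p, N.space p →ₗ[ℂ] N'.space p) : Prop :=
  ∀ (p q : Vertex l) (a : p ⟶ q) (x : N.space p), f q (N.map a x) = N'.map a (f p x)

variable {f : ∀ p, N.space p →ₗ[ℂ] N'.space p}

theorem IsHom.isRow (hf : IsHom N N' f) {lo hi : ℕ} {x : ∀ p, N.space p} (hx : IsRow N lo hi x) :
    IsRow N' lo hi fun p => f p (x p) where
  supp p hp := by rw [hx.supp p hp, map_zero]
  step p q e hq := by rw [← hx.step p q e hq]; exact (hf _ _ _ _).symm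
  first q hq hl := by rw [hx.first q hq hl, map_zero]

theorem IsHom.mem_rowSpace (hf : IsHom N N' f) {lo hi : ℕ} {p : Vertex l} {v : N.space p}
    (hv : v ∈ rowSpace N lo hi p) : f p v ∈ rowSpace N' lo hi p := by
  obtain ⟨x, hx, rfl⟩ := hv
  exact ⟨_, hf.isRow hx, rfl⟩

theorem IsHom.mem_filt (hf : IsHom N N' f) {m : ℕ} {v : N.space (omega l)}
    (hv : v ∈ filt N m) : f _ v ∈ filt N' m := hf.mem_rowSpace hv

theorem IsHom.alpha (hf : IsHom N N' f) (v : N.space (omega l)) :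
    f _ (alphaMap N v) = alphaMap N' (f _ v) := hf _ _ _ _

theorem IsHom.mem_sup_range (hf : IsHom N N' f) {m : ℕ} {v : N.space (omega l)}
    (hv : v ∈ filt N m ⊔ LinearMap.range (alphaMap N)) :
    f _ v ∈ filt N' m ⊔ LinearMap.range (alphaMap N') := by
  obtain ⟨g, hg, _, ⟨u, rfl⟩, rfl⟩ := Submodule.mem_sup.1 hv
  rw [map_add, hf.alpha]
  exact Submodule.add_mem_sup (hf.mem_filt hg) ⟨_, rfl⟩

theorem IsHom.mem_sup_map (hf : IsHom N N' f) {s t : ℕ} {v : N.space (omega l)}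
    (hv : v ∈ filt N t ⊔ (filt N s).map (alphaMap N)) :
    f _ v ∈ filt N' t ⊔ (filt N' s).map (alphaMap N') := by
  obtain ⟨g, hg, _, ⟨u, hu, rfl⟩, rfl⟩ := Submodule.mem_sup.1 hv
  rw [map_add, hf.alpha]
  exact Submodule.add_mem_sup (hf.mem_filt hg) ⟨_, hf.mem_filt hu, rfl⟩

/-- A string module which is a summand of `N₁ ⊕ N₂` is one of `N₁` or of `N₂`. -/
theorem Has.of_decomposition {f₁ : ∀ p, N.space p →ₗ[ℂ] N₁.space p}
    {f₂ : ∀ p, N.space p →ₗ[ℂ] N₂.space p} {g₁ : ∀ p, N₁.space p →ₗ[ℂ] N.space p}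
    {g₂ : ∀ p, N₂.space p →ₗ[ℂ] N.space p} (hf₁ : IsHom N N₁ f₁) (hf₂ : IsHom N N₂ f₂)
    (hg₁ : IsHom N₁ N g₁) (hg₂ : IsHom N₂ N g₂)
    (hsum : ∀ p v, g₁ p (f₁ p v) + g₂ p (f₂ p v) = v) {k : Kind} (h : Has N k) :
    Has N₁ k ∨ Has N₂ k := by
  -- If both components of the chosen vector lie in the subspaces to be avoided, so does their sum
  -- after mapping back to `N`.
  by_contra! hc
  obtain ⟨c₁, c₂⟩ := hc
  cases k with
  | chain i j =>
    obtain ⟨p, hp, v, hv, hv'⟩ := h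
    refine hv' ?_
    have d₁ : f₁ p v ∈ rowSpace N₁ (i - 1) (2 * l + 1) p := by
      by_contra hd
      exact c₁ ⟨p, hp, _, hf₁.mem_rowSpace hv, hd⟩
    have d₂ : f₂ p v ∈ rowSpace N₂ (i - 1) (2 * l + 1) p := by
      by_contra hd
      exact c₂ ⟨p, hp, _, hf₂.mem_rowSpace hv, hd⟩
    rw [← hsum p v]
    exact add_mem (hg₁.mem_rowSpace d₁) (hg₂.mem_rowSpace d₂)
  | one m =>
    obtain ⟨v, hv, hv0, hv'⟩ := h
    refine hv' ?_
    have d₁ : f₁ _ v ∈ filt N₁ (m - 1) ⊔ LinearMap.range (alphaMap N₁) := by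
      by_contra hd
      exact c₁ ⟨_, hf₁.mem_filt hv, by rw [← hf₁.alpha, hv0, map_zero], hd⟩
    have d₂ : f₂ _ v ∈ filt N₂ (m - 1) ⊔ LinearMap.range (alphaMap N₂) := by
      by_contra hd
      exact c₂ ⟨_, hf₂.mem_filt hv, by rw [← hf₂.alpha, hv0, map_zero], hd⟩
    rw [← hsum _ v]
    exact add_mem (hg₁.mem_sup_range d₁) (hg₂.mem_sup_range d₂)
  | two s t =>
    obtain ⟨v, hv, hvt, hv'⟩ := h
    refine hv' ?_
    have d₁ : f₁ _ (alphaMap N v) ∈ filt N₁ (t - 1) ⊔ (filt N₁ (s - 1)).map (alphaMap N₁) := by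
      by_contra hd
      rw [hf₁.alpha] at hd
      exact c₁ ⟨_, hf₁.mem_filt hv, by rw [← hf₁.alpha]; exact hf₁.mem_filt hvt, hd⟩
    have d₂ : f₂ _ (alphaMap N v) ∈ filt N₂ (t - 1) ⊔ (filt N₂ (s - 1)).map (alphaMap N₂) := by
      by_contra hd
      rw [hf₂.alpha] at hd
      exact c₂ ⟨_, hf₂.mem_filt hv, by rw [← hf₂.alpha]; exact hf₂.mem_filt hvt, hd⟩
    rw [← hsum _ (alphaMap N v)]
    exact add_mem (hg₁.mem_sup_map d₁) (hg₂.mem_sup_map d₂)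

theorem IsHom.symm {e : ∀ p, N.space p ≃ₗ[ℂ] N'.space p} (he : IsIsomorphism N N' e) :
    IsHom N' N fun p => (e p).symm.toLinearMap := by
  intro p q a x
  apply (e q).injective
  simp [he p q a]

theorem Has.of_isomorphic (hN : N.Isomorphic N') {k : Kind} (h : Has N k) : Has N' k := by
  obtain ⟨e, he⟩ := hN
  -- An isomorphism is used as a decomposition in which the second inclusion is zero.
  have := h.of_decomposition (f₁ := fun p => (e p).toLinearMap) (f₂ := fun p => (e p).toLinearMap)
    (g₁ := fun p => (e p).symm.toLinearMap) (g₂ := fun _ => 0) he he (IsHom.symm he)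
    (fun p q a x => by simp) (fun p v => by simp)
  exact or_self_iff.1 this

theorem isomorphic_symm (hN : N.Isomorphic N') : N'.Isomorphic N := by
  obtain ⟨e, he⟩ := hN
  exact ⟨fun p => (e p).symm, IsHom.symm he⟩

end Hom

/-! ### Every nonzero representation has a summand -/

section Existence

variable {N : QuiverRep.{w} ℂ (Vertex l)} {B : N.Form} {ε : ℂ}

/-- The parameters of a type are in the range where they describe a string module; of a string
module and its dual, in the case of one row, only one needs to be considered. -/
def Kind.Valid (l : ℕ) : Kind → Prop
  | .chain i j => 1 ≤ i ∧ i ≤ j ∧ j ≤ l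
  | .one m => 1 ≤ m ∧ m ≤ l + 1
  | .two s t => 1 ≤ s ∧ s ≤ 2 * l + 1 ∧ 1 ≤ t ∧ t ≤ 2 * l + 1

/-- Choose `t` least such that `filt N t` contains a nonzero value of `α`, then `s` least such that
`filt N s` contains a preimage of such a value. If `αv = g + αu` with `g` and `u` one step lower,
then `g = α(v - u)` vanishes by the choice of `t`, and `αv = αu` contradicts the choice of `s`. -/
theorem exists_two (h : ∃ v, alphaMap N v ≠ 0) :
    ∃ s t, Kind.Valid l (.two s t) ∧ Has N (.two s t) := by
  classical
  have ex : ∃ t s, t ≤ 2 * l + 1 ∧ s ≤ 2 * l + 1 ∧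
      ∃ v ∈ filt N s, alphaMap N v ∈ filt N t ∧ alphaMap N v ≠ 0 := by
    obtain ⟨v, hv⟩ := h
    exact ⟨2 * l + 1, 2 * l + 1, le_rfl, le_rfl, v, by simp [filt_top], by simp [filt_top], hv⟩
  have ex' := Nat.find_spec ex
  have mt := fun m hm => Nat.find_min ex (m := m) hm
  set t := Nat.find ex
  have ms := fun m hm => Nat.find_min ex' (m := m) hm
  obtain ⟨ht, hs, v, hv, hvt, hv0⟩ := Nat.find_spec ex'
  set s := Nat.find ex'
  have ht1 : 1 ≤ t := by
    by_contra hc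
    obtain h0 : t = 0 := by omega
    rw [h0, filt_zero] at hvt
    exact hv0 hvt
  have hs1 : 1 ≤ s := by
    by_contra hc
    obtain h0 : s = 0 := by omega
    rw [h0, filt_zero, Submodule.mem_bot] at hv
    simp [hv] at hv0
  refine ⟨s, t, ⟨hs1, hs, ht1, ht⟩, v, hv, hvt, fun hm => ?_⟩
  obtain ⟨g, hg, _, ⟨u, hu, rfl⟩, e⟩ := Submodule.mem_sup.1 hm
  have eg : alphaMap N (v - u) = g := by rw [map_sub, ← e]; abel
  have g0 : g = 0 := by
    by_contra hc
    exact mt (t - 1) (by omega) ⟨2 * l + 1, by omega, le_rfl, v - u, by simp [filt_top],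
      by rwa [eg], by rwa [eg]⟩
  rw [g0, zero_add] at e
  exact ms (s - 1) (by omega) ⟨ht, by omega, u, hu, by rwa [e], by rwa [e]⟩

/-- Take the first nonzero step of the filtration. It occurs at `l + 1` or earlier, since `filt N (l
+ 1)` contains the orthogonal of `filt N l` and is everything if the latter is zero. -/
theorem IsEpsRep.exists_one (h : IsEpsRep ε N B) (h0 : ∀ v, alphaMap N v = 0)
    (hω : Nontrivial (N.space (omega l))) : ∃ m, Kind.Valid l (.one m) ∧ Has N (.one m) := by
  classical
  have hr : LinearMap.range (alphaMap N) = ⊥ := by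
    rw [LinearMap.range_eq_bot]
    exact LinearMap.ext h0
  have ex : ∃ m, filt N m ≠ ⊥ := ⟨2 * l + 1, by rw [filt_top]; exact top_ne_bot⟩
  have hm := Nat.find_spec ex
  have mm := fun m hm => Nat.find_min ex (m := m) hm
  set m := Nat.find ex
  obtain ⟨v, hv, hv0⟩ := Submodule.exists_mem_ne_zero_of_ne_bot hm
  have hm1 : 1 ≤ m := by
    by_contra hc
    rw [show m = 0 by omega, filt_zero] at hm
    exact hm rfl
  refine ⟨m, ⟨hm1, ?_⟩, v, hv, h0 v, ?_⟩
  · by_contra hc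
    have h1 := not_not.1 (mm (l + 1) (by omega))
    obtain ⟨u, hu⟩ := exists_ne (0 : N.space (omega l))
    have h2 := not_not.1 (mm l (by omega))
    have := h.mem_filt_of_orthogonal (n := l) (by omega) u
      (fun v hv => by rw [h2, Submodule.mem_bot] at hv; simp [hv])
    rw [show 2 * l + 1 - l = l + 1 by omega, h1] at this
    exact hu this
  · rw [hr, not_not.1 (mm (m - 1) (by omega))]
    simpa using hv0

/-- Follow a nonzero vector until it dies, which happens at `ω` at the latest, then extend
backwards: take the least start `i` of a row with the same end whose last vector is nonzero. A
preimage of that vector further back would give a longer row. -/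
theorem exists_chain (hω : ∀ v : N.space (omega l), v = 0) (p : Vertex l) (hp : p.num ≤ l)
    (v : N.space p) (hv : v ≠ 0) : ∃ i j, Kind.Valid l (.chain i j) ∧ Has N (.chain i j) := by
  classical
  obtain ⟨x, hx, rfl⟩ := exists_row p v
  have ex : ∃ m, p.num ≤ m ∧ ∃ hm : 1 ≤ m ∧ m ≤ 2 * l + 1, x ⟨m, hm.1, hm.2⟩ = 0 :=
    ⟨l + 1, by omega, by omega, hω _⟩
  obtain ⟨n, ⟨h1, h2, h3⟩, mm⟩ : ∃ n, (p.num ≤ n ∧ ∃ hm : 1 ≤ n ∧ n ≤ 2 * l + 1,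
      x ⟨n, hm.1, hm.2⟩ = 0) ∧ ∀ m < n, ¬ (p.num ≤ m ∧ ∃ hm : 1 ≤ m ∧ m ≤ 2 * l + 1,
      x ⟨m, hm.1, hm.2⟩ = 0) := ⟨_, Nat.find_spec ex, fun m hm => Nat.find_min ex hm⟩
  have hle : n ≤ l + 1 := by
    by_contra hc
    exact mm (l + 1) (by omega) ⟨by omega, ⟨by omega, by omega⟩, hω _⟩
  have hpn : p.num ≠ n := by
    intro e
    obtain rfl : p = ⟨n, h2.1, h2.2⟩ := Vertex.ext e
    exact hv h3
  have hcut := hx.cut _ h3 h1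
  have := p.one_le
  let q : Vertex l := ⟨n - 1, by omega, by omega⟩
  have hq : x q ≠ 0 := fun h0 => mm (n - 1) (by omega) ⟨by omega, ⟨by omega, by omega⟩, h0⟩
  have ex2 : ∃ i, i ≤ n - 1 ∧ ∃ y, IsRow N i (n - 1) y ∧ y q ≠ 0 := ⟨p.num, by omega, x, hcut, hq⟩
  obtain ⟨hi, y, hy, hy0⟩ := Nat.find_spec ex2
  have mi := fun m hm => Nat.find_min ex2 (m := m) hm
  set i := Nat.find ex2
  have hi1 : 1 ≤ i := by
    by_contra hc
    rw [show i = 0 by omega] at hy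
    exact hy0 (hy.eq_zero q)
  refine ⟨i, n - 1, ⟨hi1, hi, by omega⟩, q, rfl, y q, ⟨y, hy, rfl⟩, ?_⟩
  rintro ⟨z, hz, e⟩
  refine mi (i - 1) (by omega) ⟨by omega, z, ?_, by rwa [e]⟩
  let r : Vertex l := ⟨n, h2.1, h2.2⟩
  have e1 : q.num + 1 = r.num := by simp only [q, r]; omega
  refine hz.cut r ?_ (by simp only [r]; omega)
  rw [← hz.step q r e1 (by simp only [r]; omega), e, hy.step q r e1 (by simp only [r]; omega)]
  exact hy.supp r (by simp only [r]; omega)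

/-- A nonzero representation with a form has a string module as a summand. -/
theorem IsEpsRep.exists_has (h : IsEpsRep ε N B) (hN : ∃ p, Nontrivial (N.space p)) :
    ∃ k, Kind.Valid l k ∧ Has N k := by
  by_cases h1 : ∃ v, alphaMap N v ≠ 0
  · obtain ⟨s, t, h⟩ := exists_two h1
    exact ⟨_, h⟩
  push Not at h1
  by_cases h2 : ∀ v : N.space (omega l), v = 0
  · have : ∃ p : Vertex l, p.num ≤ l ∧ ∃ v : N.space p, v ≠ 0 := by
      obtain ⟨p, hp⟩ := hN
      obtain ⟨v, hv⟩ := exists_ne (0 : N.space p)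
      have := p.le
      rcases lt_trichotomy p.num (l + 1) with hl | hl | hl
      · exact ⟨p, by omega, v, hv⟩
      · obtain rfl := eq_omega hl
        exact absurd (h2 v) hv
      -- A nonzero space after `ω` is paired perfectly with one before `ω`.
      · refine ⟨starVertex p, by simp only [starVertex]; omega, ?_⟩
        by_contra! hc
        exact hv (h.eq_zero_of_pairing_left (opp_star p) v fun y => by rw [hc y, map_zero])
    obtain ⟨p, hp, v, hv⟩ := this
    obtain ⟨i, j, h⟩ := exists_chain h2 p hp v hv
    exact ⟨_, h⟩
  · push Not at h2
    obtain ⟨v, hv⟩ := h2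
    obtain ⟨m, h⟩ := h.exists_one h1 ⟨v, 0, hv⟩
    exact ⟨_, h⟩

end Existence

end AL

namespace AL

open QuiverRep

/-! ### The standard forms on the representations of the list -/

/-- A single row without arrow `α`. -/
def oneRowSystem (lo hi : ℕ) : RowSystem Unit := ⟨fun _ => lo, fun _ => hi, fun _ => none⟩

/-- Two rows joined by an arrow `α`. -/
def twoRowSystem (lo₀ hi₀ lo₁ hi₁ : ℕ) : RowSystem (Fin 2) :=
  ⟨![lo₀, lo₁], ![hi₀, hi₁], ![some 1, none]⟩

/-- A row and its dual. -/
def pairSystem (l i j : ℕ) : RowSystem (Unit ⊕ Unit) :=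
  (oneRowSystem i j).sum (oneRowSystem (st l j) (st l i))

/-- Two rows joined by `α`: from `ω` to the vertices `s` and `t`. -/
def arrowSystem (l s t : ℕ) : RowSystem (Fin 2) :=
  twoRowSystem (min s (l + 1)) (max s (l + 1)) (min t (l + 1)) (max t (l + 1))

/-- A pair of rows joined by `α`, and its dual. -/
def doubleSystem (l s t : ℕ) : RowSystem (Fin 2 ⊕ Fin 2) :=
  (arrowSystem l s t).sum (arrowSystem l (st l t) (st l s))

variable {l s t i j : ℕ} {ε : ℂ}

theorem min_st_add_max (hs : s ≤ 2 * l + 2) : min (st l s) (l + 1) + max s (l + 1) = 2 * l + 2 := by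
  simp only [st]
  omega

theorem max_st_add_min (hs : s ≤ 2 * l + 2) : max (st l s) (l + 1) + min s (l + 1) = 2 * l + 2 := by
  simp only [st]
  omega

theorem oneRowSystem_regular {lo hi : ℕ} (h1 : 1 ≤ lo) (h2 : lo ≤ hi) (h3 : hi ≤ 2 * l + 1)
    (h4 : hi ≤ l + 1 ∨ l + 1 ≤ lo) : (oneRowSystem lo hi).Regular l :=
  ⟨fun _ => h2, fun _ => h1, fun _ => h3, fun _ => h4⟩

theorem arrowSystem_regular (hs : 1 ≤ s ∧ s ≤ 2 * l + 1) (ht : 1 ≤ t ∧ t ≤ 2 * l + 1) :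
    (arrowSystem l s t).Regular l where
  lo_le_hi r := by fin_cases r <;> simp [arrowSystem, twoRowSystem]
  one_le_lo r := by fin_cases r <;> simp [arrowSystem, twoRowSystem] <;> omega
  hi_le r := by fin_cases r <;> simp [arrowSystem, twoRowSystem] <;> omega
  half r := by fin_cases r <;> simp [arrowSystem, twoRowSystem] <;> omega

theorem arrowSystem_mem (r : Fin 2) : (arrowSystem l s t).Mem r (omega l) := by
  fin_cases r <;> simp [arrowSystem, twoRowSystem, RowSystem.Mem]

theorem doubleSystem_mem (r : Fin 2 ⊕ Fin 2) : (doubleSystem l s t).Mem r (omega l) := by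
  rcases r with r | r
  · exact arrowSystem_mem (s := s) (t := t) r
  · exact arrowSystem_mem (s := st l t) (t := st l s) r

/-- The standard form on the sum of a row and its dual. -/
def pairForm (hε : ε = 1 ∨ ε = -1) (h1 : 1 ≤ i) (h2 : i ≤ j) (h3 : j ≤ l + 1) :
    FormData ε l (pairSystem l i j) where
  toRegular := (oneRowSystem_regular h1 h2 (by omega) (.inl h3)).sum
    (oneRowSystem_regular (by simp only [st]; omega) (by simp only [st]; omega)
      (by simp only [st]; omega) (.inr (by simp only [st]; omega)))
  dual := Sum.swap
  c := Sum.elim (fun _ => 1) (fun _ => ε)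
  c_ne r := by rcases hε with rfl | rfl <;> rcases r with r | r <;> simp
  dual_dual := Sum.swap_swap
  lo_dual r := by
    rcases r with r | r <;> simp [pairSystem, RowSystem.sum, oneRowSystem, st] <;> omega
  c_dual r := by rcases hε with rfl | rfl <;> rcases r with r | r <;> simp
  alpha_dual r r' h := by rcases r with r | r <;> cases h
  c_alpha r r' h := by rcases r with r | r <;> cases h
  alpha_alpha r r' h := by rcases r with r | r <;> cases h
  alpha_mem r r' h := by rcases r with r | r <;> cases h

theorem st_mem (hs : 1 ≤ s ∧ s ≤ 2 * l + 1) : 1 ≤ st l s ∧ st l s ≤ 2 * l + 1 := by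
  simp only [st]
  omega

/-- The standard form on the sum of a pair of rows joined by `α` and its dual. -/
def doubleForm (hε : ε = 1 ∨ ε = -1) (hs : 1 ≤ s ∧ s ≤ 2 * l + 1)
    (ht : 1 ≤ t ∧ t ≤ 2 * l + 1) : FormData ε l (doubleSystem l s t) where
  toRegular := (arrowSystem_regular hs ht).sum (arrowSystem_regular (st_mem ht) (st_mem hs))
  -- Duality reverses `α`, hence `Fin.rev`. In `c`, rows joined by `α` have opposite values and dual
  -- rows differ by the factor `ε`.
  dual := Sum.elim (fun r => Sum.inr r.rev) (fun r => Sum.inl r.rev)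
  c := Sum.elim ![1, -1] ![-ε, ε]
  c_ne r := by
    rcases hε with rfl | rfl <;> rcases r with r | r <;> fin_cases r <;> simp
  dual_dual r := by rcases r with r | r <;> simp
  lo_dual r := by
    rcases r with r | r <;> fin_cases r
    · exact min_st_add_max (by omega)
    · exact min_st_add_max (by omega)
    · exact (add_comm _ _).trans (max_st_add_min (by omega))
    · exact (add_comm _ _).trans (max_st_add_min (by omega))
  c_dual r := by
    rcases hε with rfl | rfl <;> rcases r with r | r <;> fin_cases r <;> simp
  alpha_dual r r' h := by
    rcases r with r | r <;> fin_cases r <;> cases h <;> rfl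
  c_alpha r r' h := by
    rcases r with r | r <;> fin_cases r <;> cases h <;> simp
  alpha_alpha r r' h := by
    rcases r with r | r <;> fin_cases r <;> cases h <;> rfl
  alpha_mem r r' h := doubleSystem_mem r

/-- The standard symplectic form on a self-dual pair of rows joined by `α`. -/
def selfForm (hs : 1 ≤ s) (ht : 1 ≤ t) (hst : s + t = 2 * l + 2) :
    FormData (-1) l (arrowSystem l s t) where
  toRegular := arrowSystem_regular ⟨hs, by omega⟩ ⟨ht, by omega⟩
  dual := Fin.rev
  -- The two rows are both dual to each other and joined by `α`, so `c_dual` and `c_alpha` together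
  -- force `ε = -1`.
  c := ![1, -1]
  c_ne r := by fin_cases r <;> simp
  dual_dual r := Fin.rev_rev r
  lo_dual r := by fin_cases r <;> simp [arrowSystem, twoRowSystem] <;> omega
  c_dual r := by fin_cases r <;> simp
  alpha_dual r r' h := by fin_cases r <;> cases h; rfl
  c_alpha r r' h := by fin_cases r <;> cases h; simp
  alpha_alpha r r' h := by fin_cases r <;> cases h; rfl
  alpha_mem r r' h := arrowSystem_mem r

/-- The standard orthogonal form on the simple representation at `ω`. -/
def simpleForm (l : ℕ) : FormData 1 l (oneRowSystem (l + 1) (l + 1)) where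
  toRegular := oneRowSystem_regular (by omega) le_rfl (by omega) (.inl le_rfl)
  dual := id
  c _ := 1
  c_ne _ := one_ne_zero
  dual_dual _ := rfl
  lo_dual _ := by simp only [oneRowSystem]; omega
  c_dual _ := by simp
  alpha_dual r r' h := by cases h
  c_alpha r r' h := by cases h
  alpha_alpha r r' h := by cases h
  alpha_mem r r' h := by cases h

/-! ### Finding standard systems inside a representation with a form -/

section Realise

variable {N : QuiverRep.{w} ℂ (Vertex l)} {B : N.Form}

/-- A system of rows through `ω` is standard if it is standard at `ω`. -/
theorem IsEpsRep.isStandard_of_omega {R : Type} [DecidableEq R] {D : RowSystem R}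
    {Φ : FormData ε l D} (h : IsEpsRep ε N B) {x : R → ∀ p, N.space p} (hx : IsSystem D N x)
    (hD : ∀ r, D.Mem r (omega l)) (hg : ∀ r r', pairing N B _ _ (x r (omega l)) (x r' (omega l)) =
      if r' = Φ.dual r then (-1) ^ (l + 1) * Φ.c r else 0) : IsStandard Φ N B x := by
  refine ⟨hx, fun r r' p p' hp => ?_⟩
  by_cases h1 : D.Mem r p
  · by_cases h2 : D.Mem r' p'
    · have key : (-1) ^ p.num * pairing N B p p' (x r p) (x r' p') = (-1) ^ (l + 1) *
          pairing N B _ _ (x r (omega l)) (x r' (omega l)) := by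
        rcases le_total p.num (l + 1) with hl | hl
        · exact h.pairing_rows (hx.row r) (hx.row r') hp (opp_omega l) hl h1.1 (hD r').1
        · exact (h.pairing_rows (hx.row r) (hx.row r') (opp_omega l) hp hl (hD r).1 h2.1).symm
      rw [hg] at key
      rw [FormData.gram]
      have e1 : ((-1 : ℂ) ^ p.num) * (-1) ^ p.num = 1 := by
        rw [← pow_add, ← two_mul, pow_mul]; simp
      have e2 : ((-1 : ℂ) ^ (l + 1)) * (-1) ^ (l + 1) = 1 := by
        rw [← pow_add, ← two_mul, pow_mul]; simp
      simp only [h1, and_true]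
      split_ifs at key ⊢
      · linear_combination (-1) ^ p.num * key + (-1) ^ p.num * Φ.c r * e2 -
          pairing N B p p' (x r p) (x r' p') * e1
      · linear_combination (-1) ^ p.num * key - pairing N B p p' (x r p) (x r' p') * e1
    · rw [hx.supp h2, map_zero, FormData.gram, if_neg]
      rintro ⟨rfl, h3⟩
      exact h2 ((Φ.mem_dual hp r).2 h3)
  · rw [hx.supp h1, map_zero, LinearMap.zero_apply, FormData.gram, if_neg (fun h' => h1 h'.2)]

theorem loopMap_eq {x y : ∀ p, N.space p} (h : alphaMap N (x (omega l)) = y (omega l))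
    (p q : Vertex l) (hp : p.num = l + 1) (hq : q.num = l + 1) :
    loopMap N hp hq (x p) = y q := by
  obtain rfl := eq_omega hp
  obtain rfl := eq_omega hq
  exact h

theorem IsRow.loop_eq_zero {x : ∀ p, N.space p} (h : alphaMap N (x (omega l)) = 0)
    (p q : Vertex l) (hp : p.num = l + 1) (hq : q.num = l + 1) : loopMap N hp hq (x p) = 0 :=
  loopMap_eq (y := 0) h p q hp hq

theorem isSystem_arrow {v : N.space (omega l)} (hb : IsBound N) (hv : v ∈ filt N s)
    (ht : alphaMap N v ∈ filt N t) : ∃ x, IsSystem (arrowSystem l s t) N x ∧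
      x 0 (omega l) = v ∧ x 1 (omega l) = alphaMap N v := by
  obtain ⟨x, hx, rfl⟩ := hv
  obtain ⟨y, hy, e⟩ := ht
  refine ⟨![x, y], ⟨fun r => ?_, fun r => ?_⟩, rfl, e⟩
  · fin_cases r
    · exact hx
    · exact hy
  · fin_cases r
    · exact loopMap_eq e.symm
    · exact IsRow.loop_eq_zero (x := y) (by rw [e, hb.alphaMap_sq])

/-! #### Two rows joined by `α` -/

/-- Vectors which span, together with their images, the sum of two string modules in duality. -/
structure IsDualPair (N : QuiverRep.{w} ℂ (Vertex l)) (B : N.Form) (s t : ℕ) (κ : ℂ)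
    (v v' : N.space (omega l)) : Prop where
  mem : v ∈ filt N s
  alpha_mem : alphaMap N v ∈ filt N t
  mem' : v' ∈ filt N (st l t)
  alpha_mem' : alphaMap N v' ∈ filt N (st l s)
  pairing_eq : pairing N B _ _ v (alphaMap N v') = κ

variable {κ : ℂ} {v v' : N.space (omega l)}

/-- Take `y` orthogonal to the subspace avoided by `αv` but not to `αv`. Orthogonality to `filt N (t
- 1)` places `y` in the filtration, and orthogonality to the image of `filt N (s - 1)` under `α`
places `αy` there. -/
theorem IsEpsRep.exists_isDualPair (h : IsEpsRep ε N B) (hs : 1 ≤ s ∧ s ≤ 2 * l + 1)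
    (ht : 1 ≤ t ∧ t ≤ 2 * l + 1) (hN : Has N (.two s t)) :
    ∃ v v' κ, κ ≠ 0 ∧ IsDualPair N B s t κ v v' := by
  obtain ⟨v, hv, hvt, hv'⟩ := hN
  obtain ⟨y, hy, hy'⟩ := h.exists_orthogonal (opp_omega l) hv'
  refine ⟨v, y, - pairing N B _ _ (alphaMap N v) y, neg_ne_zero.2 hy', hv, hvt, ?_, ?_,
    by rw [h.pairing_alpha]; ring⟩
  · have := h.mem_filt_of_orthogonal (n := t - 1) (by omega) y
      fun u hu => hy u (Submodule.mem_sup_left hu)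
    rwa [show 2 * l + 1 - (t - 1) = st l t by simp only [st]; omega] at this
  · have := h.mem_filt_of_orthogonal (n := s - 1) (by omega) (alphaMap N y) fun u hu => by
      have := hy _ (Submodule.mem_sup_right (Submodule.mem_map_of_mem hu))
      rwa [h.pairing_alpha, neg_eq_zero] at this
    rwa [show 2 * l + 1 - (s - 1) = st l s by simp only [st]; omega] at this

/-- Pairing with `v'` kills the subspace to be avoided, by `pairing_filt`, but takes the value `-κ`
on `αv`. -/
theorem IsEpsRep.has_two (h : IsEpsRep ε N B) (hs : 1 ≤ s) (ht : 1 ≤ t) (hκ : κ ≠ 0)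
    (hv : IsDualPair N B s t κ v v') : Has N (.two s t) := by
  refine ⟨v, hv.mem, hv.alpha_mem, fun hm => hκ ?_⟩
  obtain ⟨g, hg, _, ⟨u, hu, rfl⟩, e⟩ := Submodule.mem_sup.1 hm
  have h1 : pairing N B _ _ g v' = 0 := by
    -- Beyond `2 * l + 2`, truncated subtraction gives `st l t = 0`, so `v'` is zero.
    by_cases h0 : t ≤ 2 * l + 2
    · exact h.pairing_filt (by simp only [st]; omega) hg hv.mem'
    · have := hv.mem'
      rw [show st l t = 0 by simp only [st]; omega, filt_zero, Submodule.mem_bot] at this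
      simp [this]
  have h2 : pairing N B _ _ u (alphaMap N v') = 0 := by
    by_cases h0 : s ≤ 2 * l + 2
    · exact h.pairing_filt (by simp only [st]; omega) hu hv.alpha_mem'
    · have := hv.alpha_mem'
      rw [show st l s = 0 by simp only [st]; omega, filt_zero, Submodule.mem_bot] at this
      simp [this]
  have := h.pairing_alpha v v'
  rw [← e, map_add, LinearMap.add_apply, h1, h.pairing_alpha, h2, hv.pairing_eq] at this
  simpa using this.symm

/-- The form `⟨x, αy⟩` is `(-ε)`-symmetric: symmetric in the symplectic case, alternating in the
orthogonal one. This decides which self-dual pairs of rows carry a form. -/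
theorem IsEpsRep.alpha_swap (h : IsEpsRep ε N B) (x y : N.space (omega l)) :
    pairing N B _ _ y (alphaMap N x) = - ε * pairing N B _ _ x (alphaMap N y) := by
  rw [h.pairing_swap, h.pairing_alpha]; ring

theorem IsDualPair.swap (h : IsEpsRep ε N B) (hs : s ≤ 2 * l + 2) (ht : t ≤ 2 * l + 2)
    (hv : IsDualPair N B s t κ v v') : IsDualPair N B (st l t) (st l s) (-ε * κ) v' v where
  mem := hv.mem'
  alpha_mem := hv.alpha_mem'
  mem' := by rw [show st l (st l s) = s by simp only [st]; omega]; exact hv.mem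
  alpha_mem' := by rw [show st l (st l t) = t by simp only [st]; omega]; exact hv.alpha_mem
  pairing_eq := by rw [h.alpha_swap, hv.pairing_eq]

/-- A dual pair on which the form is standard. -/
structure IsNormalPair (N : QuiverRep.{w} ℂ (Vertex l)) (B : N.Form) (s t : ℕ) (κ : ℂ)
    (v v' : N.space (omega l)) : Prop extends IsDualPair N B s t κ v v' where
  left_alpha : pairing N B _ _ v (alphaMap N v) = 0
  right_alpha : pairing N B _ _ v' (alphaMap N v') = 0
  left : pairing N B _ _ v v = 0
  right : pairing N B _ _ v' v' = 0
  left_right : pairing N B _ _ v v' = 0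

theorem IsNormalPair.swap (h : IsEpsRep ε N B) (hs : s ≤ 2 * l + 2) (ht : t ≤ 2 * l + 2)
    (hv : IsNormalPair N B s t κ v v') : IsNormalPair N B (st l t) (st l s) (-ε * κ) v' v where
  toIsDualPair := hv.toIsDualPair.swap h hs ht
  left_alpha := hv.right_alpha
  right_alpha := hv.left_alpha
  left := hv.right
  right := hv.left
  left_right := by rw [h.pairing_swap, hv.left_right, mul_zero]

theorem IsEpsRep.alpha_alpha (h : IsEpsRep ε N B) (x y : N.space (omega l)) :
    pairing N B _ _ (alphaMap N x) (alphaMap N y) = 0 := by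
  rw [h.pairing_alpha, h.bound.alphaMap_sq, map_zero, neg_zero]

/-- In the orthogonal case `v` can be made isotropic. -/
theorem IsEpsRep.isotropic_left (h : IsEpsRep 1 N B) (hκ : κ ≠ 0)
    (hv : IsDualPair N B s t κ v v') : ∃ c : ℂ, pairing N B _ _ (v + c • alphaMap N v')
      (v + c • alphaMap N v') = 0 ∧ v + c • alphaMap N v' ∈ filt N s := by
  -- If `s ≤ l`, then `filt N s` is already isotropic. Otherwise it contains the isotropic vector
  -- `αv'`, which pairs to `κ` with `v`, and `c` solves `⟨v, v⟩ + 2cκ = 0`.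
  rcases Nat.lt_or_ge l s with hs | hs
  · refine ⟨- pairing N B _ _ v v / (2 * κ), ?_,
      add_mem hv.mem (Submodule.smul_mem _ _ (filt_mono (by simp only [st]; omega) hv.alpha_mem'))⟩
    have e : pairing N B _ _ (alphaMap N v') v = κ := by
      rw [h.pairing_swap, hv.pairing_eq, one_mul]
    simp only [map_add, map_smul, LinearMap.add_apply, LinearMap.smul_apply, smul_eq_mul,
      hv.pairing_eq, e, h.alpha_alpha]
    field_simp
    ring
  · exact ⟨0, by simpa using h.pairing_filt (by omega) hv.mem hv.mem, by simpa using hv.mem⟩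

/-- `α² = 0` and the image of `α` is isotropic, so the correction changes neither `αv` nor `⟨v,
αv'⟩`. -/
theorem IsDualPair.add_alpha (h : IsEpsRep ε N B) (hv : IsDualPair N B s t κ v v')
    (u : N.space (omega l)) (c : ℂ) (hu : v + c • alphaMap N u ∈ filt N s) :
    IsDualPair N B s t κ (v + c • alphaMap N u) v' where
  mem := hu
  alpha_mem := by
    rw [map_add, map_smul, h.bound.alphaMap_sq, smul_zero, add_zero]; exact hv.alpha_mem
  mem' := hv.mem'
  alpha_mem' := hv.alpha_mem'
  pairing_eq := by
    rw [map_add, LinearMap.add_apply, map_smul, LinearMap.smul_apply, h.alpha_alpha, smul_zero,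
      add_zero, hv.pairing_eq]

/-- The last step of the normalisation makes `v` orthogonal to `v'`. -/
theorem IsEpsRep.orthogonal_pair (h : IsEpsRep ε N B) (ht : t ≤ 2 * l + 2) (hκ : κ ≠ 0)
    (hv : IsDualPair N B s t κ v v') (h1 : pairing N B _ _ v (alphaMap N v) = 0)
    (h2 : pairing N B _ _ v' (alphaMap N v') = 0) (h3 : pairing N B _ _ v v = 0)
    (h4 : pairing N B _ _ v' v' = 0) : ∃ u u', IsNormalPair N B s t κ u u' := by
  -- If `s < t`, the filtration already gives `⟨v, v'⟩ = 0`. Otherwise `αv` lies in `filt N s`, and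
  -- since `⟨αv, v'⟩ = -κ` a multiple of it corrects `v`.
  rcases Nat.lt_or_ge s t with hs | hs
  · exact ⟨v, v', hv, h1, h2, h3, h4,
      h.pairing_filt (by simp only [st]; omega) hv.mem hv.mem'⟩
  · have e1 : pairing N B _ _ (alphaMap N v) v = 0 := by rw [h.pairing_alpha, h1, neg_zero]
    have e2 : pairing N B _ _ (alphaMap N v) v' = -κ := by rw [h.pairing_alpha, hv.pairing_eq]
    refine ⟨v + (pairing N B _ _ v v' / κ) • alphaMap N v, v',
      hv.add_alpha h v _ (add_mem hv.mem (Submodule.smul_mem _ _ (filt_mono hs hv.alpha_mem))),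
      ?_, h2, ?_, h4, ?_⟩ <;>
    simp only [map_add, map_smul, LinearMap.add_apply, LinearMap.smul_apply, smul_eq_mul,
      h1, h3, e1, e2, h.alpha_alpha, h.bound.alphaMap_sq]
    · simp
    · simp
    · field_simp
      ring

/-- In the orthogonal case `⟨x, αx⟩ = 0` for all `x`, and `v` and `v'` are made isotropic one after
the other. In the symplectic case every vector is isotropic, and what must be arranged is `⟨x, αx⟩ =
0` for `v` and `v'`; this uses that the type is not self-dual. -/
theorem IsEpsRep.exists_isNormalPair (h : IsEpsRep ε N B) (hs : s ≤ 2 * l + 2)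
    (ht : t ≤ 2 * l + 2) (hκ : κ ≠ 0) (hst : ε = 1 ∨ s + t ≠ 2 * l + 2)
    (hv : IsDualPair N B s t κ v v') : ∃ u u', IsNormalPair N B s t κ u u' := by
  rcases h.sign with rfl | rfl
  · have a : ∀ x : N.space (omega l), pairing N B _ _ x (alphaMap N x) = 0 := fun x => by
      have := h.alpha_swap x x
      linear_combination this / 2
    obtain ⟨c, hc, hc'⟩ := h.isotropic_left hκ hv
    have hv1 := hv.add_alpha h v' c hc'
    have hv2 := hv1.swap h hs ht
    obtain ⟨d, hd, hd'⟩ := h.isotropic_left (by simpa using hκ) hv2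
    have hv3 := (hv2.add_alpha h _ d hd').swap h (by simp [st]) (by simp [st])
    rw [show st l (st l s) = s by simp only [st]; omega,
      show st l (st l t) = t by simp only [st]; omega] at hv3
    have := h.orthogonal_pair ht (by simpa using hκ) hv3 (a _) (a _) hc hd
    simpa using this
  · replace hst := hst.resolve_left (by norm_num)
    -- Passing to the dual pair reverses the inequality. Under it, `⟨v, αv⟩ = 0` by the filtration,
    -- and `v` lies low enough to be subtracted from `v'`.
    wlog hlt : s + t < 2 * l + 2 generalizing s t κ v v'
    · obtain ⟨u, u', hu⟩ := this (s := st l t) (t := st l s) (by simp [st]) (by simp [st])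
        (κ := - -1 * κ) (by simpa using hκ) (hv.swap h hs ht) (by simp only [st]; omega)
        (by simp only [st]; omega)
      have := hu.swap h (by simp [st]) (by simp [st])
      rw [show st l (st l s) = s by simp only [st]; omega,
        show st l (st l t) = t by simp only [st]; omega] at this
      exact ⟨u', u, by simpa using this⟩
    have a : ∀ x : N.space (omega l), pairing N B _ _ x x = 0 := fun x => by
      have := h.pairing_swap x x
      linear_combination this / 2
    have b : pairing N B _ _ v (alphaMap N v) = 0 :=
      h.pairing_filt (by omega) hv.mem hv.alpha_mem
    have e : pairing N B _ _ v' (alphaMap N v) = κ := by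
      rw [h.alpha_swap, hv.pairing_eq]; ring
    refine h.orthogonal_pair (v := v)
      (v' := v' - (pairing N B _ _ v' (alphaMap N v') / (2 * κ)) • v) ht hκ
      ⟨hv.mem, hv.alpha_mem, ?_, ?_, ?_⟩ b ?_ (a _) (a _)
    · exact sub_mem hv.mem' (Submodule.smul_mem _ _ (filt_mono (by simp only [st]; omega) hv.mem))
    · rw [map_sub, map_smul]
      exact sub_mem hv.alpha_mem'
        (Submodule.smul_mem _ _ (filt_mono (by simp only [st]; omega) hv.alpha_mem))
    · simp [b, hv.pairing_eq]
    · simp only [map_sub, map_smul, LinearMap.sub_apply, LinearMap.smul_apply, smul_eq_mul, e, b,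
        hv.pairing_eq]
      field_simp
      ring

theorem IsDualPair.smul (hv : IsDualPair N B s t κ v v') (c : ℂ) :
    IsDualPair N B s t (c * κ) (c • v) v' where
  mem := Submodule.smul_mem _ _ hv.mem
  alpha_mem := by rw [map_smul]; exact Submodule.smul_mem _ _ hv.alpha_mem
  mem' := hv.mem'
  alpha_mem' := hv.alpha_mem'
  pairing_eq := by simp [hv.pairing_eq]

/-- The union of two systems of rows in the same representation. -/
theorem IsSystem.union {R R' : Type} {D : RowSystem R} {D' : RowSystem R'}
    {x : R → ∀ p, N.space p} {y : R' → ∀ p, N.space p} (hx : IsSystem D N x)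
    (hy : IsSystem D' N y) : IsSystem (D.sum D') N (Sum.elim x y) where
  row r := by
    cases r with
    | inl r => exact hx.row r
    | inr r => exact hy.row r
  loop r p q hp hq := by
    cases r with
    | inl r =>
      refine (hx.loop r p q hp hq).trans ?_
      simp only [RowSystem.sum, Sum.elim_inl]
      cases D.alpha r <;> rfl
    | inr r =>
      refine (hy.loop r p q hp hq).trans ?_
      simp only [RowSystem.sum, Sum.elim_inr]
      cases D'.alpha r <;> rfl

theorem IsEpsRep.exists_double (h : IsEpsRep ε N B) (hs : 1 ≤ s ∧ s ≤ 2 * l + 1)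
    (ht : 1 ≤ t ∧ t ≤ 2 * l + 1) (hst : ε = 1 ∨ s + t ≠ 2 * l + 2) (hN : Has N (.two s t)) :
    ∃ x, IsStandard (doubleForm h.sign hs ht) N B x := by
  obtain ⟨v, v', κ, hκ, hv⟩ := h.exists_isDualPair hs ht hN
  -- The scalar makes `⟨v, αv'⟩` equal to `(-1) ^ (l + 1)`, the value of the standard form at `ω`.
  have hv1 := hv.smul (κ⁻¹ * (-1) ^ (l + 1))
  rw [mul_right_comm, inv_mul_cancel₀ hκ, one_mul] at hv1
  obtain ⟨u, u', hu⟩ := h.exists_isNormalPair (by omega) (by omega)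
    (pow_ne_zero _ (by norm_num)) hst hv1
  obtain ⟨x, hx, hx0, hx1⟩ := isSystem_arrow h.bound hu.mem hu.alpha_mem
  obtain ⟨y, hy, hy0, hy1⟩ := isSystem_arrow h.bound hu.mem' hu.alpha_mem'
  have e1 := h.alpha_swap u u'
  rw [hu.pairing_eq] at e1
  refine ⟨_, h.isStandard_of_omega (hx.union hy) doubleSystem_mem ?_⟩
  have e2 := h.pairing_alpha u u
  have e3 := h.pairing_alpha u' u'
  have e4 := h.pairing_alpha u u'
  have e5 := h.pairing_alpha u' u
  have e6 := h.pairing_swap u' u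
  rw [hu.left_alpha, neg_zero] at e2
  rw [hu.right_alpha, neg_zero] at e3
  rw [hu.pairing_eq] at e4
  rw [e1] at e5
  rw [hu.left_right, mul_zero] at e6
  rintro (r | r) (r' | r') <;> fin_cases r <;> fin_cases r' <;>
    simp [doubleForm, hx0, hx1, hy0, hy1, h.alpha_alpha, e1, e2, e3, e4, e5, e6, hu.left_alpha,
      hu.right_alpha, hu.left, hu.right, hu.left_right, hu.pairing_eq, mul_comm]

/-- In the self-dual case `v` and `v'` satisfy the same conditions. The form `⟨x, αy⟩` is symmetric
and nonzero on them, so by polarisation some `u` has `⟨u, αu⟩ ≠ 0`, and a square root normalises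
this value. -/
theorem IsEpsRep.exists_self (h : IsEpsRep (-1) N B) (hs : 1 ≤ s) (ht : 1 ≤ t)
    (hst : s + t = 2 * l + 2) (hN : Has N (.two s t)) :
    ∃ x, IsStandard (selfForm hs ht hst) N B x := by
  obtain ⟨v, v', κ, hκ, hv⟩ := h.exists_isDualPair ⟨hs, by omega⟩ ⟨ht, by omega⟩ hN
  have hv1 := hv.mem'
  have hv2 := hv.alpha_mem'
  rw [show st l t = s by simp only [st]; omega] at hv1
  rw [show st l s = t by simp only [st]; omega] at hv2
  have ex : ∃ u ∈ filt N s, alphaMap N u ∈ filt N t ∧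
      pairing N B _ _ u (alphaMap N u) ≠ 0 := by
    by_contra! hc
    have a := hc v hv.mem hv.alpha_mem
    have b := hc v' hv1 hv2
    have c := hc (v + v') (add_mem hv.mem hv1) (by rw [map_add]; exact add_mem hv.alpha_mem hv2)
    have d := h.alpha_swap v v'
    simp only [map_add, LinearMap.add_apply, a, b, d, hv.pairing_eq] at c
    exact hκ (by linear_combination c / 2)
  obtain ⟨u, hu, hu', hu0⟩ := ex
  obtain ⟨z, hz⟩ := IsAlgClosed.exists_pow_nat_eq
    ((-1) ^ (l + 1) / pairing N B _ _ u (alphaMap N u)) (n := 2) (by norm_num)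
  obtain ⟨x, hx, hx0, hx1⟩ := isSystem_arrow h.bound (v := z • u) (Submodule.smul_mem _ z hu)
    (t := t) (by rw [map_smul]; exact Submodule.smul_mem _ z hu')
  have e1 : pairing N B _ _ (z • u) (alphaMap N (z • u)) = (-1) ^ (l + 1) := by
    simp only [map_smul, LinearMap.smul_apply, smul_eq_mul]
    rw [← mul_assoc, ← sq, hz, div_mul_cancel₀ _ hu0]
  have e2 := h.pairing_alpha (z • u) (z • u)
  have e3 := h.pairing_swap (z • u) (z • u)
  replace e3 : pairing N B _ _ (z • u) (z • u) = 0 := by linear_combination e3 / 2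
  rw [e1] at e2
  generalize z • u = u₁ at *
  refine ⟨x, h.isStandard_of_omega hx arrowSystem_mem ?_⟩
  intro r r'
  fin_cases r <;> fin_cases r' <;> simp [selfForm, hx0, hx1, h.alpha_alpha, e1, e2, e3]

end Realise

end AL

namespace AL

open QuiverRep

section Realise

variable {l i j m s t : ℕ} {ε : ℂ} {N : QuiverRep.{w} ℂ (Vertex l)} {B : N.Form}

/-! #### A row and its dual -/

theorem isSystem_oneRow {lo hi : ℕ} {x : ∀ p, N.space p} (hx : IsRow N lo hi x)
    (h0 : alphaMap N (x (omega l)) = 0) : IsSystem (oneRowSystem lo hi) N fun _ => x :=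
  ⟨fun _ => hx, fun _ => IsRow.loop_eq_zero h0⟩

/-- A vector at `j*` orthogonal to all rows from `i - 1`, but not to `v`, starts a row that ends by
`i*`. It is scaled at one vertex, and `pairing_rows` gives the values at the others. -/
theorem IsEpsRep.exists_chain_pair (h : IsEpsRep ε N B) (h1 : 1 ≤ i) (h2 : i ≤ j) (h3 : j ≤ l)
    (hN : Has N (.chain i j)) :
    ∃ x, IsStandard (pairForm h.sign h1 h2 (by omega : j ≤ l + 1)) N B x := by
  obtain ⟨p, hp, v, hv, hv'⟩ := hN
  have hpp : p.num + (starVertex p).num = 2 * l + 2 := opp_star p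
  obtain ⟨y₁, hy₁, hy0⟩ := h.exists_orthogonal (opp_star p) hv'
  have hmem := h.mem_rowSpace_of_orthogonal (opp_star p) (n := i - 1) (by omega) y₁ hy₁
  rw [show (starVertex p).num = st l j by simp only [st]; omega,
    show 2 * l + 1 - (i - 1) = st l i by simp only [st]; omega] at hmem
  obtain ⟨x, hx, rfl⟩ := hv
  obtain ⟨y', hy', rfl⟩ := hmem
  have hy := hy'.smul ((-1) ^ j / pairing N B _ _ (x p) (y' (starVertex p)))
  have e : pairing N B _ _ (x p)
      (((-1) ^ j / pairing N B _ _ (x p) (y' (starVertex p))) • y' (starVertex p)) =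
      (-1) ^ j := by
    rw [map_smul, smul_eq_mul, div_mul_cancel₀ _ hy0]
  change pairing N B _ _ (x p) ((((-1) ^ j / pairing N B _ _ (x p) (y' (starVertex p))) • y')
    (starVertex p)) = (-1) ^ j at e
  generalize ((-1) ^ j / pairing N B _ _ (x p) (y' (starVertex p))) • y' = y at hy e
  have sx := isSystem_oneRow hx (by rw [hx.supp _ (by simp; omega), map_zero])
  have sy := isSystem_oneRow hy (by rw [hy.supp _ (by simp only [omega_num, st]; omega), map_zero])
  have key : ∀ q q', Opp q q' → pairing N B q q' (x q) (y q') =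
      if i ≤ q.num ∧ q.num ≤ j then (-1) ^ q.num else 0 := by
    intro q q' hq
    split_ifs with hm
    · have := h.pairing_rows hx hy hq (opp_star p) (by omega) hm.1
        (by simp only [st]; omega)
      rw [e, ← hp, ← pow_add, ← two_mul, pow_mul] at this
      have e1 : ((-1 : ℂ) ^ q.num) * (-1) ^ q.num = 1 := by
        rw [← pow_add, ← two_mul, pow_mul]; simp
      simp only [even_two, Even.neg_pow, one_pow] at this
      linear_combination (-1) ^ q.num * this - pairing N B q q' (x q) (y q') * e1
    · rw [hx.supp _ hm, map_zero, LinearMap.zero_apply]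
  have key2 : ∀ q q', Opp q q' → pairing N B q q' (y q) (x q') =
      if st l j ≤ q.num ∧ q.num ≤ st l i then (-1) ^ q.num * ε else 0 := by
    intro q q' hq
    rw [h.pairing_swap, key q' q hq.symm, hq.neg_one_pow, mul_ite, mul_zero, mul_comm ε]
    refine if_congr ?_ rfl rfl
    simp only [Opp, st] at *
    omega
  refine ⟨_, sx.union sy, ?_⟩
  rintro (r | r) (r' | r') q q' hq
  · have : ¬ (i ≤ q.num ∧ q.num ≤ j) ∨ ¬ (i ≤ q'.num ∧ q'.num ≤ j) := by
      simp only [Opp] at hq; omega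
    rcases this with h | h <;> simp [pairForm, FormData.gram, hx.supp _ h]
  · simpa [pairForm, FormData.gram, RowSystem.Mem, RowSystem.sum, pairSystem,
      oneRowSystem] using key q q' hq
  · simpa [pairForm, FormData.gram, RowSystem.Mem, RowSystem.sum, pairSystem,
      oneRowSystem] using key2 q q' hq
  · have : ¬ (st l j ≤ q.num ∧ q.num ≤ st l i) ∨ ¬ (st l j ≤ q'.num ∧ q'.num ≤ st l i) := by
      simp only [Opp, st] at *; omega
    rcases this with h | h <;> simp [pairForm, FormData.gram, hy.supp _ h]

/-- Orthogonality of `y` to `filt N (m - 1)` bounds its row, and orthogonality to the image of `α`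
means `αy = 0`. -/
theorem IsEpsRep.exists_one_dual (h : IsEpsRep ε N B) (hm : 1 ≤ m ∧ m ≤ 2 * l + 1)
    (hN : Has N (.one m)) : ∃ v ∈ filt N m, ∃ y ∈ filt N (st l m), alphaMap N v = 0 ∧
      alphaMap N y = 0 ∧ pairing N B _ _ v y ≠ 0 := by
  obtain ⟨v, hv, hv0, hv'⟩ := hN
  obtain ⟨y, hy, hy0⟩ := h.exists_orthogonal (opp_omega l) hv'
  refine ⟨v, hv, y, ?_, hv0, ?_, hy0⟩
  · have := h.mem_filt_of_orthogonal (n := m - 1) (by omega) y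
      fun u hu => hy u (Submodule.mem_sup_left hu)
    rwa [show 2 * l + 1 - (m - 1) = st l m by simp only [st]; omega] at this
  · refine h.eq_zero_of_pairing (opp_omega l) _ fun u => ?_
    have := hy _ (Submodule.mem_sup_right ⟨u, rfl⟩)
    rwa [h.pairing_alpha, neg_eq_zero] at this

theorem IsEpsRep.has_one (h : IsEpsRep ε N B) (hm : 1 ≤ m ∧ m ≤ 2 * l + 1)
    {v y : N.space (omega l)} (hv : v ∈ filt N m) (hy : y ∈ filt N (st l m))
    (hv0 : alphaMap N v = 0) (hy0 : alphaMap N y = 0) (hvy : pairing N B _ _ v y ≠ 0) :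
    Has N (.one m) := by
  refine ⟨v, hv, hv0, fun hmem => hvy ?_⟩
  obtain ⟨g, hg, _, ⟨u, rfl⟩, rfl⟩ := Submodule.mem_sup.1 hmem
  rw [map_add, LinearMap.add_apply, h.pairing_alpha, hy0, map_zero, neg_zero, add_zero]
  exact h.pairing_filt (by simp only [st]; omega) hg hy

/-- The vector `v` is isotropic, by skew-symmetry or because `m ≤ l`. In the orthogonal case a
multiple of `v` is then subtracted from its partner to make that isotropic too. -/
theorem IsEpsRep.exists_one_pair (h : IsEpsRep ε N B) (hm : 1 ≤ m) (hm' : m ≤ l + 1)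
    (hε : ε = -1 ∨ m ≠ l + 1) (hN : Has N (.one m)) :
    ∃ x, IsStandard (pairForm h.sign hm hm' le_rfl) N B x := by
  obtain ⟨v, hv, y₁, hy₁, hv0, hy₁0, hvy₁⟩ := h.exists_one_dual ⟨hm, by omega⟩ hN
  have hvv : pairing N B _ _ v v = 0 := by
    rcases hε with rfl | hε
    · linear_combination h.pairing_swap v v / 2
    · exact h.pairing_filt (by omega) hv hv
  have hy₂ : ∃ y ∈ filt N (st l m), alphaMap N y = 0 ∧ pairing N B _ _ v y ≠ 0 ∧
      pairing N B _ _ y y = 0 := by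
    by_cases hε1 : ε = -1
    · subst hε1
      exact ⟨y₁, hy₁, hy₁0, hvy₁, by linear_combination h.pairing_swap y₁ y₁ / 2⟩
    · obtain rfl := h.sign.resolve_right hε1
      refine ⟨y₁ - (pairing N B _ _ y₁ y₁ / (2 * pairing N B _ _ v y₁)) • v,
        sub_mem hy₁ (Submodule.smul_mem _ _ (filt_mono (by simp only [st]; omega) hv)), ?_, ?_, ?_⟩
      · simp [hv0, hy₁0]
      · simpa [hvv] using hvy₁
      · simp only [map_sub, map_smul, LinearMap.sub_apply, LinearMap.smul_apply, smul_eq_mul, hvv,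
          h.pairing_swap y₁ v]
        field_simp
        ring
  obtain ⟨y₂, hy₂, hy₂0, hvy₂, hyy₂⟩ := hy₂
  obtain ⟨y, hy, hy0, hvy, hyy⟩ : ∃ y ∈ filt N (st l m), alphaMap N y = 0 ∧
      pairing N B _ _ v y = (-1) ^ (l + 1) ∧ pairing N B _ _ y y = 0 :=
    ⟨((-1) ^ (l + 1) / pairing N B _ _ v y₂) • y₂, Submodule.smul_mem _ _ hy₂, by simp [hy₂0],
      by rw [map_smul, smul_eq_mul, div_mul_cancel₀ _ hvy₂], by simp [hyy₂]⟩
  have hyv := h.pairing_swap y v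
  rw [hvy] at hyv
  obtain ⟨x, hx, rfl⟩ := hv
  obtain ⟨z, hz, rfl⟩ := hy
  rw [min_eq_left hm', max_eq_right hm'] at hx
  rw [min_eq_right (by simp only [st]; omega), max_eq_left (by simp only [st]; omega),
    show l + 1 = st l (l + 1) by simp only [st]; omega] at hz
  refine ⟨_, h.isStandard_of_omega ((isSystem_oneRow hx hv0).union (isSystem_oneRow hz hy0)) ?_ ?_⟩
  · rintro (r | r) <;> simp [RowSystem.Mem, RowSystem.sum, pairSystem, oneRowSystem, st] <;> omega
  · rintro (r | r) (r' | r') <;> simp [pairForm, hvv, hyy, hvy, hyv, mul_comm]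

/-- The symmetric form is nonzero on the vectors of `filt N (l + 1)` killed by `α`; polarisation and
a square root give a vector of the required length. -/
theorem IsEpsRep.exists_simple (h : IsEpsRep 1 N B) (hN : Has N (.one (l + 1))) :
    ∃ x, IsStandard (simpleForm l) N B x := by
  obtain ⟨v, hv, y, hy, hv0, hy0, hvy⟩ := h.exists_one_dual ⟨by omega, by omega⟩ hN
  rw [show st l (l + 1) = l + 1 by simp only [st]; omega] at hy
  have ex : ∃ u ∈ filt N (l + 1), alphaMap N u = 0 ∧ pairing N B _ _ u u ≠ 0 := by
    by_contra! hc
    have a := hc v hv hv0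
    have b := hc y hy hy0
    have c := hc (v + y) (add_mem hv hy) (by rw [map_add, hv0, hy0, add_zero])
    have d := h.pairing_swap y v
    simp only [map_add, LinearMap.add_apply, a, b, d] at c
    exact hvy (by linear_combination c / 2)
  obtain ⟨u, hu, hu0, huu⟩ := ex
  obtain ⟨z, hz⟩ := IsAlgClosed.exists_pow_nat_eq
    ((-1) ^ (l + 1) / pairing N B _ _ u u) (n := 2) (by norm_num)
  obtain ⟨x, hx, e⟩ := Submodule.smul_mem _ z hu
  rw [min_self, max_self] at hx
  refine ⟨_, h.isStandard_of_omega (isSystem_oneRow hx (by rw [e, map_smul, hu0, smul_zero]))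
    (fun _ => ⟨le_rfl, le_rfl⟩) fun _ _ => ?_⟩
  simp only [e, map_smul, LinearMap.smul_apply, smul_eq_mul]
  rw [← mul_assoc, ← sq, hz, div_mul_cancel₀ _ huu]
  simp [simpleForm]

/-! #### Standard systems detect the string modules -/

/-- The representations with a form which contain a standard system of the given kind are those
which have the string module of type `k` as a summand. -/
def Detects {R : Type} [DecidableEq R] {D : RowSystem R} (Φ : FormData ε l D) (k : Kind) : Prop :=
  ∀ (N : QuiverRep.{w} ℂ (Vertex l)) (B : N.Form), IsEpsRep ε N B →
    (Has N k ↔ ∃ x, IsStandard Φ N B x)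

/-- For the converse: if the vector at `j` also came from `i - 1`, its pairing with the dual row
could be slid back to the vertex `i - 1`, whose opposite lies beyond the end of that row, and would
be zero. -/
theorem detects_chain (hε : ε = 1 ∨ ε = -1) (h1 : 1 ≤ i) (h2 : i ≤ j) (h3 : j ≤ l) :
    Detects.{w} (pairForm hε h1 h2 (by omega : j ≤ l + 1)) (.chain i j) := by
  refine fun N B h => ⟨h.exists_chain_pair h1 h2 h3, ?_⟩
  rintro ⟨x, hx⟩
  let p : Vertex l := ⟨j, by omega, by omega⟩
  refine ⟨p, rfl, x (.inl ()) p, ⟨_, hx.sys.row (.inl ()), rfl⟩, ?_⟩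
  rintro ⟨z, hz, e⟩
  have h0 : pairing N B p (starVertex p) (x (.inl ()) p) (x (.inr ()) (starVertex p)) ≠ 0 := by
    rw [hx.gram _ _ _ _ (opp_star p)]
    simp [pairForm, FormData.gram, RowSystem.Mem, RowSystem.sum, pairSystem, oneRowSystem, p, h2]
  refine h0 ?_
  rw [← e]
  rcases Nat.lt_or_ge (i - 1) 1 with hi | hi
  · rw [show i - 1 = 0 by omega] at hz
    rw [hz.eq_zero, map_zero, LinearMap.zero_apply]
  · let q : Vertex l := ⟨i - 1, hi, by omega⟩
    have := h.pairing_rows hz (hx.sys.row (.inr ())) (opp_star q) (opp_star p)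
      (by simp only [q, p]; omega) le_rfl
      (by simp [RowSystem.sum, pairSystem, oneRowSystem, p, starVertex])
    rw [(hx.sys.row (.inr ())).supp (starVertex q)
      (by simp only [RowSystem.sum, pairSystem, oneRowSystem, q, starVertex, Sum.elim_inr, st]
          omega), map_zero, mul_zero] at this
    exact (mul_eq_zero.1 this.symm).resolve_left (pow_ne_zero _ (by norm_num))

theorem detects_one (hε : ε = 1 ∨ ε = -1) (h1 : 1 ≤ m) (h2 : m ≤ l + 1)
    (hm : ε = -1 ∨ m ≠ l + 1) : Detects.{w} (pairForm hε h1 h2 le_rfl) (.one m) := by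
  refine fun N B h => ⟨h.exists_one_pair h1 h2 hm, ?_⟩
  rintro ⟨x, hx⟩
  refine h.has_one ⟨h1, by omega⟩ (v := x (.inl ()) (omega l)) (y := x (.inr ()) (omega l)) ?_ ?_
    (hx.sys.loop (.inl ()) _ _ rfl rfl) (hx.sys.loop (.inr ()) _ _ rfl rfl) ?_
  · rw [filt, min_eq_left h2, max_eq_right h2]
    exact ⟨_, hx.sys.row (.inl ()), rfl⟩
  · rw [filt, min_eq_right (by simp only [st]; omega), max_eq_left (by simp only [st]; omega),
      show l + 1 = st l (l + 1) by simp only [st]; omega]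
    exact ⟨_, hx.sys.row (.inr ()), rfl⟩
  · rw [hx.gram _ _ _ _ (opp_omega l)]
    simp [pairForm, FormData.gram, RowSystem.Mem, RowSystem.sum, pairSystem, oneRowSystem, h2]

theorem detects_simple : Detects.{w} (simpleForm l) (.one (l + 1)) := by
  refine fun N B h => ⟨h.exists_simple, ?_⟩
  rintro ⟨x, hx⟩
  have hmem : x () (omega l) ∈ filt N (l + 1) := by
    rw [filt, min_self, max_self]
    exact ⟨_, hx.sys.row (), rfl⟩
  refine h.has_one ⟨by omega, by omega⟩ (v := x () (omega l)) (y := x () (omega l)) hmem ?_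
    (hx.sys.loop () _ _ rfl rfl) (hx.sys.loop () _ _ rfl rfl) ?_
  · rwa [show st l (l + 1) = l + 1 by simp only [st]; omega]
  · rw [hx.gram _ _ _ _ (opp_omega l)]
    simp [simpleForm, FormData.gram, RowSystem.Mem, oneRowSystem]

theorem detects_double (hε : ε = 1 ∨ ε = -1) (hs : 1 ≤ s ∧ s ≤ 2 * l + 1)
    (ht : 1 ≤ t ∧ t ≤ 2 * l + 1) (hst : ε = 1 ∨ s + t ≠ 2 * l + 2) :
    Detects.{w} (doubleForm hε hs ht) (.two s t) := by
  refine fun N B h => ⟨h.exists_double hs ht hst, ?_⟩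
  rintro ⟨x, hx⟩
  have e1 : alphaMap N (x (.inl 0) (omega l)) = x (.inl 1) (omega l) :=
    hx.sys.loop (.inl 0) _ _ rfl rfl
  have e2 : alphaMap N (x (.inr 0) (omega l)) = x (.inr 1) (omega l) :=
    hx.sys.loop (.inr 0) _ _ rfl rfl
  refine h.has_two (v := x (.inl 0) (omega l)) (v' := x (.inr 0) (omega l)) hs.1 ht.1
    (κ := (-1) ^ (l + 1)) (pow_ne_zero _ (by norm_num))
    ⟨⟨_, hx.sys.row (.inl 0), rfl⟩, ?_, ⟨_, hx.sys.row (.inr 0), rfl⟩, ?_, ?_⟩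
  · rw [e1]
    exact ⟨_, hx.sys.row (.inl 1), rfl⟩
  · rw [e2]
    exact ⟨_, hx.sys.row (.inr 1), rfl⟩
  · rw [e2, hx.gram _ _ _ _ (opp_omega l), FormData.gram, if_pos ⟨rfl, doubleSystem_mem _⟩]
    simp [doubleForm]

theorem detects_self (hs : 1 ≤ s) (ht : 1 ≤ t) (hst : s + t = 2 * l + 2) :
    Detects.{w} (selfForm hs ht hst) (.two s t) := by
  refine fun N B h => ⟨h.exists_self hs ht hst, ?_⟩
  rintro ⟨x, hx⟩
  have e1 : alphaMap N (x 0 (omega l)) = x 1 (omega l) := hx.sys.loop 0 _ _ rfl rfl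
  have m0 : x 0 (omega l) ∈ filt N s := ⟨_, hx.sys.row 0, rfl⟩
  have m1 : x 1 (omega l) ∈ filt N t := ⟨_, hx.sys.row 1, rfl⟩
  refine h.has_two (v := x 0 (omega l)) (v' := x 0 (omega l)) hs ht
    (κ := (-1) ^ (l + 1)) (pow_ne_zero _ (by norm_num)) ⟨m0, by rwa [e1], ?_, ?_, ?_⟩
  · rwa [show st l t = s by simp only [st]; omega]
  · rwa [show st l s = t by simp only [st]; omega, e1]
  · rw [e1, hx.gram _ _ _ _ (opp_omega l), FormData.gram, if_pos ⟨rfl, arrowSystem_mem _⟩]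
    simp [selfForm]

end Realise

end AL

namespace AL

open QuiverRep

/-! ### Subrepresentations -/

section Subrep

variable {l : ℕ} {ε : ℂ} {N : QuiverRep.{w} ℂ (Vertex l)} {B : N.Form}
  {U W : ∀ p, Submodule ℂ (N.space p)}

/-- A subrepresentation, as a representation. -/
noncomputable def subrep (N : QuiverRep.{w} ℂ (Vertex l)) (U : ∀ p, Submodule ℂ (N.space p))
    (hU : N.IsSubrep U) : QuiverRep.{w} ℂ (Vertex l) where
  space p := U p
  map a := (N.map a).restrict (hU _ _ a)

/-- The inclusion of a subrepresentation. -/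
noncomputable def subrepIncl (hU : N.IsSubrep U) (p : Vertex l) :
    (subrep N U hU).space p →ₗ[ℂ] N.space p := (U p).subtype

theorem subrepIncl_isHom (hU : N.IsSubrep U) : IsHom (subrep N U hU) N (subrepIncl hU) :=
  fun _ _ _ _ => rfl

/-- The projection to a direct summand. -/
noncomputable def subrepProj (hU : N.IsSubrep U) (h : ∀ p, IsCompl (U p) (W p)) (p : Vertex l) :
    N.space p →ₗ[ℂ] (subrep N U hU).space p := (U p).projectionOnto (W p) (h p)

theorem subrepProj_isHom (hU : N.IsSubrep U) (hW : N.IsSubrep W) (h : ∀ p, IsCompl (U p) (W p)) :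
    IsHom N (subrep N U hU) (subrepProj hU h) := by
  intro p q a v
  obtain ⟨u, hu, y, hy, rfl⟩ := Submodule.mem_sup.1
    (show v ∈ U p ⊔ W p by rw [(h p).sup_eq_top]; trivial)
  have e1 : subrepProj hU h p (u + y) = (⟨u, hu⟩ : U p) := by
    refine (map_add _ _ _).trans ?_
    have := Submodule.projectionOnto_apply_left (h p) ⟨u, hu⟩
    have h2 := (Submodule.projectionOnto_apply_eq_zero_iff (h p)).2 hy
    exact (congrArg₂ (· + ·) this h2).trans (add_zero _)
  rw [e1, map_add]
  refine (map_add ((U q).projectionOnto (W q) (h q)) _ _).trans ?_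
  have := Submodule.projectionOnto_apply_left (h q) ⟨_, hU p q a u hu⟩
  have h2 := (Submodule.projectionOnto_apply_eq_zero_iff (h q)).2 (hW p q a y hy)
  exact (congrArg₂ (· + ·) this h2).trans (add_zero _)

/-- The restriction of a form to a subrepresentation. -/
noncomputable def subForm (B : N.Form) (hU : N.IsSubrep U) : (subrep N U hU).Form :=
  B.compl₁₂ (DirectSum.lmap (subrepIncl hU)) (DirectSum.lmap (subrepIncl hU))

theorem pairing_subForm (hU : N.IsSubrep U) {p q : Vertex l} (x : (subrep N U hU).space p)
    (y : (subrep N U hU).space q) : pairing (subrep N U hU) (subForm B hU) p q x y =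
      pairing N B p q (subrepIncl hU p x) (subrepIncl hU q y) := by
  simp only [pairing, subForm, LinearMap.compl₁₂_apply, DirectSum.lmap_lof]

theorem separatingLeft_of_pairing (hv : ∀ p q, ¬ Opp p q → pairing N B p q = 0)
    (h : ∀ (p p' : Vertex l), Opp p p' → ∀ x : N.space p,
      (∀ y, pairing N B p p' x y = 0) → x = 0) : B.SeparatingLeft := by
  intro X hX
  refine DirectSum.ext_component ℂ fun p => ?_
  rw [map_zero]
  refine h p (starVertex p) (opp_star p) _ fun y => ?_
  rw [← hX (DirectSum.lof ℂ _ N.space (starVertex p) y)]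
  refine LinearMap.congr_fun
    (f := (pairing N B p (starVertex p)).flip y ∘ₗ DirectSum.component ℂ _ N.space p)
    (g := B.flip (DirectSum.lof ℂ _ N.space (starVertex p) y))
    (DirectSum.linearMap_ext ℂ fun q => LinearMap.ext fun x => ?_) X
  by_cases hq : q = p
  · subst hq
    simp only [LinearMap.comp_apply, DirectSum.component.lof_self]
    rfl
  · simp only [LinearMap.comp_apply]
    rw [DirectSum.component.of, dif_neg hq, map_zero]
    exact (LinearMap.congr_fun₂ (hv q (starVertex p) fun h' => hq (by
      rw [h'.symm.eq_star, starVertex_starVertex])) x y).symm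

/-- An orthogonal direct summand is a representation with a form. -/
theorem IsEpsRep.subrep (h : IsEpsRep ε N B) (hU : N.IsSubrep U)
    (hc : ∀ p, IsCompl (U p) (W p))
    (ho : ∀ (p q : Vertex l), ∀ x ∈ U p, ∀ y ∈ W q, pairing N B p q x y = 0) :
    IsEpsRep ε (subrep N U hU) (subForm B hU) := by
  have heps : ∀ x y, subForm B hU x y = ε * subForm B hU y x := fun x y => h.eps _ _
  have hv : ∀ p q, ¬ Opp p q → pairing (AL.subrep N U hU) (subForm B hU) p q = 0 := by
    intro p q hpq
    refine LinearMap.ext fun x => LinearMap.ext fun y => ?_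
    exact (pairing_subForm hU x y).trans (h.pairing_of_not_opp hpq _ _)
  have left : (subForm B hU).SeparatingLeft := by
    refine separatingLeft_of_pairing hv fun p p' hp x hx => ?_
    refine Subtype.ext (h.eq_zero_of_pairing_left hp _ fun y => ?_)
    -- Any test vector splits along `U` and `W`, and its part in `W` contributes nothing.
    obtain ⟨u, hu, z, hz, rfl⟩ := Submodule.mem_sup.1
      (show y ∈ U p' ⊔ W p' by rw [(hc p').sup_eq_top]; trivial)
    rw [map_add, ho p p' _ x.2 z hz, add_zero]
    exact (pairing_subForm hU x ⟨u, hu⟩).symm.trans (hx ⟨u, hu⟩)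
  refine ⟨⟨fun ω hω x => Subtype.ext (h.bound.1 ω hω (x : U ω).1),
    fun p ω q hω h1 h2 x => Subtype.ext (h.bound.2 p ω q hω h1 h2 (x : U p).1)⟩,
    ⟨⟨left, fun Y hY => left Y fun X => by rw [heps, hY, mul_zero]⟩, ?_, ?_⟩, heps, h.sign⟩
  · intro p q hq x y
    exact LinearMap.congr_fun₂ (hv p q fun h' => hq h'.eq_star) x y
  · intro p q a v u
    refine Eq.trans (congrArg₂ (· + ·) (pairing_subForm hU _ _) (pairing_subForm hU _ _)) ?_
    exact h.symm.compat p q a (v : U p).1 (u : U _).1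

end Subrep

/-! ### Representations presented by a standard form -/

section Presents

variable {l : ℕ} {ε : ℂ}

/-- The representation `X` has a basis arranged in rows, and the standard form on it detects the
string modules of type `k`. -/
def Presents (ε : ℂ) (k : Kind) (X : QuiverRep.{0} ℂ (Vertex l)) : Prop :=
  ∃ (R : Type) (_ : Fintype R) (_ : DecidableEq R) (_ : Nonempty R) (D : RowSystem R)
    -- Universe `w` serves the representations to be classified, universe `0` the model `X` itself.
    (Φ : FormData ε l D), Detects.{w} Φ k ∧ Detects.{0} Φ k ∧ Nonempty (Frame D X)

variable {k : Kind} {X : QuiverRep.{0} ℂ (Vertex l)} {N N' : QuiverRep.{w} ℂ (Vertex l)}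
  {B : N.Form} {B' : N'.Form}

theorem Presents.exists_form (hX : Presents.{w} ε k X) (hε : ε = 1 ∨ ε = -1) :
    ∃ B, IsEpsRep ε X B := by
  obtain ⟨R, _, _, _, D, Φ, -, -, ⟨F⟩⟩ := hX
  obtain ⟨B, hB, -⟩ := AL.exists_form Φ hε F
  exact ⟨B, hB⟩

/-- `X` with its own standard form contains a standard system, namely its frame, so it has the type
that is detected. -/
theorem has_of_frame {R : Type} [Fintype R] [DecidableEq R] {D : RowSystem R}
    {Φ : FormData ε l D} (h0 : Detects.{0} Φ k) (hε : ε = 1 ∨ ε = -1) (F : Frame D X) :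
    Has X k := by
  obtain ⟨B, hB, hx⟩ := AL.exists_form Φ hε F
  exact (h0 X B hB).2 ⟨_, hx⟩

/-- The map to a representation with a frame given by a standard system. -/
noncomputable def stdMap {R : Type} [Fintype R] [DecidableEq R] {D : RowSystem R}
    (Φ : FormData ε l D) (B : N.Form) (x : R → ∀ p, N.space p) (F : Frame D X) (p : Vertex l) :
    N.space p →ₗ[ℂ] X.space p :=
  ∑ r, (stdCoord Φ N B x r p).smulRight (F.x r p)

/-- This is used for counting dimensions: a representation containing a standard system over `D` is
at each vertex at least as large as `X`. -/
theorem stdMap_surjective {R : Type} [Fintype R] [DecidableEq R] {D : RowSystem R}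
    {Φ : FormData ε l D} {x : R → ∀ p, N.space p} (hx : IsStandard Φ N B x) (F : Frame D X)
    (p : Vertex l) : Function.Surjective (stdMap Φ B x F p) := by
  intro v
  refine ⟨∑ r, F.coord r p v • x r p, ?_⟩
  conv_rhs => rw [← F.span p v]
  simp only [stdMap, LinearMap.sum_apply, LinearMap.smulRight_apply]
  refine Finset.sum_congr rfl fun r _ => ?_
  by_cases hr : D.Mem r p
  · rw [map_sum, Finset.sum_eq_single r]
    · rw [map_smul, hx.stdCoord_x, if_pos ⟨rfl, hr⟩, smul_eq_mul, mul_one]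
    · intro r' _ h
      rw [map_smul, hx.stdCoord_x, if_neg (fun h' => h h'.1.symm), smul_zero]
    · simp
  · rw [F.sys.supp hr, smul_zero, smul_zero]

theorem spans_of_isomorphic {R : Type} [Fintype R] [DecidableEq R] {D : RowSystem R}
    {Φ : FormData ε l D} {x : R → ∀ p, N.space p} (hx : IsStandard Φ N B x) (F : Frame D X)
    (hN : N.Isomorphic X) (p : Vertex l) (v : N.space p)
    (hv : ∀ r, stdCoord Φ N B x r p v = 0) : v = 0 := by
  obtain ⟨e, -⟩ := hN
  have inj := (LinearMap.injective_iff_surjective_of_finrank_eq_finrank (e p).finrank_eq).2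
    (stdMap_surjective hx F p)
  refine (injective_iff_map_eq_zero _).1 inj v ?_
  simp [stdMap, hv]

/-- `Has` ignores the form, so both representations inherit the type from `X`. Each then contains a
standard system, which spans for reasons of dimension. -/
theorem Presents.isometric (hX : Presents.{w} ε k X) (h : IsEpsRep ε N B)
    (h' : IsEpsRep ε N' B') (hN : N.Isomorphic X) (hN' : N'.Isomorphic X) :
    N.Isometric B N' B' := by
  obtain ⟨R, _, _, _, D, Φ, hw, h0, ⟨F⟩⟩ := hX
  have hk := has_of_frame h0 h.sign F
  obtain ⟨x, hx⟩ := (hw N B h).1 (hk.of_isomorphic (isomorphic_symm hN))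
  obtain ⟨x', hx'⟩ := (hw N' B' h').1 (hk.of_isomorphic (isomorphic_symm hN'))
  exact isometric_of_isStandard h h' (hx.frame (spans_of_isomorphic hx F hN))
    (hx'.frame (spans_of_isomorphic hx' F hN')) hx hx'

theorem eq_bot_of_has {R : Type} [Fintype R] [DecidableEq R] {D : RowSystem R}
    {Φ : FormData ε l D} (F : Frame D X) (hN : N.Isomorphic X) (hw : Detects.{w} Φ k)
    (h : IsEpsRep ε N B) {U W : ∀ p, Submodule ℂ (N.space p)} (hU : N.IsSubrep U)
    (hc : ∀ p, IsCompl (U p) (W p))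
    (ho : ∀ (p q : Vertex l), ∀ x ∈ U p, ∀ y ∈ W q, pairing N B p q x y = 0)
    (hk : Has (subrep N U hU) k) (p : Vertex l) : W p = ⊥ := by
  obtain ⟨x, hx⟩ := (hw _ _ (h.subrep hU hc ho)).1 hk
  obtain ⟨e, -⟩ := hN
  have h1 : Module.finrank ℂ (X.space p) ≤ Module.finrank ℂ (U p) :=
    LinearMap.finrank_le_finrank_of_surjective (stdMap_surjective hx F p)
  have h2 : U p = ⊤ := by
    refine Submodule.eq_top_of_finrank_eq (le_antisymm (Submodule.finrank_le _) ?_)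
    rwa [(e p).finrank_eq]
  have := (hc p).inf_eq_bot
  rwa [h2, top_inf_eq] at this

/-- In an orthogonal decomposition one summand inherits the type. As a representation with a form it
contains a standard system, so it has the dimension of `X` and the other summand is zero. -/
theorem Presents.formIndecomposable (hX : Presents.{w} ε k X) (h : IsEpsRep ε N B)
    (hN : N.Isomorphic X) : N.FormIndecomposable B := by
  obtain ⟨R, _, _, _, D, Φ, hw, h0, ⟨F⟩⟩ := hX
  have hk := (has_of_frame h0 h.sign F).of_isomorphic (isomorphic_symm hN)
  obtain ⟨x, hx⟩ := (hw N B h).1 hk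
  constructor
  · obtain ⟨r⟩ := ‹Nonempty R›
    have h1 := Φ.hi_le r
    have h2 := Φ.lo_le_hi r
    let p : Vertex l := ⟨D.lo r, Φ.one_le_lo r, by omega⟩
    exact ⟨p, ⟨x r p, 0, hx.ne_zero ⟨le_rfl, h2⟩⟩⟩
  · intro U W hU hW hc ho
    have hsum : ∀ p v, subrepIncl hU p (subrepProj hU hc p v) +
        subrepIncl hW p (subrepProj hW (fun p => (hc p).symm) p v) = v := by
      intro p v
      exact Submodule.projection_add_projection_eq_self (hc p) v
    rcases hk.of_decomposition (subrepProj_isHom hU hW hc)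
      (subrepProj_isHom hW hU fun p => (hc p).symm) (subrepIncl_isHom hU) (subrepIncl_isHom hW) hsum
      with hk | hk
    · exact .inr (eq_bot_of_has F hN hw h hU hc (fun p q x hx y hy => (ho p q x hx y hy).1) hk)
    · exact .inl (eq_bot_of_has F hN hw h hW (fun p => (hc p).symm)
        (fun p q x hx y hy => (ho q p y hy x hx).2) hk)

theorem Presents.isomorphic (hX : Presents.{w} ε k X) (h : IsEpsRep ε N B)
    (hN : N.FormIndecomposable B) (hk : Has N k) : N.Isomorphic X := by
  obtain ⟨R, _, _, _, D, Φ, hw, h0, ⟨F⟩⟩ := hX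
  obtain ⟨x, hx⟩ := (hw N B h).1 hk
  exact ⟨_, (hx.frame (hx.spans_of_indecomposable h hN)).isIsomorphism F⟩

/-- A list of representations which are presented by standard forms, and which covers all string
modules, classifies the indecomposable representations with a form. -/
theorem classification (hε : ε = 1 ∨ ε = -1) (L : QuiverRep.{0} ℂ (Vertex l) → Prop)
    (hL : ∀ X, L X → ∃ k, Presents.{w} ε k X)
    (hL' : ∀ (N : QuiverRep.{w} ℂ (Vertex l)) (B : N.Form), IsEpsRep ε N B → ∀ k,
      Kind.Valid l k → Has N k → ∃ k' X, L X ∧ Presents.{w} ε k' X ∧ Has N k') :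
    (∀ (N : QuiverRep.{w} ℂ (Vertex l)) (B : N.Form), IsEpsRep ε N B →
        (N.FormIndecomposable B ↔ ∃ X : QuiverRep.{0} ℂ (Vertex l), L X ∧ N.Isomorphic X)) ∧
      (∀ X : QuiverRep.{0} ℂ (Vertex l), L X → ∃ B : X.Form, IsEpsRep ε X B) ∧
      (∀ (N N' : QuiverRep.{w} ℂ (Vertex l)) (B : N.Form) (B' : N'.Form),
        IsEpsRep ε N B → IsEpsRep ε N' B' →
        N.FormIndecomposable B → N'.FormIndecomposable B' →
        N.Isomorphic N' → N.Isometric B N' B') := by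
  have key : ∀ (N : QuiverRep.{w} ℂ (Vertex l)) (B : N.Form), IsEpsRep ε N B →
      N.FormIndecomposable B → ∃ X : QuiverRep.{0} ℂ (Vertex l), L X ∧ N.Isomorphic X := by
    intro N B h hN
    obtain ⟨k, hk, hNk⟩ := h.exists_has hN.1
    obtain ⟨k', X, hX, hp, hNk'⟩ := hL' N B h k hk hNk
    exact ⟨X, hX, hp.isomorphic h hN hNk'⟩
  refine ⟨fun N B h => ⟨key N B h, ?_⟩, ?_, ?_⟩
  · rintro ⟨X, hX, hN⟩
    obtain ⟨k, hk⟩ := hL X hX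
    exact hk.formIndecomposable h hN
  · intro X hX
    obtain ⟨k, hk⟩ := hL X hX
    exact hk.exists_form hε
  · intro N N' B B' h h' _ hN' ⟨e, he⟩
    obtain ⟨X, hX, e', he'⟩ := key N' B' h' hN'
    obtain ⟨k, hk⟩ := hL X hX
    exact hk.isometric h h' ⟨fun p => (e p).trans (e' p), fun p q a x => by
      simp [he p q a, he' p q a]⟩ ⟨e', he'⟩

end Presents

end AL

namespace AL

open QuiverRep

/-! ### The representations of the list -/

section Lists

variable {l i j m s t : ℕ} {ε : ℂ}

open Classical in
theorem rep_map_apply (Γ : CoeffQuiver (Vertex l)) {p q : Vertex l} (a : p ⟶ q)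
    (f : Γ.basis p → ℂ) (c : Γ.basis q) :
    ((Γ.rep ℂ).map a f : Γ.basis q → ℂ) c = ∑ b, if Γ.edge a b c then f b else 0 := by
  change (Matrix.of fun c b => if Γ.edge a b c then 1 else 0).mulVec f c = _
  simp [Matrix.mulVec, dotProduct]

/-- The coefficient quiver `Γ` is the one of a given system of rows. -/
structure IsCoeffSystem {R : Type} (D : RowSystem R) (Γ : CoeffQuiver (Vertex l))
    (row : ∀ p, Γ.basis p → R) : Prop where
  inj : ∀ p, Function.Injective (row p)
  mem : ∀ p r, (∃ b, row p b = r) ↔ D.Mem r p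
  step : ∀ (p q : Vertex l) (e : p.num + 1 = q.num) (b : Γ.basis p) (c : Γ.basis q),
    Γ.edge (Arrow.step e : p ⟶ q) b c ↔ row p b = row q c
  loop : ∀ (p q : Vertex l) (hp : p.num = l + 1) (hq : q.num = l + 1) (b : Γ.basis p)
    (c : Γ.basis q), Γ.edge (Arrow.loop hp hq : p ⟶ q) b c ↔ D.alpha (row p b) = some (row q c)
  one_le_lo : ∀ r, 1 ≤ D.lo r
  alpha_mem : ∀ r, D.alpha r ≠ none → D.Mem r (omega l)

section Frame

variable {R : Type} [DecidableEq R] {D : RowSystem R} {Γ : CoeffQuiver (Vertex l)}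
  {row : ∀ p, Γ.basis p → R}

theorem IsCoeffSystem.sum_row (h : IsCoeffSystem D Γ row) {p : Vertex l} (b₀ : Γ.basis p)
    (f : Γ.basis p → ℂ) : (∑ b, if row p b = row p b₀ then f b else 0) = f b₀ := by
  rw [Finset.sum_eq_single b₀]
  · simp
  · intro b _ hb
    rw [if_neg fun h' => hb (h.inj p h')]
  · simp

theorem IsCoeffSystem.sum_row_of_not_mem (h : IsCoeffSystem D Γ row) {p : Vertex l} {r : R}
    (hr : ¬ D.Mem r p) (f : Γ.basis p → ℂ) : (∑ b, if row p b = r then f b else 0) = 0 :=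
  Finset.sum_eq_zero fun b _ => if_neg fun h' => hr ((h.mem p r).1 ⟨b, h'⟩)

open Classical in
theorem IsCoeffSystem.isSystem (h : IsCoeffSystem D Γ row) : IsSystem D (Γ.rep ℂ)
    fun r p => (fun b : Γ.basis p => if row p b = r then (1 : ℂ) else 0) where
  row r :=
    { supp := fun p hp => funext fun b => if_neg fun h' => hp ((h.mem p r).1 ⟨b, h'⟩)
      step := fun p q e hq => funext fun c => by
        refine (rep_map_apply _ _ _ c).trans ?_
        simp only [h.step]
        by_cases hc : row q c = r
        · have hm : D.Mem r q := (h.mem q r).1 ⟨c, hc⟩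
          obtain ⟨b₀, hb₀⟩ := (h.mem p r).2 ⟨by have := hm.1; omega, by have := hm.2; omega⟩
          rw [hc, ← hb₀]
          exact (h.sum_row b₀ _).trans ((if_pos rfl).trans (if_pos rfl).symm)
        · rw [if_neg hc]
          refine Finset.sum_eq_zero fun b _ => ?_
          split_ifs with h1 h2
          · exact absurd (h1.symm.trans h2) hc
          · rfl
          · rfl
      first := fun q hq hl => funext fun c => if_neg fun h' => hl (by
        have := ((h.mem q r).1 ⟨c, h'⟩).1
        have := h.one_le_lo r
        omega) }
  loop r p q hp hq := by
    obtain rfl := eq_omega hp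
    obtain rfl := eq_omega hq
    refine funext fun c => (rep_map_apply _ _ _ c).trans ?_
    simp only [h.loop]
    cases hr : D.alpha r with
    | none =>
      refine Finset.sum_eq_zero fun b _ => ?_
      split_ifs with h1 h2
      · rw [h2, hr] at h1
        cases h1
      · rfl
      · rfl
    | some r' =>
      obtain ⟨b₀, hb₀⟩ := (h.mem _ r).2 (h.alpha_mem r (by simp [hr]))
      have e := h.sum_row b₀ fun b => if D.alpha (row _ b) = some (row _ c) then (1 : ℂ) else 0
      simp only [hb₀, hr, Option.some.injEq] at e
      refine Eq.trans (Finset.sum_congr rfl fun b _ => ?_) (e.trans (if_congr eq_comm rfl rfl))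
      split_ifs <;> rfl

/-- The frame of a representation given by a coefficient quiver. -/
noncomputable def IsCoeffSystem.frame [Fintype R] (h : IsCoeffSystem D Γ row) : Frame D (Γ.rep ℂ) where
  x r p := (fun b : Γ.basis p => if row p b = r then (1 : ℂ) else 0)
  coord r p := (∑ b, if row p b = r then LinearMap.proj b else 0 : (Γ.basis p → ℂ) →ₗ[ℂ] ℂ)
  sys := h.isSystem
  dual r r' p := by
    have e : (∑ b, if row p b = r then LinearMap.proj b else 0 : (Γ.basis p → ℂ) →ₗ[ℂ] ℂ)
        (fun b => if row p b = r' then (1 : ℂ) else 0) =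
        ∑ b, if row p b = r then (if row p b = r' then (1 : ℂ) else 0) else 0 := by
      rw [LinearMap.sum_apply]
      refine Finset.sum_congr rfl fun b _ => ?_
      split_ifs <;> simp_all
    refine e.trans ?_
    by_cases hm : D.Mem r p
    · obtain ⟨b₀, rfl⟩ := (h.mem p r).2 hm
      rw [h.sum_row]
      simp [hm]
    · rw [h.sum_row_of_not_mem hm, if_neg fun h' => hm h'.2]
  span p v := by
    have e : ∀ (v : Γ.basis p → ℂ) r,
        (∑ b, if row p b = r then LinearMap.proj b else 0 : (Γ.basis p → ℂ) →ₗ[ℂ] ℂ) v =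
        ∑ b, if row p b = r then v b else 0 := by
      intro v r
      rw [LinearMap.sum_apply]
      refine Finset.sum_congr rfl fun b _ => ?_
      split_ifs <;> simp
    refine funext fun b₀ => (Finset.sum_apply _ _ _).trans ?_
    rw [Finset.sum_eq_single (row p b₀)]
    · refine (congrArg₂ (· * ·) ((e v _).trans (h.sum_row b₀ v)) (if_pos rfl)).trans ?_
      exact mul_one (M := ℂ) _
    · intro r _ hr
      change _ * (if row p b₀ = r then (1 : ℂ) else 0) = 0
      rw [if_neg hr.symm, mul_zero]
    · simp

end Frame

theorem oneRow_isCoeffSystem {lo hi : ℕ} (h : 1 ≤ lo) :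
    IsCoeffSystem (oneRowSystem lo hi) (oneRow l lo hi) fun _ b => b.1 where
  inj _ := Subtype.val_injective
  mem p r := ⟨fun ⟨b, _⟩ => b.2, fun h => ⟨⟨r, h⟩, rfl⟩⟩
  step p q e b c := ⟨fun _ => rfl, fun _ => trivial⟩
  loop p q hp hq b c := ⟨fun h => h.elim, fun h => by cases h⟩
  one_le_lo _ := h
  alpha_mem r hr := absurd rfl hr

/-- The representation given by two rows between `ω` and the vertices `s`, `t`, joined by `α`. -/
noncomputable def arrowRep (l s t : ℕ) : QuiverRep.{0} ℂ (Vertex l) :=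
  (twoRows l (min s (l + 1)) (max s (l + 1)) (min t (l + 1)) (max t (l + 1))).rep ℂ

theorem twoRows_isCoeffSystem (hs : 1 ≤ s ∧ s ≤ 2 * l + 1) (ht : 1 ≤ t ∧ t ≤ 2 * l + 1) :
    IsCoeffSystem (arrowSystem l s t)
      (twoRows l (min s (l + 1)) (max s (l + 1)) (min t (l + 1)) (max t (l + 1)))
      fun _ b => b.1 where
  inj _ := Subtype.val_injective
  mem p r := by
    constructor
    · rintro ⟨⟨b, hb⟩, rfl⟩
      fin_cases b
      · exact hb
      · exact hb
    · intro h
      refine ⟨⟨r, ?_⟩, rfl⟩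
      fin_cases r
      · exact h
      · exact h
  step p q e b c := Iff.rfl
  loop p q hp hq b c := by
    obtain ⟨b, hb⟩ := b
    obtain ⟨c, hc⟩ := c
    change b = 0 ∧ c = 1 ↔ _
    fin_cases b <;> fin_cases c <;> simp [arrowSystem, twoRowSystem]
  one_le_lo := (arrowSystem_regular hs ht).one_le_lo
  alpha_mem r _ := arrowSystem_mem r

/-! #### The representations of the list are presented by standard forms -/

theorem presents_chain (hε : ε = 1 ∨ ε = -1) (h1 : 1 ≤ i) (h2 : i ≤ j) (h3 : j ≤ l) :
    Presents.{w} ε (.chain i j) ((M l i j).directSum (Mstar l i j)) :=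
  ⟨_, _, _, inferInstance, pairSystem l i j, pairForm hε h1 h2 (by omega),
    detects_chain hε h1 h2 h3, detects_chain hε h1 h2 h3,
    ⟨(oneRow_isCoeffSystem h1).frame.sum
      (oneRow_isCoeffSystem (by simp only [st]; omega)).frame⟩⟩

theorem presents_one (hε : ε = 1 ∨ ε = -1) (h1 : 1 ≤ m) (h2 : m ≤ l + 1)
    (hm : ε = -1 ∨ m ≠ l + 1) :
    Presents.{w} ε (.one m) ((M l m (l + 1)).directSum (Mstar l m (l + 1))) :=
  ⟨_, _, _, inferInstance, pairSystem l m (l + 1), pairForm hε h1 h2 le_rfl,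
    detects_one hε h1 h2 hm, detects_one hε h1 h2 hm,
    ⟨(oneRow_isCoeffSystem h1).frame.sum
      (oneRow_isCoeffSystem (by simp only [st]; omega)).frame⟩⟩

theorem presents_simple : Presents.{w} 1 (.one (l + 1)) (M l (l + 1) (l + 1)) :=
  ⟨_, _, _, inferInstance, _, simpleForm l, detects_simple, detects_simple,
    ⟨(oneRow_isCoeffSystem (by omega)).frame⟩⟩

theorem presents_double (hε : ε = 1 ∨ ε = -1) (hs : 1 ≤ s ∧ s ≤ 2 * l + 1)
    (ht : 1 ≤ t ∧ t ≤ 2 * l + 1) (hst : ε = 1 ∨ s + t ≠ 2 * l + 2) :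
    Presents.{w} ε (.two s t) ((arrowRep l s t).directSum (arrowRep l (st l t) (st l s))) :=
  ⟨_, _, _, inferInstance, doubleSystem l s t, doubleForm hε hs ht,
    detects_double hε hs ht hst, detects_double hε hs ht hst,
    ⟨(twoRows_isCoeffSystem hs ht).frame.sum
      (twoRows_isCoeffSystem (st_mem ht) (st_mem hs)).frame⟩⟩

theorem presents_self (hs : 1 ≤ s) (ht : 1 ≤ t) (hst : s + t = 2 * l + 2) :
    Presents.{w} (-1) (.two s t) (arrowRep l s t) :=
  ⟨_, _, _, inferInstance, _, selfForm hs ht hst, detects_self hs ht hst, detects_self hs ht hst,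
    ⟨(twoRows_isCoeffSystem ⟨hs, by omega⟩ ⟨ht, by omega⟩).frame⟩⟩

/-- The families `D`, `C` and `Z` are one family `arrowRep l s t`, where `s` and `t` are the outer
ends of the rows, on either side of `ω`, and `α` goes from the row of `s` to the row of `t`. -/
theorem Dplus_eq (hi : i ≤ l + 1) (hj : j ≤ l + 1) : Dplus l i j = arrowRep l j i := by
  rw [arrowRep, min_eq_left hi, min_eq_left hj, max_eq_right hi, max_eq_right hj, Dplus]

theorem Dminus_eq (hi : i ≤ l + 1) (hj : j ≤ l + 1) : Dminus l i j = arrowRep l i j := by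
  rw [arrowRep, min_eq_left hi, min_eq_left hj, max_eq_right hi, max_eq_right hj, Dminus]

theorem le_st (hi : i ≤ l + 1) : l + 1 ≤ st l i := by
  simp only [st]
  omega

theorem Cplus_eq (hi : i ≤ l + 1) (hj : j ≤ l + 1) :
    Cplus l i j = arrowRep l (st l i) (st l j) := by
  rw [arrowRep, min_eq_right (le_st hi), min_eq_right (le_st hj), max_eq_left (le_st hi),
    max_eq_left (le_st hj), Cplus]

theorem Cminus_eq (hi : i ≤ l + 1) (hj : j ≤ l + 1) :
    Cminus l i j = arrowRep l (st l j) (st l i) := by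
  rw [arrowRep, min_eq_right (le_st hi), min_eq_right (le_st hj), max_eq_left (le_st hi),
    max_eq_left (le_st hj), Cminus]

theorem Zplus_eq (hi : i ≤ l + 1) (hj : j ≤ l + 1) : Zplus l i j = arrowRep l (st l j) i := by
  rw [arrowRep, min_eq_left hi, max_eq_right hi, min_eq_right (le_st hj), max_eq_left (le_st hj),
    Zplus]

theorem Zminus_eq (hi : i ≤ l + 1) (hj : j ≤ l + 1) : Zminus l i j = arrowRep l i (st l j) := by
  rw [arrowRep, min_eq_left hi, max_eq_right hi, min_eq_right (le_st hj), max_eq_left (le_st hj),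
    Zminus]

theorem st_st (hi : i ≤ 2 * l + 2) : st l (st l i) = i := by
  simp only [st]
  omega

theorem presents_D_plus (hε : ε = 1 ∨ ε = -1) (h1 : 1 ≤ i) (h2 : i ≤ j) (h3 : j ≤ l + 1)
    (h : ε = 1 ∨ (i, j) ≠ (l + 1, l + 1)) :
    Presents.{w} ε (.two j i) ((Dplus l i j).directSum (Cplus l i j)) := by
  rw [Dplus_eq (by omega) h3, Cplus_eq (by omega) h3]
  refine presents_double hε (by omega) (by omega) (h.imp_right fun h h' => h ?_)
  rw [Prod.mk.injEq]
  omega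

theorem presents_D_minus (hε : ε = 1 ∨ ε = -1) (h1 : 1 ≤ i) (h2 : i < j) (h3 : j ≤ l + 1) :
    Presents.{w} ε (.two i j) ((Dminus l i j).directSum (Cminus l i j)) := by
  rw [Dminus_eq (by omega) h3, Cminus_eq (by omega) h3]
  exact presents_double hε (by omega) (by omega) (.inr (by omega))

theorem presents_Z_plus (hε : ε = 1 ∨ ε = -1) (h1 : 1 ≤ i) (h2 : i ≤ l) (h3 : 1 ≤ j) (h4 : j ≤ l)
    (h : ε = 1 ∨ i ≠ j) :
    Presents.{w} ε (.two (st l j) i) ((Zplus l i j).directSum (Zplus l j i)) := by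
  rw [Zplus_eq (by omega) (by omega), Zplus_eq (by omega) (by omega)]
  have := presents_double.{w} (l := l) (s := st l j) (t := i) hε (st_mem (by omega)) (by omega)
    (h.imp_right fun h => by simp only [st]; omega)
  rwa [st_st (by omega)] at this

theorem presents_Z_minus (hε : ε = 1 ∨ ε = -1) (h1 : 1 ≤ i) (h2 : i ≤ l) (h3 : 1 ≤ j) (h4 : j ≤ l)
    (h : ε = 1 ∨ i ≠ j) :
    Presents.{w} ε (.two i (st l j)) ((Zminus l i j).directSum (Zminus l j i)) := by
  rw [Zminus_eq (by omega) (by omega), Zminus_eq (by omega) (by omega)]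
  have := presents_double.{w} (l := l) (s := i) (t := st l j) hε (by omega) (st_mem (by omega))
    (h.imp_right fun h => by simp only [st]; omega)
  rwa [st_st (by omega)] at this

/-- A string module and its dual are summands at the same time. -/
theorem IsEpsRep.has_dual {N : QuiverRep.{w} ℂ (Vertex l)} {B : N.Form} (h : IsEpsRep ε N B)
    (hs : 1 ≤ s ∧ s ≤ 2 * l + 1) (ht : 1 ≤ t ∧ t ≤ 2 * l + 1) (hN : Has N (.two s t)) :
    Has N (.two (st l t) (st l s)) := by
  obtain ⟨v, v', κ, hκ, hv⟩ := h.exists_isDualPair hs ht hN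
  exact h.has_two (st_mem ht).1 (st_mem hs).1 (mul_ne_zero (neg_ne_zero.2 h.eps_ne_zero) hκ)
    (hv.swap h (by omega) (by omega))

theorem presents_of_symplecticList {X : QuiverRep.{0} ℂ (Vertex l)} (hX : SymplecticList l X) :
    ∃ k, Presents.{w} (-1) k X := by
  have hε : (-1 : ℂ) = 1 ∨ (-1 : ℂ) = -1 := .inr rfl
  cases hX with
  | Zp_self i h1 h2 =>
    rw [Zplus_eq (by omega) (by omega)]
    exact ⟨_, presents_self (st_mem (by omega)).1 h1 (by simp only [st]; omega)⟩
  | Zm_self i h1 h2 =>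
    rw [Zminus_eq (by omega) (by omega)]
    exact ⟨_, presents_self h1 (st_mem (by omega)).1 (by simp only [st]; omega)⟩
  | M_Mstar i j h1 h2 h3 =>
    rcases Nat.lt_or_ge l j with hj | hj
    · obtain rfl : j = l + 1 := by omega
      exact ⟨_, presents_one hε h1 h2 (.inl rfl)⟩
    · exact ⟨_, presents_chain hε h1 h2 hj⟩
  | Dp_Cp i j h1 h2 h3 h4 => exact ⟨_, presents_D_plus hε h1 h2 h3 (.inr h4)⟩
  | Dm_Cm i j h1 h2 h3 => exact ⟨_, presents_D_minus hε h1 h2 h3⟩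
  | Dp_last =>
    rw [Dplus_eq le_rfl le_rfl]
    exact ⟨_, presents_self (by omega) (by omega) (by omega)⟩
  | Zp_Zp i j h1 h2 h3 h4 h5 => exact ⟨_, presents_Z_plus hε h1 h2 h3 h4 (.inr h5)⟩
  | Zm_Zm i j h1 h2 h3 h4 h5 => exact ⟨_, presents_Z_minus hε h1 h2 h3 h4 (.inr h5)⟩

theorem presents_of_orthogonalList {X : QuiverRep.{0} ℂ (Vertex l)} (hX : OrthogonalList l X) :
    ∃ k, Presents.{w} 1 k X := by
  have hε : (1 : ℂ) = 1 ∨ (1 : ℂ) = -1 := .inl rfl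
  cases hX with
  | M_Mstar i j h1 h2 h3 h4 =>
    rcases Nat.lt_or_ge l j with hj | hj
    · obtain rfl : j = l + 1 := by omega
      exact ⟨_, presents_one hε h1 h2 (.inr fun h => h4 (by rw [h]))⟩
    · exact ⟨_, presents_chain hε h1 h2 hj⟩
  | Dp_Cp i j h1 h2 h3 => exact ⟨_, presents_D_plus hε h1 h2 h3 (.inl rfl)⟩
  | Dm_Cm i j h1 h2 h3 => exact ⟨_, presents_D_minus hε h1 h2 h3⟩
  | Zp_Zp i j h1 h2 h3 h4 => exact ⟨_, presents_Z_plus hε h1 h2 h3 h4 (.inl rfl)⟩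
  | Zm_Zm i j h1 h2 h3 h4 => exact ⟨_, presents_Z_minus hε h1 h2 h3 h4 (.inl rfl)⟩
  | M_last => exact ⟨_, presents_simple⟩

/-- Of a string module with two rows and its dual, one is of type `D` or `Z`. -/
theorem IsEpsRep.exists_le {N : QuiverRep.{w} ℂ (Vertex l)} {B : N.Form} (h : IsEpsRep ε N B)
    (hs : 1 ≤ s ∧ s ≤ 2 * l + 1) (ht : 1 ≤ t ∧ t ≤ 2 * l + 1) (hN : Has N (.two s t)) :
    ∃ s t, (1 ≤ s ∧ s ≤ 2 * l + 1) ∧ (1 ≤ t ∧ t ≤ 2 * l + 1) ∧ Has N (.two s t) ∧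
      ((s ≤ l + 1 ∧ t ≤ l + 1) ∨ (s ≤ l ∧ l + 2 ≤ t) ∨ (t ≤ l ∧ l + 2 ≤ s)) := by
  by_cases hst : l + 1 ≤ s ∧ l + 1 ≤ t
  · exact ⟨_, _, st_mem ht, st_mem hs, h.has_dual hs ht hN, .inl (by simp only [st]; omega)⟩
  · exact ⟨s, t, hs, ht, hN, by omega⟩

theorem exists_mem_symplecticList {N : QuiverRep.{w} ℂ (Vertex l)} {B : N.Form}
    (h : IsEpsRep (-1) N B) {k : Kind} (hk : Kind.Valid l k) (hN : Has N k) :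
    ∃ k' X, SymplecticList l X ∧ Presents.{w} (-1) k' X ∧ Has N k' := by
  have hε : (-1 : ℂ) = 1 ∨ (-1 : ℂ) = -1 := .inr rfl
  cases k with
  | chain i j =>
    obtain ⟨h1, h2, h3⟩ := hk
    exact ⟨_, _, .M_Mstar i j h1 h2 (by omega), presents_chain hε h1 h2 h3, hN⟩
  | one m =>
    exact ⟨_, _, .M_Mstar m (l + 1) hk.1 hk.2 le_rfl, presents_one hε hk.1 hk.2 (.inl rfl), hN⟩
  | two s t =>
    -- Replacing the type by its dual if necessary leaves both ends up to `ω` (type `D`), or one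
    -- strictly on each side (type `Z`).
    obtain ⟨s, t, hs, ht, hN, hc⟩ := h.exists_le ⟨hk.1, hk.2.1⟩ hk.2.2 hN
    rcases hc with ⟨h1, h2⟩ | ⟨h1, h2⟩ | ⟨h1, h2⟩
    · rcases Nat.lt_or_ge s t with hlt | hle
      · exact ⟨_, _, .Dm_Cm s t hs.1 hlt h2, presents_D_minus hε hs.1 hlt h2, hN⟩
      · by_cases hl : t = l + 1
        · obtain rfl : s = l + 1 := by omega
          subst hl
          refine ⟨_, _, .Dp_last, ?_, hN⟩
          rw [Dplus_eq le_rfl le_rfl]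
          exact presents_self (by omega) (by omega) (by omega)
        · have hne : (t, s) ≠ (l + 1, l + 1) := fun e => hl (Prod.ext_iff.1 e).1
          exact ⟨_, _, .Dp_Cp t s ht.1 hle h1 hne, presents_D_plus hε ht.1 hle h1 (.inr hne), hN⟩
    · rw [← st_st (l := l) (i := t) (by omega)] at hN
      have g1 : 1 ≤ st l t := (st_mem ht).1
      have g2 : st l t ≤ l := by simp only [st]; omega
      by_cases he : s = st l t
      · refine ⟨_, _, .Zm_self s hs.1 h1, ?_, hN⟩
        rw [Zminus_eq (by omega) (by omega), ← he]
        exact presents_self hs.1 (st_mem hs).1 (by simp only [st]; omega)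
      · exact ⟨_, _, .Zm_Zm s (st l t) hs.1 h1 g1 g2 he,
          presents_Z_minus hε hs.1 h1 g1 g2 (.inr he), hN⟩
    · rw [← st_st (l := l) (i := s) (by omega)] at hN
      have g1 : 1 ≤ st l s := (st_mem hs).1
      have g2 : st l s ≤ l := by simp only [st]; omega
      by_cases he : t = st l s
      · refine ⟨_, _, .Zp_self t ht.1 h1, ?_, hN⟩
        rw [Zplus_eq (by omega) (by omega), ← he]
        exact presents_self (st_mem ht).1 ht.1 (by simp only [st]; omega)
      · exact ⟨_, _, .Zp_Zp t (st l s) ht.1 h1 g1 g2 he,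
          presents_Z_plus hε ht.1 h1 g1 g2 (.inr he), hN⟩

theorem exists_mem_orthogonalList {N : QuiverRep.{w} ℂ (Vertex l)} {B : N.Form}
    (h : IsEpsRep 1 N B) {k : Kind} (hk : Kind.Valid l k) (hN : Has N k) :
    ∃ k' X, OrthogonalList l X ∧ Presents.{w} 1 k' X ∧ Has N k' := by
  have hε : (1 : ℂ) = 1 ∨ (1 : ℂ) = -1 := .inl rfl
  cases k with
  | chain i j =>
    obtain ⟨h1, h2, h3⟩ := hk
    exact ⟨_, _, .M_Mstar i j h1 h2 (by omega) (fun e => by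
      have := (Prod.ext_iff.1 e).2
      simp only at this
      omega), presents_chain hε h1 h2 h3, hN⟩
  | one m =>
    by_cases hm : m = l + 1
    · subst hm
      exact ⟨_, _, .M_last, presents_simple, hN⟩
    · exact ⟨_, _, .M_Mstar m (l + 1) hk.1 hk.2 le_rfl (fun e => hm (Prod.ext_iff.1 e).1),
        presents_one hε hk.1 hk.2 (.inr hm), hN⟩
  | two s t =>
    obtain ⟨s, t, hs, ht, hN, hc⟩ := h.exists_le ⟨hk.1, hk.2.1⟩ hk.2.2 hN
    rcases hc with ⟨h1, h2⟩ | ⟨h1, h2⟩ | ⟨h1, h2⟩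
    · rcases Nat.lt_or_ge s t with hlt | hle
      · exact ⟨_, _, .Dm_Cm s t hs.1 hlt h2, presents_D_minus hε hs.1 hlt h2, hN⟩
      · exact ⟨_, _, .Dp_Cp t s ht.1 hle h1, presents_D_plus hε ht.1 hle h1 (.inl rfl), hN⟩
    · rw [← st_st (l := l) (i := t) (by omega)] at hN
      have g1 : 1 ≤ st l t := (st_mem ht).1
      have g2 : st l t ≤ l := by simp only [st]; omega
      exact ⟨_, _, .Zm_Zm s (st l t) hs.1 h1 g1 g2,
        presents_Z_minus hε hs.1 h1 g1 g2 (.inl rfl), hN⟩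
    · rw [← st_st (l := l) (i := s) (by omega)] at hN
      have g1 : 1 ≤ st l s := (st_mem hs).1
      have g2 : st l s ≤ l := by simp only [st]; omega
      exact ⟨_, _, .Zp_Zp t (st l s) ht.1 h1 g1 g2,
        presents_Z_plus hε ht.1 h1 g1 g2 (.inl rfl), hN⟩

/-! ### The symplectic and orthogonal cases as `ε = -1` and `ε = 1` -/

theorem isSymplecticRep_iff {N : QuiverRep.{w} ℂ (Vertex l)} {B : N.Form} :
    IsSymplecticRep N B ↔ IsEpsRep (-1) N B :=
  ⟨fun h => ⟨h.1, h.2.1, fun x y => by rw [h.2.2 x y]; ring, .inr rfl⟩,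
    fun h => ⟨h.bound, h.symm, fun x y => by rw [h.eps x y]; ring⟩⟩

theorem isOrthogonalRep_iff {N : QuiverRep.{w} ℂ (Vertex l)} {B : N.Form} :
    IsOrthogonalRep N B ↔ IsEpsRep 1 N B :=
  ⟨fun h => ⟨h.1, h.2.1, fun x y => by rw [h.2.2 x y]; ring, .inl rfl⟩,
    fun h => ⟨h.bound, h.symm, fun x y => by rw [h.eps x y]; ring⟩⟩

end Lists

end AL

theorem mainTheorem9 (l : ℕ) :
    ((∀ (N : QuiverRep.{w} ℂ (AL.Vertex l)) (B : N.Form), AL.IsSymplecticRep N B →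
        (N.FormIndecomposable B ↔
          ∃ X : QuiverRep.{0} ℂ (AL.Vertex l), AL.SymplecticList l X ∧ N.Isomorphic X)) ∧
      (∀ X : QuiverRep.{0} ℂ (AL.Vertex l), AL.SymplecticList l X →
        ∃ B : X.Form, AL.IsSymplecticRep X B) ∧
      (∀ (N N' : QuiverRep.{w} ℂ (AL.Vertex l)) (B : N.Form) (B' : N'.Form),
        AL.IsSymplecticRep N B → AL.IsSymplecticRep N' B' →
        N.FormIndecomposable B → N'.FormIndecomposable B' →
        N.Isomorphic N' → N.Isometric B N' B')) ∧
    ((∀ (N : QuiverRep.{w} ℂ (AL.Vertex l)) (B : N.Form), AL.IsOrthogonalRep N B →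
        (N.FormIndecomposable B ↔
          ∃ X : QuiverRep.{0} ℂ (AL.Vertex l), AL.OrthogonalList l X ∧ N.Isomorphic X)) ∧
      (∀ X : QuiverRep.{0} ℂ (AL.Vertex l), AL.OrthogonalList l X →
        ∃ B : X.Form, AL.IsOrthogonalRep X B) ∧
      (∀ (N N' : QuiverRep.{w} ℂ (AL.Vertex l)) (B : N.Form) (B' : N'.Form),
        AL.IsOrthogonalRep N B → AL.IsOrthogonalRep N' B' →
        N.FormIndecomposable B → N'.FormIndecomposable B' →
        N.Isomorphic N' → N.Isometric B N' B')) := by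
  simp only [AL.isSymplecticRep_iff, AL.isOrthogonalRep_iff]
  exact ⟨AL.classification (.inr rfl) _ (fun _ => AL.presents_of_symplecticList)
      fun _ _ h _ => AL.exists_mem_symplecticList h,
    AL.classification (.inl rfl) _ (fun _ => AL.presents_of_orthogonalList)
      fun _ _ h _ => AL.exists_mem_orthogonalList h⟩
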